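/- Let $\gamma=\mathrm{diag}(1,1,1,1,-1)$ and let $\mathfrak g=\{x\in M_5(\mathbb C): x^{\tau}\gamma=-\gamma x\}\cong\mathfrak{so}(5,\mathbb C)$ be the complexification of $\mathfrak{so}(4,1)$. Let $\mathfrak p=\{x\in\mathfrak g: x^\tau=x\}$ be the $(-1)$-eigenspace of the Cartan involution $\theta(x)=-x^{\tau}$, and let $K=\{\mathrm{diag}(k,1): k\in SO(4)\}$ be the maximal compact subgroup of $SO_e(4,1)$. It acts on $\mathfrak g$ and $\mathfrak p$ by conjugation, and hence by algebra automorphisms on the tensor product algebra $S(\mathfrak g)\otimes\bigwedge(\mathfrak p)$ of the symmetric algebra of $\mathfrak g$ and the exterior algebra of $\mathfrak p$ over $\mathbb C$. With $e_{kl}$ the matrix units, put \begin{gather*} H_1=ie_{12}-ie_{21},\quad H_2=ie_{34}-ie_{43},\\ E_1=\tfrac12(e_{13}-e_{24}-ie_{23}-ie_{14}-e_{31}+e_{42}+ie_{32}+ie_{41}),\\ E_2=\tfrac12(e_{13}+e_{24}-ie_{23}+ie_{14}-e_{31}-e_{42}+ie_{32}-ie_{41}),\\ F_1=-\tfrac12(e_{13}-e_{24}+ie_{23}+ie_{14}-e_{31}+e_{42}-ie_{32}-ie_{41}),\\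 F_2=-\tfrac12(e_{13}+e_{24}+ie_{23}-ie_{14}-e_{31}-e_{42}-ie_{32}+ie_{41}),\\ E_3=e_{15}-ie_{25}+e_{51}-ie_{52},\quad E_4=e_{35}-ie_{45}+e_{53}-ie_{54},\\ F_3=e_{15}+ie_{25}+e_{51}+ie_{52},\quad F_4=e_{35}+ie_{45}+e_{53}+ie_{54}. \end{gather*} These ten matrices form a basis of $\mathfrak g$, and $E_3,E_4,F_3,F_4$ form a basis of $\mathfrak p$. In $S(\mathfrak g)\otimes\bigwedge(\mathfrak p)$, where $S(\mathfrak g)$ is identified with $S(\mathfrak g)\otimes 1$, define \begin{align*} a_1&=(H_1+H_2)^2+4E_1F_1,\qquad a_2=(H_1-H_2)^2+4E_2F_2,\qquad b=E_3F_3+E_4F_4,\\ c&=2(E_1E_2F_3^2-E_1F_2F_4^2+F_1F_2E_3^2-F_1E_2E_4^2)-2(H_1-H_2)(E_1F_3F_4+F_1E_3E_4)\\ &\quad-2(H_1+H_2)(F_2E_3F_4+E_2F_3E_4)-(H_1-H_2)(H_1+H_2)(E_3F_3-E_4F_4),\\ D&=E_3\otimes F_3+E_4\otimes F_4+F_3\otimes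 E_3+F_4\otimes E_4,\\ d&=2E_1\otimes F_3\wedge F_4-(H_1+H_2)\otimes(E_3\wedge F_3+E_4\wedge F_4)-2F_1\otimes E_3\wedge E_4,\\ e&=2E_2\otimes E_4\wedge F_3+(H_1-H_2)\otimes(E_3\wedge F_3-E_4\wedge F_4)+2F_2\otimes E_3\wedge F_4,\\ f&=2(E_1F_3\otimes F_4-E_1F_4\otimes F_3)-(H_1+H_2)(E_3\otimes F_3+E_4\otimes F_4-F_3\otimes E_3-F_4\otimes E_4)\\ &\quad-2(F_1E_3\otimes E_4-F_1E_4\otimes E_3),\\ g&=-2(E_2F_3\otimes E_4-E_2E_4\otimes F_3)+(H_1-H_2)(E_3\otimes F_3-E_4\otimes F_4-F_3\otimes E_3+F_4\otimes E_4)\\ &\quad+2(F_2E_3\otimes F_4-F_2F_4\otimes E_3),\\ h&=2(E_1E_2F_3\otimes F_3-E_1F_2F_4\otimes F_4+F_1F_2E_3\otimes E_3-F_1E_2E_4\otimes E_4)\\ &\quad-(H_1-H_2)(E_1F_3\otimes F_4+E_1F_4\otimes F_3+F_1E_3\otimes E_4+F_1E_4\otimes E_3)\\ &\quad-(H_1+H_2)(F_2E_3\otimes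 F_4+F_2F_4\otimes E_3+E_2F_3\otimes E_4+E_2E_4\otimes F_3)\\ &\quad-\tfrac12(H_1-H_2)(H_1+H_2)(E_3\otimes F_3+F_3\otimes E_3-E_4\otimes F_4-F_4\otimes E_4),\\ i&=1\otimes E_3\wedge E_4\wedge F_3\wedge F_4,\\ j&=E_3\otimes E_4\wedge F_3\wedge F_4-E_4\otimes E_3\wedge F_3\wedge F_4+F_3\otimes E_3\wedge E_4\wedge F_4-F_4\otimes E_3\wedge E_4\wedge F_3. \end{align*} Let $$S=\{a_1^{n_1}a_2^{n_2}b^{n_3}c^{n_4}: n_1,n_2,n_3,n_4\in\mathbb N_0\},\qquad T=\{1,D,d,e,f,g,h,i,j,Dd,De,Df,Dg,fg,Dh,dg\}.$$ Then $S$ and $T$ are subsets of the algebra of invariants $(S(\mathfrak g)\otimes\bigwedge(\mathfrak p))^K$, and the set $S\cdot T$ of products of elements of $S$ and $T$ is a basis of $(S(\mathfrak g)\otimes\bigwedge(\mathfrak p))^K$ over $\mathbb C$. Moreover, the products $a_1^{n_1}a_2^{n_2}b^{n_3}c^{n_4}\,t$, indexed by $(n_1,n_2,n_3,n_4)\in\mathbb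 N_0^4$ and the sixteen listed elements $t$ of $T$, are linearly independent, and in particular pairwise distinct. -/

import Mathlib

open scoped TensorProduct Matrix Pointwise

attribute [local instance] LieRing.ofAssociativeRing

noncomputable section

namespace SO41

/-- Row and column indices of `5 × 5` matrices, split as `4 + 1`. -/
abbrev Idx : Type := Fin 4 ⊕ Fin 1

/-- Complex `5 × 5` matrices. -/
abbrev Mat : Type := Matrix Idx Idx ℂ

/-- The five indices, in the usual order. -/
abbrev i₁ : Idx := Sum.inl 0
abbrev i₂ : Idx := Sum.inl 1
abbrev i₃ : Idx := Sum.inl 2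
abbrev i₄ : Idx := Sum.inl 3
abbrev i₅ : Idx := Sum.inr 0

/-- The matrix unit `e_{kl}`. -/
def E (k l : Idx) : Mat := Matrix.single k l 1

/-- The Lie algebra `𝔤`, the complexification of `𝔰𝔬(4,1)`: complex matrices `x` with
`xᵀ γ = - γ x`, where `γ = diag(1,1,1,1,-1)`. -/
abbrev 𝔤 : LieSubalgebra ℂ Mat := LieAlgebra.Orthogonal.so' (Fin 4) (Fin 1) ℂ

/-- `γ = diag(1,1,1,1,-1)`. -/
abbrev γ : Mat := LieAlgebra.Orthogonal.indefiniteDiagonal (Fin 4) (Fin 1) ℂ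

theorem mem_𝔤_iff (x : Mat) : x ∈ 𝔤 ↔ xᵀ * γ = -(γ * x) := by
  change x ∈ skewAdjointMatricesLieSubalgebra γ ↔ _
  rw [mem_skewAdjointMatricesLieSubalgebra, mem_skewAdjointMatricesSubmodule, Matrix.IsSkewAdjoint, Matrix.IsAdjointPair, mul_neg]

/-- The `-1`-eigenspace `𝔭` in `𝔤` of the Cartan involution `θ(x) = -xᵀ`. -/
def 𝔭 : Submodule ℂ 𝔤 where
  carrier := {x | (x : Mat)ᵀ = x}
  add_mem' {x y} hx hy := by
    simp only [Set.mem_ofPred_eq] at hx hy ⊢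
    simp [hx, hy]
  zero_mem' := by simp
  smul_mem' c x hx := by
    simp only [Set.mem_ofPred_eq] at hx ⊢
    simp [hx]

theorem mem_𝔭_iff (x : 𝔤) : x ∈ 𝔭 ↔ (x : Mat)ᵀ = x := Iff.rfl

/-! ### The basis of `𝔤` -/

open Complex in
def matH₁ : Mat := I • E i₁ i₂ - I • E i₂ i₁
open Complex in
def matH₂ : Mat := I • E i₃ i₄ - I • E i₄ i₃
open Complex in
def matE₁ : Mat := (1 / 2 : ℂ) • (E i₁ i₃ - E i₂ i₄ - I • E i₂ i₃ - I • E i₁ i₄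
  - E i₃ i₁ + E i₄ i₂ + I • E i₃ i₂ + I • E i₄ i₁)
open Complex in
def matE₂ : Mat := (1 / 2 : ℂ) • (E i₁ i₃ + E i₂ i₄ - I • E i₂ i₃ + I • E i₁ i₄
  - E i₃ i₁ - E i₄ i₂ + I • E i₃ i₂ - I • E i₄ i₁)
open Complex in
def matF₁ : Mat := (-1 / 2 : ℂ) • (E i₁ i₃ - E i₂ i₄ + I • E i₂ i₃ + I • E i₁ i₄
  - E i₃ i₁ + E i₄ i₂ - I • E i₃ i₂ - I • E i₄ i₁)
open Complex in
def matF₂ : Mat := (-1 / 2 : ℂ) • (E i₁ i₃ + E i₂ i₄ + I • E i₂ i₃ - I • E i₁ i₄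
  - E i₃ i₁ - E i₄ i₂ - I • E i₃ i₂ + I • E i₄ i₁)
open Complex in
def matE₃ : Mat := E i₁ i₅ - I • E i₂ i₅ + E i₅ i₁ - I • E i₅ i₂
open Complex in
def matE₄ : Mat := E i₃ i₅ - I • E i₄ i₅ + E i₅ i₃ - I • E i₅ i₄
open Complex in
def matF₃ : Mat := E i₁ i₅ + I • E i₂ i₅ + E i₅ i₁ + I • E i₅ i₂
open Complex in
def matF₄ : Mat := E i₃ i₅ + I • E i₄ i₅ + E i₅ i₃ + I • E i₅ i₄

theorem E_skew (k l : Fin 4) : E (.inl k) (.inl l) - E (.inl l) (.inl k) ∈ 𝔤 := by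
  rw [mem_𝔤_iff]
  ext a b
  simp only [γ, LieAlgebra.Orthogonal.indefiniteDiagonal, Matrix.mul_diagonal,
    Matrix.diagonal_mul, Matrix.neg_apply, Matrix.transpose_apply, E, Matrix.sub_apply,
    Matrix.single_apply]
  rcases a with a | a <;> rcases b with b | b <;> simp
  grind

theorem E_symm (k : Fin 4) : E (.inl k) i₅ + E i₅ (.inl k) ∈ 𝔤 := by
  rw [mem_𝔤_iff]
  ext a b
  simp only [γ, LieAlgebra.Orthogonal.indefiniteDiagonal, Matrix.mul_diagonal,
    Matrix.diagonal_mul, Matrix.neg_apply, Matrix.transpose_apply, E, Matrix.add_apply,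
    Matrix.single_apply]
  rcases a with a | a <;> rcases b with b | b <;> simp [Subsingleton.elim _ (0 : Fin 1), apply_ite]

theorem matH₁_mem : matH₁ ∈ 𝔤 := by
  convert 𝔤.smul_mem Complex.I (E_skew 0 1) using 1
  simp only [matH₁]; module

theorem matH₂_mem : matH₂ ∈ 𝔤 := by
  convert 𝔤.smul_mem Complex.I (E_skew 2 3) using 1
  simp only [matH₂]; module

theorem skew_comb_mem (a b c d : ℂ) :
    a • (E i₁ i₃ - E i₃ i₁) + b • (E i₂ i₄ - E i₄ i₂) + c • (E i₂ i₃ - E i₃ i₂)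
      + d • (E i₁ i₄ - E i₄ i₁) ∈ 𝔤 :=
  add_mem (add_mem (add_mem (𝔤.smul_mem a (E_skew 0 2)) (𝔤.smul_mem b (E_skew 1 3)))
    (𝔤.smul_mem c (E_skew 1 2))) (𝔤.smul_mem d (E_skew 0 3))

theorem matE₁_mem : matE₁ ∈ 𝔤 := by
  convert skew_comb_mem (1 / 2) (-1 / 2) (-Complex.I / 2) (-Complex.I / 2) using 1
  simp only [matE₁]; module

theorem matE₂_mem : matE₂ ∈ 𝔤 := by
  convert skew_comb_mem (1 / 2) (1 / 2) (-Complex.I / 2) (Complex.I / 2) using 1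
  simp only [matE₂]; module

theorem matF₁_mem : matF₁ ∈ 𝔤 := by
  convert skew_comb_mem (-1 / 2) (1 / 2) (-Complex.I / 2) (-Complex.I / 2) using 1
  simp only [matF₁]; module

theorem matF₂_mem : matF₂ ∈ 𝔤 := by
  convert skew_comb_mem (-1 / 2) (-1 / 2) (-Complex.I / 2) (Complex.I / 2) using 1
  simp only [matF₂]; module

theorem symm_comb_mem (k l : Fin 4) (a : ℂ) :
    (E (.inl k) i₅ + E i₅ (.inl k)) + a • (E (.inl l) i₅ + E i₅ (.inl l)) ∈ 𝔤 :=
  add_mem (E_symm k) (𝔤.smul_mem a (E_symm l))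

theorem matE₃_mem : matE₃ ∈ 𝔤 := by
  convert symm_comb_mem 0 1 (-Complex.I) using 1
  simp only [matE₃]; module

theorem matE₄_mem : matE₄ ∈ 𝔤 := by
  convert symm_comb_mem 2 3 (-Complex.I) using 1
  simp only [matE₄]; module

theorem matF₃_mem : matF₃ ∈ 𝔤 := by
  convert symm_comb_mem 0 1 Complex.I using 1
  simp only [matF₃]; module

theorem matF₄_mem : matF₄ ∈ 𝔤 := by
  convert symm_comb_mem 2 3 Complex.I using 1
  simp only [matF₄]; module

theorem matE₃_transpose : matE₃ᵀ = matE₃ := by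
  simp only [matE₃, E, Matrix.transpose_sub, Matrix.transpose_add, Matrix.transpose_smul,
    Matrix.transpose_single]; module

theorem matE₄_transpose : matE₄ᵀ = matE₄ := by
  simp only [matE₄, E, Matrix.transpose_sub, Matrix.transpose_add, Matrix.transpose_smul,
    Matrix.transpose_single]; module

theorem matF₃_transpose : matF₃ᵀ = matF₃ := by
  simp only [matF₃, E, Matrix.transpose_add, Matrix.transpose_smul,
    Matrix.transpose_single]; module

theorem matF₄_transpose : matF₄ᵀ = matF₄ := by
  simp only [matF₄, E, Matrix.transpose_add, Matrix.transpose_smul,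
    Matrix.transpose_single]; module

/-! ### The algebra `S(𝔤) ⊗ Λ(𝔭)` and the action of `K` -/

/-- The symmetric algebra `S(𝔤)`. -/
abbrev Sg : Type := SymmetricAlgebra ℂ 𝔤

/-- The exterior algebra `Λ(𝔭)`. -/
abbrev Λp : Type := ExteriorAlgebra ℂ 𝔭

/-- The algebra `S(𝔤) ⊗ Λ(𝔭)`, with product `(x ⊗ y)(x' ⊗ y') = x x' ⊗ y ∧ y'`. -/
abbrev A : Type := Sg ⊗[ℂ] Λp

/-- The group `SO(4)`. -/
abbrev SO4 : Type := Matrix.specialOrthogonalGroup (Fin 4) ℝ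

/-- The embedding `k ↦ diag(k, 1)` of `SO(4)`. Its image is `K`, the maximal compact subgroup of
the identity component of `SO(4,1)`. -/
def embK (k : SO4) : Mat :=
  Matrix.fromBlocks ((k : Matrix (Fin 4) (Fin 4) ℝ).map Complex.ofReal) 0 0 1

theorem transpose_mul_self (k : SO4) :
    (k : Matrix (Fin 4) (Fin 4) ℝ)ᵀ * (k : Matrix (Fin 4) (Fin 4) ℝ) = 1 :=
  (Matrix.mem_orthogonalGroup_iff' (Fin 4) ℝ).1 (Matrix.mem_specialOrthogonalGroup_iff.1 k.2).1

theorem coe_inv (k : SO4) :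
    ((k⁻¹ : SO4) : Matrix (Fin 4) (Fin 4) ℝ) = (k : Matrix (Fin 4) (Fin 4) ℝ)ᵀ := rfl

theorem embK_inv (k : SO4) : embK k⁻¹ = (embK k)ᵀ := by
  simp [embK, coe_inv, Matrix.fromBlocks_transpose, Matrix.transpose_map]

theorem embK_comm_γ (k : SO4) : embK k * γ = γ * embK k := by
  ext a b
  simp only [γ, LieAlgebra.Orthogonal.indefiniteDiagonal, Matrix.mul_diagonal,
    Matrix.diagonal_mul, embK]
  rcases a with a | a <;> rcases b with b | b <;> simp

theorem conj_mem (k : SO4) (x : Mat) (hx : x ∈ 𝔤) : embK k * x * embK k⁻¹ ∈ 𝔤 := by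
  rw [mem_𝔤_iff] at hx ⊢
  have h2 := embK_comm_γ k
  have h1 : (embK k)ᵀ * γ = γ * (embK k)ᵀ := by
    rw [← embK_inv]; exact embK_comm_γ k⁻¹
  rw [embK_inv, Matrix.transpose_mul, Matrix.transpose_mul, Matrix.transpose_transpose]
  calc embK k * (xᵀ * (embK k)ᵀ) * γ
      = embK k * (xᵀ * γ) * (embK k)ᵀ := by
        simp only [Matrix.mul_assoc, h1]
    _ = -((embK k * γ) * x * (embK k)ᵀ) := by
        rw [hx]; simp only [Matrix.mul_assoc, Matrix.neg_mul, Matrix.mul_neg]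
    _ = _ := by rw [h2]; simp only [Matrix.mul_assoc]

/-- The adjoint action `Ad(k) x = k x k⁻¹` of `K` on `𝔤`. -/
def Ad (k : SO4) : 𝔤 →ₗ[ℂ] 𝔤 where
  toFun x := ⟨embK k * x * embK k⁻¹, conj_mem k x x.2⟩
  map_add' x y := Subtype.ext (by simp [Matrix.mul_add, Matrix.add_mul])
  map_smul' c x := Subtype.ext (by simp)

theorem Ad_mem_𝔭 (k : SO4) (x : 𝔤) (hx : x ∈ 𝔭) : Ad k x ∈ 𝔭 := by
  rw [mem_𝔭_iff] at hx ⊢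
  simp only [Ad, LinearMap.coe_mk, AddHom.coe_mk, embK_inv, Matrix.transpose_mul,
    Matrix.transpose_transpose, hx, Matrix.mul_assoc]

/-- The adjoint action of `K` on `𝔭`. -/
def Adp (k : SO4) : 𝔭 →ₗ[ℂ] 𝔭 := (Ad k).restrict (Ad_mem_𝔭 k)

/-- The action of `K` on `S(𝔤) ⊗ Λ(𝔭)`, the tensor product of the functorial extensions of the
adjoint actions. -/
def act (k : SO4) : A →ₐ[ℂ] A :=
  Algebra.TensorProduct.map
    (SymmetricAlgebra.lift (SymmetricAlgebra.ι ℂ 𝔤 ∘ₗ Ad k))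
    (ExteriorAlgebra.map (Adp k))

/-- The algebra of invariants `(S(𝔤) ⊗ Λ(𝔭))^K`. -/
def invariants : Subalgebra ℂ A where
  carrier := {x | ∀ k : SO4, act k x = x}
  mul_mem' hx hy k := by rw [map_mul, hx k, hy k]
  add_mem' hx hy k := by rw [map_add, hx k, hy k]
  algebraMap_mem' r k := (act k).commutes r

/-! ### The basis vectors of `𝔤` in `S(𝔤)`, and those of `𝔭` in `Λ(𝔭)` -/

def H₁ : Sg := SymmetricAlgebra.ι ℂ 𝔤 ⟨matH₁, matH₁_mem⟩
def H₂ : Sg := SymmetricAlgebra.ι ℂ 𝔤 ⟨matH₂, matH₂_mem⟩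
def E₁ : Sg := SymmetricAlgebra.ι ℂ 𝔤 ⟨matE₁, matE₁_mem⟩
def E₂ : Sg := SymmetricAlgebra.ι ℂ 𝔤 ⟨matE₂, matE₂_mem⟩
def E₃ : Sg := SymmetricAlgebra.ι ℂ 𝔤 ⟨matE₃, matE₃_mem⟩
def E₄ : Sg := SymmetricAlgebra.ι ℂ 𝔤 ⟨matE₄, matE₄_mem⟩
def F₁ : Sg := SymmetricAlgebra.ι ℂ 𝔤 ⟨matF₁, matF₁_mem⟩
def F₂ : Sg := SymmetricAlgebra.ι ℂ 𝔤 ⟨matF₂, matF₂_mem⟩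
def F₃ : Sg := SymmetricAlgebra.ι ℂ 𝔤 ⟨matF₃, matF₃_mem⟩
def F₄ : Sg := SymmetricAlgebra.ι ℂ 𝔤 ⟨matF₄, matF₄_mem⟩

/-- `E₃`, `E₄`, `F₃`, `F₄` as elements of `Λ(𝔭)`. -/
def wE₃ : Λp := ExteriorAlgebra.ι ℂ (⟨⟨matE₃, matE₃_mem⟩, matE₃_transpose⟩ : 𝔭)
def wE₄ : Λp := ExteriorAlgebra.ι ℂ (⟨⟨matE₄, matE₄_mem⟩, matE₄_transpose⟩ : 𝔭)
def wF₃ : Λp := ExteriorAlgebra.ι ℂ (⟨⟨matF₃, matF₃_mem⟩, matF₃_transpose⟩ : 𝔭)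
def wF₄ : Λp := ExteriorAlgebra.ι ℂ (⟨⟨matF₄, matF₄_mem⟩, matF₄_transpose⟩ : 𝔭)

/-! ### The invariants -/

def a₁ : A := ((H₁ + H₂) ^ 2 + 4 * E₁ * F₁) ⊗ₜ 1

def a₂ : A := ((H₁ - H₂) ^ 2 + 4 * E₂ * F₂) ⊗ₜ 1

def b : A := (E₃ * F₃ + E₄ * F₄) ⊗ₜ 1

def c : A :=
  (2 * (E₁ * E₂ * F₃ ^ 2 - E₁ * F₂ * F₄ ^ 2 + F₁ * F₂ * E₃ ^ 2 - F₁ * E₂ * E₄ ^ 2)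
    - 2 * (H₁ - H₂) * (E₁ * F₃ * F₄ + F₁ * E₃ * E₄)
    - 2 * (H₁ + H₂) * (F₂ * E₃ * F₄ + E₂ * F₃ * E₄)
    - (H₁ - H₂) * (H₁ + H₂) * (E₃ * F₃ - E₄ * F₄)) ⊗ₜ 1

def D : A := E₃ ⊗ₜ wF₃ + E₄ ⊗ₜ wF₄ + F₃ ⊗ₜ wE₃ + F₄ ⊗ₜ wE₄

def d : A :=
  (2 * E₁) ⊗ₜ (wF₃ * wF₄) - (H₁ + H₂) ⊗ₜ (wE₃ * wF₃ + wE₄ * wF₄) - (2 * F₁) ⊗ₜ (wE₃ * wE₄)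

def e : A :=
  (2 * E₂) ⊗ₜ (wE₄ * wF₃) + (H₁ - H₂) ⊗ₜ (wE₃ * wF₃ - wE₄ * wF₄) + (2 * F₂) ⊗ₜ (wE₃ * wF₄)

def f : A :=
  2 * ((E₁ * F₃) ⊗ₜ wF₄ - (E₁ * F₄) ⊗ₜ wF₃)
    - ((H₁ + H₂) ⊗ₜ 1) * (E₃ ⊗ₜ wF₃ + E₄ ⊗ₜ wF₄ - F₃ ⊗ₜ wE₃ - F₄ ⊗ₜ wE₄)
    - 2 * ((F₁ * E₃) ⊗ₜ wE₄ - (F₁ * E₄) ⊗ₜ wE₃)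

def g : A :=
  -2 * ((E₂ * F₃) ⊗ₜ wE₄ - (E₂ * E₄) ⊗ₜ wF₃)
    + ((H₁ - H₂) ⊗ₜ 1) * (E₃ ⊗ₜ wF₃ - E₄ ⊗ₜ wF₄ - F₃ ⊗ₜ wE₃ + F₄ ⊗ₜ wE₄)
    + 2 * ((F₂ * E₃) ⊗ₜ wF₄ - (F₂ * F₄) ⊗ₜ wE₃)

def h : A :=
  2 * ((E₁ * E₂ * F₃) ⊗ₜ wF₃ - (E₁ * F₂ * F₄) ⊗ₜ wF₄
      + (F₁ * F₂ * E₃) ⊗ₜ wE₃ - (F₁ * E₂ * E₄) ⊗ₜ wE₄)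
    - ((H₁ - H₂) ⊗ₜ 1) * ((E₁ * F₃) ⊗ₜ wF₄ + (E₁ * F₄) ⊗ₜ wF₃
      + (F₁ * E₃) ⊗ₜ wE₄ + (F₁ * E₄) ⊗ₜ wE₃)
    - ((H₁ + H₂) ⊗ₜ 1) * ((F₂ * E₃) ⊗ₜ wF₄ + (F₂ * F₄) ⊗ₜ wE₃
      + (E₂ * F₃) ⊗ₜ wE₄ + (E₂ * E₄) ⊗ₜ wF₃)
    - (1 / 2 : ℂ) • ((((H₁ - H₂) * (H₁ + H₂)) ⊗ₜ 1)
      * (E₃ ⊗ₜ wF₃ + F₃ ⊗ₜ wE₃ - E₄ ⊗ₜ wF₄ - F₄ ⊗ₜ wE₄))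

def i : A := 1 ⊗ₜ (wE₃ * wE₄ * wF₃ * wF₄)

def j : A :=
  E₃ ⊗ₜ (wE₄ * wF₃ * wF₄) - E₄ ⊗ₜ (wE₃ * wF₃ * wF₄)
    + F₃ ⊗ₜ (wE₃ * wE₄ * wF₄) - F₄ ⊗ₜ (wE₃ * wE₄ * wF₃)

/-- The monomial `a₁^{n₁} a₂^{n₂} b^{n₃} c^{n₄}`. -/
def s (n₁ n₂ n₃ n₄ : ℕ) : A := a₁ ^ n₁ * a₂ ^ n₂ * b ^ n₃ * c ^ n₄

/-- The list of the sixteen elements of `T`. -/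
def t : Fin 16 → A :=
  ![1, D, d, e, f, g, h, i, j, D * d, D * e, D * f, D * g, f * g, D * h, d * g]

/-- The set of monomials in `a₁`, `a₂`, `b`, `c`. -/
def S : Set A := {x | ∃ n₁ n₂ n₃ n₄ : ℕ, x = a₁ ^ n₁ * a₂ ^ n₂ * b ^ n₃ * c ^ n₄}

def T : Set A :=
  {1, D, d, e, f, g, h, i, j, D * d, D * e, D * f, D * g, f * g, D * h, d * g}

end SO41

end

/-!
The basis `gvec` of `𝔤` and the elements `pvec` of `𝔭` identify `S(𝔤) ⊗ Λ(𝔭)` with the algebra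
`PolyMap 10` of polynomial maps from `ℂ¹⁰` to `Λ(𝔭)` (`mapEquiv`). The coordinates 0, 1, 2 belong to
`H₁ + H₂`, `E₁`, `F₁` and the coordinates 3, 4, 5 to `H₁ - H₂`, `E₂`, `F₂`, that is, to the two ideals
`𝔰𝔩₂` of `𝔰𝔬(4)`; the last four belong to `𝔭`.

*Invariance.* Let `Z` and `Z'` be the selfdual and the anti-selfdual part of the generic skew matrix
(`matZ`), let `v` be the generic vector of `𝔭` (`vecV`) and `w` its copy in `Λ(𝔭)` (`vecW`). Up to
constant factors `a₁, a₂, b, c, D, d, e, f, g, h` are the contractions `tr Z²`, `tr Z'²`, `v·v`,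
`v·ZZ'v`, `v·w`, `w·Zw`, `w·Z'w`, `v·Zw`, `v·Z'w`, `v·ZZ'w`. They are invariant since conjugation
by a special orthogonal matrix commutes with the Hodge star (`hodge_conj`). For `i` and `j`, use
`d² = -2 a₁ i` and `d f = -a₁ j`, where `a₁` is not a zero divisor.

*The products span.* An invariant of `K` is fixed by the complex unipotent one-parameter groups of
the two factors `SL₂` (`actC_kMat_of_mem_invariants`): a polynomial identity on the real sphere extends
to the complex quadric (`eq_zero_of_sphere`). It is also fixed by `-1`. These conditions define
`Fixed`. If an equivariant map vanishes where the first three coordinates are the nilpotent element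
`(0, 0, 1)`, then it vanishes over the nilpotent cone of the first `𝔰𝔩₂`, hence is divisible by `a₁`
(`exists_eq_quad_smul_of_pull`). By a graded form of Nakayama's lemma (`mem_of_mem_add_smul`) it
suffices to treat the restriction to this slice (`Fixed.mem_spanST`), and the same reduction applies
to the second factor and `a₂`. What is left are maps from `ℂ⁴` to `Λ(𝔭)` equivariant under
the stabilizer of the two nilpotents (`Fixed₂`). This group acts unitriangularly in the basis `wmono`
of `Λ(𝔭)`, so the first nonzero coordinate of such a map is an invariant or anti-invariant polynomial,
that is, a polynomial in `E₃` and `E₃F₃ + E₄F₄` (`eq_aeval_of_invariant`); in the four middle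
positions it is divisible by `E₃` (`X_dvd_coord`). Since `c` restricts to `2 E₃²`, the leading terms
this permits (`exists_coord_eq_lead_mul`) are exactly those of the restrictions of `ℂ[b, c] · T`
(`coord_tGen_slice`). Dividing by them position by position ends with remainder zero
(`mem_spanST_of_coord_eq_zero`).

*The products are independent.* By the same leading terms the matrix of the sixteen elements of `T` with
respect to `wmono` has nonzero determinant (`linearIndependent_tGen`), and `a₁, a₂, b, c` are
algebraically independent because they map `ℂ¹⁰` onto `ℂ⁴` (`exists_eval_aGen`).
-/

noncomputable section

namespace SO41

/-- `H₁` as an element of `𝔤`; similarly the following definitions. -/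
def gH₁ : 𝔤 := ⟨matH₁, matH₁_mem⟩
def gH₂ : 𝔤 := ⟨matH₂, matH₂_mem⟩
def gE₁ : 𝔤 := ⟨matE₁, matE₁_mem⟩
def gE₂ : 𝔤 := ⟨matE₂, matE₂_mem⟩
def gE₃ : 𝔤 := ⟨matE₃, matE₃_mem⟩
def gE₄ : 𝔤 := ⟨matE₄, matE₄_mem⟩
def gF₁ : 𝔤 := ⟨matF₁, matF₁_mem⟩
def gF₂ : 𝔤 := ⟨matF₂, matF₂_mem⟩
def gF₃ : 𝔤 := ⟨matF₃, matF₃_mem⟩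
def gF₄ : 𝔤 := ⟨matF₄, matF₄_mem⟩

/-- The basis `H₁ + H₂, E₁, F₁, H₁ - H₂, E₂, F₂, E₃, E₄, F₃, F₄` of `𝔤`: two `𝔰𝔩₂`-triples spanning
the ideals of `𝔰𝔬(4)`, followed by a basis of `𝔭`. -/
def gvec : Fin 10 → 𝔤 :=
  ![gH₁ + gH₂, gE₁, gF₁, gH₁ - gH₂, gE₂, gF₂, gE₃, gE₄, gF₃, gF₄]

/-- The coordinates with respect to `gvec`, as functions of the matrix entries. -/
def matCoord (x : Mat) : Fin 10 → ℂ :=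
  ![-Complex.I / 2 * (x i₁ i₂ + x i₃ i₄),
    1 / 2 * (x i₁ i₃ - x i₂ i₄ + Complex.I * (x i₂ i₃ + x i₁ i₄)),
    1 / 2 * (-(x i₁ i₃ - x i₂ i₄) + Complex.I * (x i₂ i₃ + x i₁ i₄)),
    -Complex.I / 2 * (x i₁ i₂ - x i₃ i₄),
    1 / 2 * (x i₁ i₃ + x i₂ i₄ + Complex.I * (x i₂ i₃ - x i₁ i₄)),
    1 / 2 * (-(x i₁ i₃ + x i₂ i₄) + Complex.I * (x i₂ i₃ - x i₁ i₄)),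
    1 / 2 * (x i₁ i₅ + Complex.I * x i₂ i₅),
    1 / 2 * (x i₃ i₅ + Complex.I * x i₄ i₅),
    1 / 2 * (x i₁ i₅ - Complex.I * x i₂ i₅),
    1 / 2 * (x i₃ i₅ - Complex.I * x i₄ i₅)]

theorem skew_apply {x : Mat} (hx : x ∈ 𝔤) (k l : Fin 4) : x (.inl k) (.inl l) = -x (.inl l)
    (.inl k) := by
  have := congrFun (congrFun ((mem_𝔤_iff x).1 hx) (.inl l)) (.inl k)
  simpa [γ, LieAlgebra.Orthogonal.indefiniteDiagonal, Matrix.mul_diagonal,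
    Matrix.diagonal_mul] using this

theorem symm_apply {x : Mat} (hx : x ∈ 𝔤) (k : Fin 4) : x i₅ (.inl k) = x (.inl k) i₅ := by
  have := congrFun (congrFun ((mem_𝔤_iff x).1 hx) (.inl k)) i₅
  simpa [γ, LieAlgebra.Orthogonal.indefiniteDiagonal, Matrix.mul_diagonal,
    Matrix.diagonal_mul] using this

theorem apply_i₅_i₅ {x : Mat} (hx : x ∈ 𝔤) : x i₅ i₅ = 0 := by
  have := congrFun (congrFun ((mem_𝔤_iff x).1 hx) i₅) i₅
  simp [γ, LieAlgebra.Orthogonal.indefiniteDiagonal, Matrix.mul_diagonal,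
    Matrix.diagonal_mul] at this
  linear_combination (-1 / 2) * this

theorem apply_diag {x : Mat} (hx : x ∈ 𝔤) (k : Fin 4) : x (.inl k) (.inl k) = 0 := by
  linear_combination (1 / 2) * skew_apply hx k k

/-- An element of `𝔤` is determined by its entries above the diagonal. -/
theorem ext_upper {x y : Mat} (hx : x ∈ 𝔤) (hy : y ∈ 𝔤)
    (h12 : x i₁ i₂ = y i₁ i₂) (h13 : x i₁ i₃ = y i₁ i₃) (h14 : x i₁ i₄ = y i₁ i₄)
    (h23 : x i₂ i₃ = y i₂ i₃) (h24 : x i₂ i₄ = y i₂ i₄) (h34 : x i₃ i₄ = y i₃ i₄)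
    (h15 : x i₁ i₅ = y i₁ i₅) (h25 : x i₂ i₅ = y i₂ i₅) (h35 : x i₃ i₅ = y i₃ i₅)
    (h45 : x i₄ i₅ = y i₄ i₅) : x = y := by
  ext a b
  rcases a with a | a <;> rcases b with b | b
  · fin_cases a <;> fin_cases b <;>
      simp only [Fin.zero_eta, Fin.mk_one, Fin.reduceFinMk, apply_diag hx, apply_diag hy] <;>
      first
      | assumption
      | (rw [skew_apply hx, skew_apply hy]; exact congrArg Neg.neg ‹_›)
  · obtain rfl : b = 0 := Subsingleton.elim _ _
    fin_cases a <;> assumption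
  · obtain rfl : a = 0 := Subsingleton.elim _ _
    rw [symm_apply hx, symm_apply hy]
    fin_cases b <;> assumption
  · obtain rfl : a = 0 := Subsingleton.elim _ _
    obtain rfl : b = 0 := Subsingleton.elim _ _
    rw [apply_i₅_i₅ hx, apply_i₅_i₅ hy]


theorem coe_sum_gvec (c : Fin 10 → ℂ) : ((∑ i, c i • gvec i : 𝔤) : Mat) =
    c 0 • (matH₁ + matH₂) + c 1 • matE₁ + c 2 • matF₁ + c 3 • (matH₁ - matH₂) + c 4 • matE₂ +
      c 5 • matF₂ + c 6 • matE₃ + c 7 • matE₄ + c 8 • matF₃ + c 9 • matF₄ := by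
  simp only [Fin.sum_univ_castSucc, Finset.univ_eq_empty, Finset.sum_empty, zero_add]
  rfl

open Complex in
/-- The entries above the diagonal of a linear combination of the vectors `gvec`. -/
theorem sum_gvec_apply (c : Fin 10 → ℂ) :
    let x : Mat := (∑ i, c i • gvec i : 𝔤)
    x i₁ i₂ = I * (c 0 + c 3) ∧ x i₃ i₄ = I * (c 0 - c 3) ∧
    x i₁ i₃ = (c 1 + c 4 - c 2 - c 5) / 2 ∧ x i₁ i₄ = I * (-c 1 + c 4 - c 2 + c 5) / 2 ∧
    x i₂ i₃ = -I * (c 1 + c 4 + c 2 + c 5) / 2 ∧ x i₂ i₄ = (-c 1 + c 4 + c 2 - c 5) / 2 ∧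
    x i₁ i₅ = c 6 + c 8 ∧ x i₂ i₅ = I * (c 8 - c 6) ∧ x i₃ i₅ = c 7 + c 9 ∧
    x i₄ i₅ = I * (c 9 - c 7) := by
  simp only [coe_sum_gvec]
  refine ⟨?_, ?_, ?_, ?_, ?_, ?_, ?_, ?_, ?_, ?_⟩ <;>
    simp [matH₁, matH₂, matE₁, matE₂, matE₃, matE₄, matF₁, matF₂, matF₃, matF₄, E] <;> ring

theorem matCoord_add (x y : Mat) : matCoord (x + y) = matCoord x + matCoord y := by
  ext i
  fin_cases i <;> simp only [matCoord, Matrix.cons_val, Fin.zero_eta, Fin.mk_one, Fin.reduceFinMk,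
    Matrix.add_apply, Pi.add_apply] <;> ring

theorem matCoord_smul (r : ℂ) (x : Mat) : matCoord (r • x) = r • matCoord x := by
  ext i
  fin_cases i <;> simp only [matCoord, Matrix.cons_val, Fin.zero_eta, Fin.mk_one, Fin.reduceFinMk,
    Matrix.smul_apply, Pi.smul_apply, smul_eq_mul] <;> ring

theorem sum_matCoord_smul_gvec (x : 𝔤) : ∑ i, matCoord x i • gvec i = x := by
  obtain ⟨h1, h2, h3, h4, h5, h6, h7, h8, h9, h10⟩ := sum_gvec_apply (matCoord x)
  have hI := Complex.I_mul_I
  simp only [matCoord, Matrix.cons_val] at h1 h2 h3 h4 h5 h6 h7 h8 h9 h10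
  apply Subtype.ext
  refine ext_upper (SetLike.coe_mem _) x.2 (h1.trans ?_) (h3.trans ?_) (h4.trans ?_) (h5.trans ?_)
    (h6.trans ?_) (h2.trans ?_) (h7.trans ?_) (h8.trans ?_) (h9.trans ?_) (h10.trans ?_) <;>
  clear h1 h2 h3 h4 h5 h6 h7 h8 h9 h10 <;> grind

theorem matCoord_sum_gvec (c : Fin 10 → ℂ) : matCoord (∑ i, c i • gvec i : 𝔤) = c := by
  obtain ⟨h1, h2, h3, h4, h5, h6, h7, h8, h9, h10⟩ := sum_gvec_apply c
  have hI := Complex.I_mul_I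
  ext i
  fin_cases i <;> simp only [matCoord, Matrix.cons_val, Fin.zero_eta, Fin.mk_one,
    Fin.reduceFinMk, h1, h2, h3, h4, h5, h6, h7, h8, h9, h10] <;>
    clear h1 h2 h3 h4 h5 h6 h7 h8 h9 h10 <;> grind

/-- The coordinate isomorphism of the basis `gvec`. -/
def gEquiv : 𝔤 ≃ₗ[ℂ] (Fin 10 → ℂ) where
  toFun x := matCoord x
  invFun c := ∑ i, c i • gvec i
  map_add' x y := matCoord_add x y
  map_smul' r x := matCoord_smul r x
  left_inv x := sum_matCoord_smul_gvec x
  right_inv c := matCoord_sum_gvec c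

/-- `gvec` as a basis of `𝔤`. -/
def gBasis : Module.Basis (Fin 10) ℂ 𝔤 := Module.Basis.ofEquivFun gEquiv

theorem gBasis_apply (i : Fin 10) : gBasis i = gvec i := by
  apply gEquiv.injective
  rw [gBasis, Module.Basis.coe_ofEquivFun, LinearEquiv.apply_symm_apply]
  symm
  have := gEquiv.apply_symm_apply (Pi.single i 1)
  convert this using 2
  change _ = ∑ j, (Pi.single i (1 : ℂ) : Fin 10 → ℂ) j • gvec j
  simp [Pi.single_apply]

theorem gBasis_repr (x : 𝔤) (i : Fin 10) : gBasis.repr x i = matCoord x i := rfl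

/-- `E₃` as an element of `𝔭`; similarly the following definitions. -/
def pE₃ : 𝔭 := ⟨gE₃, matE₃_transpose⟩
def pE₄ : 𝔭 := ⟨gE₄, matE₄_transpose⟩
def pF₃ : 𝔭 := ⟨gF₃, matF₃_transpose⟩
def pF₄ : 𝔭 := ⟨gF₄, matF₄_transpose⟩

/-- The basis `E₃, E₄, F₃, F₄` of `𝔭`, in the order of the last four vectors of `gvec`. -/
def pvec : Fin 4 → 𝔭 := ![pE₃, pE₄, pF₃, pF₄]

theorem coe_pvec (i : Fin 4) : (pvec i : 𝔤) = gvec (Fin.natAdd 6 i) := by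
  fin_cases i <;> rfl

/-- On `𝔭` the first six coordinates vanish. -/
theorem gBasis_repr_of_mem {x : 𝔤} (hx : x ∈ 𝔭) (i : Fin 6) :
    gBasis.repr x (Fin.castAdd 4 i) = 0 := by
  have h : ∀ k l : Fin 4, (x : Mat) (.inl k) (.inl l) = 0 := fun k l => by
    have h1 := skew_apply x.2 k l
    have h2 := congrFun (congrFun ((mem_𝔭_iff x).1 hx) (.inl k)) (.inl l)
    rw [Matrix.transpose_apply] at h2
    rw [h2] at h1
    linear_combination (1 / 2) * h1
  rw [gBasis_repr]
  fin_cases i <;> simp [matCoord, h]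

theorem eq_sum_pvec (x : 𝔭) : x = ∑ i, gBasis.repr x (Fin.natAdd 6 i) • pvec i := by
  apply Subtype.ext
  conv_lhs => rw [← gBasis.sum_repr (x : 𝔤)]
  rw [Fin.sum_univ_add (a := 6) (b := 4)]
  simp only [gBasis_repr_of_mem x.2, zero_smul, Finset.sum_const_zero, zero_add,
    Submodule.coe_sum, Submodule.coe_smul, coe_pvec, gBasis_apply]

/-- `pvec` as a basis of `𝔭`. -/
def pBasis : Module.Basis (Fin 4) ℂ 𝔭 := by
  refine Module.Basis.mk (v := pvec) ?_ ?_
  · have h : LinearIndependent ℂ (fun i => (𝔭.subtype (pvec i))) := by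
      have := gBasis.linearIndependent.comp (Fin.natAdd 6 : Fin 4 → Fin 10)
        (fun i j hij => by simpa [Fin.ext_iff] using hij)
      convert this using 1
      ext1 i
      simp only [Submodule.subtype_apply, coe_pvec, Function.comp_apply, gBasis_apply]
    exact LinearIndependent.of_comp 𝔭.subtype h
  · intro x _
    rw [eq_sum_pvec x]
    exact Submodule.sum_mem _ fun i _ => Submodule.smul_mem _ _ (Submodule.subset_span ⟨i, rfl⟩)

theorem pBasis_apply (i : Fin 4) : pBasis i = pvec i := by
  rw [pBasis, Module.Basis.mk_apply]

/-- The sixteen monomials in `E₃, E₄, F₃, F₄` in `Λ(𝔭)`. The order is chosen so that the unipotent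
radical of a Borel subgroup of the complexification of `K` acts on them by unitriangular matrices.
-/
def wmono : Fin 16 → Λp :=
  ![1, wF₃, wE₄, wF₄, wE₃, wF₃ * wF₄, wE₄ * wF₃, wE₄ * wF₄, wE₃ * wF₃, wE₃ * wE₄, wE₃ * wF₄,
    wE₄ * wF₃ * wF₄, wE₃ * wE₄ * wF₃, wE₃ * wF₃ * wF₄, wE₃ * wE₄ * wF₄, wE₃ * wE₄ * wF₃ * wF₄]

theorem wedge_swap (x y : 𝔭) :
    ExteriorAlgebra.ι ℂ x * ExteriorAlgebra.ι ℂ y =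
      -(ExteriorAlgebra.ι ℂ y * ExteriorAlgebra.ι ℂ x) :=
  eq_neg_of_add_eq_zero_left (ExteriorAlgebra.ι_add_mul_swap x y)

-- The lemmas below bring products of `wE₃`, `wE₄`, `wF₃`, `wF₄` into this order; the versions with
-- a further factor `x` apply inside right-associated products.

theorem wE₃_sq : wE₃ * wE₃ = 0 := ExteriorAlgebra.ι_sq_zero _
theorem wE₃_sq_mul (x : Λp) : wE₃ * (wE₃ * x) = 0 := by rw [← mul_assoc, wE₃_sq, zero_mul]
theorem wE₄_sq : wE₄ * wE₄ = 0 := ExteriorAlgebra.ι_sq_zero _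
theorem wE₄_sq_mul (x : Λp) : wE₄ * (wE₄ * x) = 0 := by rw [← mul_assoc, wE₄_sq, zero_mul]
theorem wE₄_mul_wE₃ : wE₄ * wE₃ = -(wE₃ * wE₄) := wedge_swap _ _
theorem wE₄_mul_wE₃_mul (x : Λp) : wE₄ * (wE₃ * x) = -(wE₃ * (wE₄ * x)) := by
  rw [← mul_assoc, wE₄_mul_wE₃, neg_mul, mul_assoc]
theorem wF₃_sq : wF₃ * wF₃ = 0 := ExteriorAlgebra.ι_sq_zero _
theorem wF₃_sq_mul (x : Λp) : wF₃ * (wF₃ * x) = 0 := by rw [← mul_assoc, wF₃_sq, zero_mul]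
theorem wF₃_mul_wE₃ : wF₃ * wE₃ = -(wE₃ * wF₃) := wedge_swap _ _
theorem wF₃_mul_wE₃_mul (x : Λp) : wF₃ * (wE₃ * x) = -(wE₃ * (wF₃ * x)) := by
  rw [← mul_assoc, wF₃_mul_wE₃, neg_mul, mul_assoc]
theorem wF₃_mul_wE₄ : wF₃ * wE₄ = -(wE₄ * wF₃) := wedge_swap _ _
theorem wF₃_mul_wE₄_mul (x : Λp) : wF₃ * (wE₄ * x) = -(wE₄ * (wF₃ * x)) := by
  rw [← mul_assoc, wF₃_mul_wE₄, neg_mul, mul_assoc]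
theorem wF₄_sq : wF₄ * wF₄ = 0 := ExteriorAlgebra.ι_sq_zero _
theorem wF₄_sq_mul (x : Λp) : wF₄ * (wF₄ * x) = 0 := by rw [← mul_assoc, wF₄_sq, zero_mul]
theorem wF₄_mul_wE₃ : wF₄ * wE₃ = -(wE₃ * wF₄) := wedge_swap _ _
theorem wF₄_mul_wE₃_mul (x : Λp) : wF₄ * (wE₃ * x) = -(wE₃ * (wF₄ * x)) := by
  rw [← mul_assoc, wF₄_mul_wE₃, neg_mul, mul_assoc]
theorem wF₄_mul_wE₄ : wF₄ * wE₄ = -(wE₄ * wF₄) := wedge_swap _ _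
theorem wF₄_mul_wE₄_mul (x : Λp) : wF₄ * (wE₄ * x) = -(wE₄ * (wF₄ * x)) := by
  rw [← mul_assoc, wF₄_mul_wE₄, neg_mul, mul_assoc]
theorem wF₄_mul_wF₃ : wF₄ * wF₃ = -(wF₃ * wF₄) := wedge_swap _ _
theorem wF₄_mul_wF₃_mul (x : Λp) : wF₄ * (wF₃ * x) = -(wF₃ * (wF₄ * x)) := by
  rw [← mul_assoc, wF₄_mul_wF₃, neg_mul, mul_assoc]

theorem span_wmono : ⊤ ≤ Submodule.span ℂ (Set.range wmono) := by
  set N := Submodule.span ℂ (Set.range wmono) with hN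
  have h (k : Fin 16) : wmono k ∈ N := Submodule.subset_span ⟨k, rfl⟩
  have hl (i : Fin 4) (k : Fin 16) : ExteriorAlgebra.ι ℂ (pvec i) * wmono k ∈ N := by
    have h' := h
    simp only [Fin.forall_fin_succ, IsEmpty.forall_iff, and_true, wmono, Fin.succ_zero_eq_one,
      Fin.isValue, Matrix.cons_val_zero, Matrix.cons_val_succ, mul_assoc] at h'
    have hi : ExteriorAlgebra.ι ℂ (pvec i) = ![wE₃, wE₄, wF₃, wF₄] i := by
      fin_cases i <;> rfl
    rw [hi]
    fin_cases i <;> fin_cases k <;>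
      simp [wmono, mul_assoc, wE₃_sq, wE₃_sq_mul, wE₄_sq, wE₄_sq_mul, wE₄_mul_wE₃, wE₄_mul_wE₃_mul,
          wF₃_sq, wF₃_sq_mul, wF₃_mul_wE₃, wF₃_mul_wE₃_mul, wF₃_mul_wE₄, wF₃_mul_wE₄_mul, wF₄_sq,
          wF₄_sq_mul, wF₄_mul_wE₃, wF₄_mul_wE₃_mul, wF₄_mul_wE₄, wF₄_mul_wE₄_mul, wF₄_mul_wF₃,
          wF₄_mul_wF₃_mul, h']
  have hv (i : Fin 4) (x : Λp) (hx : x ∈ N) : ExteriorAlgebra.ι ℂ (pvec i) * x ∈ N := by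
    induction hx using Submodule.span_induction with
    | mem x hx => obtain ⟨k, rfl⟩ := hx; exact hl i k
    | zero => simp
    | add x y _ _ hx hy => rw [mul_add]; exact add_mem hx hy
    | smul r x _ hx => rw [mul_smul_comm]; exact N.smul_mem r hx
  rintro x -
  induction x using CliffordAlgebra.left_induction with
  | algebraMap r =>
    rw [Algebra.algebraMap_eq_smul_one]
    exact N.smul_mem r (h 0)
  | add x y hx hy => exact add_mem hx hy
  | ι_mul x m hx =>
    have hm : m = ∑ i, pBasis.repr m i • pvec i := by
      conv_lhs => rw [← pBasis.sum_repr m]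
      simp only [pBasis_apply]
    change ExteriorAlgebra.ι ℂ m * x ∈ N
    rw [hm, map_sum, Finset.sum_mul]
    refine sum_mem fun i _ => ?_
    rw [map_smul, smul_mul_assoc]
    exact N.smul_mem _ (hv i x hx)

theorem finrank_Λp : Module.finrank ℂ Λp = 16 := by
  rw [Module.finrank_eq_card_basis pBasis.ExteriorAlgebra]
  simp

/-- The monomials `wmono` as a basis of `Λ(𝔭)`. -/
def wBasis : Module.Basis (Fin 16) ℂ Λp :=
  basisOfTopLeSpanOfCardEqFinrank wmono span_wmono (by rw [finrank_Λp]; rfl)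

theorem wBasis_apply (i : Fin 16) : wBasis i = wmono i := by
  rw [wBasis, coe_basisOfTopLeSpanOfCardEqFinrank]

/-! ### The action of complex `4 × 4` matrices -/

/-- Complex square matrices of size four. -/
abbrev Mat4 : Type := Matrix (Fin 4) (Fin 4) ℂ

/-- The matrix `diag(k, 1)`. -/
def embC (k : Mat4) : Mat := Matrix.fromBlocks k 0 0 1

theorem embC_mul_γ (k : Mat4) : embC k * γ = γ * embC k := by
  ext a b
  simp only [γ, LieAlgebra.Orthogonal.indefiniteDiagonal, Matrix.mul_diagonal,
    Matrix.diagonal_mul, embC]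
  rcases a with a | a <;> rcases b with b | b <;> simp

theorem embC_transpose (k : Mat4) : (embC k)ᵀ = embC kᵀ := by
  simp [embC, Matrix.fromBlocks_transpose]

theorem embC_conj_mem (k : Mat4) {x : Mat} (hx : x ∈ 𝔤) : embC k * x * (embC k)ᵀ ∈ 𝔤 := by
  rw [mem_𝔤_iff] at hx ⊢
  have h1 := embC_mul_γ kᵀ
  have h2 := embC_mul_γ k
  rw [← embC_transpose] at h1
  rw [Matrix.transpose_mul, Matrix.transpose_mul, Matrix.transpose_transpose]
  calc embC k * (xᵀ * (embC k)ᵀ) * γ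
      = embC k * (xᵀ * γ) * (embC k)ᵀ := by
        simp only [Matrix.mul_assoc, h1]
    _ = -((embC k * γ) * x * (embC k)ᵀ) := by
        rw [hx]; simp only [Matrix.mul_assoc, Matrix.neg_mul, Matrix.mul_neg]
    _ = _ := by rw [h2]; simp only [Matrix.mul_assoc]

/-- The map `x ↦ diag(k, 1) x diag(k, 1)ᵀ` on `𝔤`. It makes sense for every complex matrix `k`, is
polynomial in `k`, and is the adjoint action when `k` is orthogonal. -/
def AdC (k : Mat4) : 𝔤 →ₗ[ℂ] 𝔤 where
  toFun x := ⟨embC k * x * (embC k)ᵀ, embC_conj_mem k x.2⟩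
  map_add' x y := Subtype.ext (by simp [Matrix.mul_add, Matrix.add_mul])
  map_smul' c x := Subtype.ext (by simp)

theorem AdC_mem_𝔭 (k : Mat4) (x : 𝔤) (hx : x ∈ 𝔭) : AdC k x ∈ 𝔭 := by
  rw [mem_𝔭_iff] at hx ⊢
  simp only [AdC, LinearMap.coe_mk, AddHom.coe_mk, Matrix.transpose_mul,
    Matrix.transpose_transpose, hx, Matrix.mul_assoc]

/-- The restriction of `AdC k` to `𝔭`. -/
def AdCp (k : Mat4) : 𝔭 →ₗ[ℂ] 𝔭 := (AdC k).restrict (AdC_mem_𝔭 k)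

/-- The endomorphism of `S(𝔤) ⊗ Λ(𝔭)` induced by `AdC k`. -/
def actC (k : Mat4) : A →ₐ[ℂ] A :=
  Algebra.TensorProduct.map
    (SymmetricAlgebra.lift (SymmetricAlgebra.ι ℂ 𝔤 ∘ₗ AdC k))
    (ExteriorAlgebra.map (AdCp k))

theorem Ad_eq_AdC (k : SO4) : Ad k = AdC ((k : Matrix (Fin 4) (Fin 4) ℝ).map Complex.ofReal) := by
  ext1 x
  apply Subtype.ext
  change embK k * x * embK k⁻¹ = embC _ * x * (embC _)ᵀ
  rw [embK_inv]
  rfl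

theorem act_eq_actC (k : SO4) :
    act k = actC ((k : Matrix (Fin 4) (Fin 4) ℝ).map Complex.ofReal) := by
  have h2 : Adp k = AdCp ((k : Matrix (Fin 4) (Fin 4) ℝ).map Complex.ofReal) := by
    ext1 x
    exact Subtype.ext (LinearMap.congr_fun (Ad_eq_AdC k) x)
  rw [act, actC, Ad_eq_AdC, h2]

theorem symm_mem (u : Fin 4 → ℂ) :
    Matrix.fromBlocks 0 (Matrix.of fun i (_ : Fin 1) => u i) (Matrix.of fun (_ : Fin 1) i => u i) 0
      ∈ 𝔤 := by
  rw [mem_𝔤_iff]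
  ext a b
  simp only [γ, LieAlgebra.Orthogonal.indefiniteDiagonal, Matrix.mul_diagonal,
    Matrix.diagonal_mul, Matrix.neg_apply]
  rcases a with a | a <;> rcases b with b | b <;> simp

/-- The element of `𝔭` with last column `u`. -/
def pOf : (Fin 4 → ℂ) →ₗ[ℂ] 𝔭 where
  toFun u := ⟨⟨_, symm_mem u⟩, by
    change Matrix.transpose _ = _
    simp only [Matrix.fromBlocks_transpose, Matrix.transpose_zero]
    rfl⟩
  map_add' x y := by
    apply Subtype.ext
    apply Subtype.ext
    ext a b
    rcases a with a | a <;> rcases b with b | b <;> simp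
  map_smul' r x := by
    apply Subtype.ext
    apply Subtype.ext
    ext a b
    rcases a with a | a <;> rcases b with b | b <;> simp

theorem skew_mem (M : Mat4) :
    Matrix.fromBlocks (M - Mᵀ) 0 0 0 ∈ 𝔤 := by
  rw [mem_𝔤_iff]
  ext a b
  simp only [γ, LieAlgebra.Orthogonal.indefiniteDiagonal, Matrix.mul_diagonal,
    Matrix.diagonal_mul, Matrix.neg_apply]
  rcases a with a | a <;> rcases b with b | b <;> simp

/-- The element of `𝔰𝔬(4) ⊆ 𝔤` with upper left block `M - Mᵀ`. -/
def kOf : Mat4 →ₗ[ℂ] 𝔤 where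
  toFun M := ⟨_, skew_mem M⟩
  map_add' x y := by
    apply Subtype.ext
    ext a b
    rcases a with a | a <;> rcases b with b | b <;> simp
    ring
  map_smul' r x := by
    apply Subtype.ext
    ext a b
    rcases a with a | a <;> rcases b with b | b <;> simp
    ring

theorem AdC_pOf (k : Mat4) (u : Fin 4 → ℂ) : AdC k (pOf u) = pOf (k *ᵥ u) := by
  apply Subtype.ext
  change embC k * Matrix.fromBlocks _ _ _ _ * (embC k)ᵀ = Matrix.fromBlocks _ _ _ _
  rw [embC_transpose, embC, embC, Matrix.fromBlocks_multiply, Matrix.fromBlocks_multiply]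
  congr 1
  · simp
  · ext i j; simp [Matrix.mul_apply, Matrix.mulVec, dotProduct]
  · ext i j; simp [Matrix.mul_apply, Matrix.mulVec, dotProduct, mul_comm]
  · simp

theorem AdCp_pOf (k : Mat4) (u : Fin 4 → ℂ) : AdCp k (pOf u) = pOf (k *ᵥ u) :=
  Subtype.ext (AdC_pOf k u)

theorem AdC_kOf (k M : Mat4) : AdC k (kOf M) = kOf (k * M * kᵀ) := by
  apply Subtype.ext
  change embC k * Matrix.fromBlocks _ _ _ _ * (embC k)ᵀ = Matrix.fromBlocks _ _ _ _
  rw [embC_transpose, embC, embC, Matrix.fromBlocks_multiply, Matrix.fromBlocks_multiply]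
  congr 1 <;> simp [Matrix.mul_sub, Matrix.sub_mul, Matrix.mul_assoc]

/-- The element of `𝔭` with last column `u`, in degree one of `S(𝔤)`. -/
def sv : (Fin 4 → ℂ) →ₗ[ℂ] Sg := SymmetricAlgebra.ι ℂ 𝔤 ∘ₗ 𝔭.subtype ∘ₗ pOf

/-- The element of `𝔭` with last column `u`, in degree one of `Λ(𝔭)`. -/
def sw : (Fin 4 → ℂ) →ₗ[ℂ] Λp := ExteriorAlgebra.ι ℂ ∘ₗ pOf

/-- The element of `𝔰𝔬(4)` with matrix `M - Mᵀ`, in degree one of `S(𝔤)`. -/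
def sz : Mat4 →ₗ[ℂ] Sg := SymmetricAlgebra.ι ℂ 𝔤 ∘ₗ kOf

theorem actC_sw (k : Mat4) (u : Fin 4 → ℂ) :
    actC k (1 ⊗ₜ sw u) = 1 ⊗ₜ sw (k *ᵥ u) := by
  simp [actC, sw, AdCp_pOf]

open Complex in
theorem pE₃_eq : pE₃ = pOf ![1, -I, 0, 0] := by
  apply Subtype.ext; apply Subtype.ext
  refine ext_upper matE₃_mem (Subtype.mem _) ?_ ?_ ?_ ?_ ?_ ?_ ?_ ?_ ?_ ?_ <;>
    simp [pE₃, gE₃, matE₃, E, pOf]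

open Complex in
theorem pE₄_eq : pE₄ = pOf ![0, 0, 1, -I] := by
  apply Subtype.ext; apply Subtype.ext
  refine ext_upper matE₄_mem (Subtype.mem _) ?_ ?_ ?_ ?_ ?_ ?_ ?_ ?_ ?_ ?_ <;>
    simp [pE₄, gE₄, matE₄, E, pOf]

open Complex in
theorem pF₃_eq : pF₃ = pOf ![1, I, 0, 0] := by
  apply Subtype.ext; apply Subtype.ext
  refine ext_upper matF₃_mem (Subtype.mem _) ?_ ?_ ?_ ?_ ?_ ?_ ?_ ?_ ?_ ?_ <;>
    simp [pF₃, gF₃, matF₃, E, pOf]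

open Complex in
theorem pF₄_eq : pF₄ = pOf ![0, 0, 1, I] := by
  apply Subtype.ext; apply Subtype.ext
  refine ext_upper matF₄_mem (Subtype.mem _) ?_ ?_ ?_ ?_ ?_ ?_ ?_ ?_ ?_ ?_ <;>
    simp [pF₄, gF₄, matF₄, E, pOf]

open Complex in
theorem gH₁_eq : gH₁ = kOf !![0, I, 0, 0; 0, 0, 0, 0; 0, 0, 0, 0; 0, 0, 0, 0] := by
  apply Subtype.ext
  refine ext_upper matH₁_mem (Subtype.mem _) ?_ ?_ ?_ ?_ ?_ ?_ ?_ ?_ ?_ ?_ <;>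
    simp [gH₁, matH₁, E, kOf]

open Complex in
theorem gH₂_eq : gH₂ = kOf !![0, 0, 0, 0; 0, 0, 0, 0; 0, 0, 0, I; 0, 0, 0, 0] := by
  apply Subtype.ext
  refine ext_upper matH₂_mem (Subtype.mem _) ?_ ?_ ?_ ?_ ?_ ?_ ?_ ?_ ?_ ?_ <;>
    simp [gH₂, matH₂, E, kOf]

open Complex in
theorem gE₁_eq : gE₁ = kOf ((1 / 2 : ℂ) • !![0, 0, 1, -I; 0, 0, -I, -1; 0, 0, 0, 0; 0, 0, 0,
    0]) := by
  apply Subtype.ext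
  refine ext_upper matE₁_mem (Subtype.mem _) ?_ ?_ ?_ ?_ ?_ ?_ ?_ ?_ ?_ ?_ <;>
    simp [gE₁, matE₁, E, kOf]

open Complex in
theorem gE₂_eq : gE₂ = kOf ((1 / 2 : ℂ) • !![0, 0, 1, I; 0, 0, -I, 1; 0, 0, 0, 0; 0, 0, 0, 0]) := by
  apply Subtype.ext
  refine ext_upper matE₂_mem (Subtype.mem _) ?_ ?_ ?_ ?_ ?_ ?_ ?_ ?_ ?_ ?_ <;>
    simp [gE₂, matE₂, E, kOf]

open Complex in
theorem gF₁_eq : gF₁ = kOf ((1 / 2 : ℂ) • !![0, 0, -1, -I; 0, 0, -I, 1; 0, 0, 0, 0; 0, 0, 0,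
    0]) := by
  apply Subtype.ext
  refine ext_upper matF₁_mem (Subtype.mem _) ?_ ?_ ?_ ?_ ?_ ?_ ?_ ?_ ?_ ?_ <;>
    simp [gF₁, matF₁, E, kOf] <;> ring

open Complex in
theorem gF₂_eq : gF₂ = kOf ((1 / 2 : ℂ) • !![0, 0, -1, I; 0, 0, -I, -1; 0, 0, 0, 0; 0, 0, 0,
    0]) := by
  apply Subtype.ext
  refine ext_upper matF₂_mem (Subtype.mem _) ?_ ?_ ?_ ?_ ?_ ?_ ?_ ?_ ?_ ?_ <;>
    simp [gF₂, matF₂, E, kOf] <;> ring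

/-! ### The Hodge star on skew `4 × 4` matrices -/

/-- The Hodge star on `4 × 4` matrices, extended linearly from skew matrices by complementing the
pair of indices. -/
def hodge : Mat4 →ₗ[ℂ] Mat4 where
  toFun M := !![0, M 2 3, M 3 1, M 1 2; M 3 2, 0, M 0 3, M 2 0; M 1 3, M 3 0, 0, M 0 1;
    M 2 1, M 0 2, M 1 0, 0]
  map_add' x y := by
    ext i j
    fin_cases i <;> fin_cases j <;> first | rfl | exact (add_zero 0).symm
  map_smul' r x := by
    ext i j
    fin_cases i <;> fin_cases j <;> first | rfl | exact (mul_zero r).symm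

theorem hodge_transpose (M : Mat4) : hodge Mᵀ = (hodge M)ᵀ := by
  ext i j
  fin_cases i <;> fin_cases j <;> simp [hodge]

theorem eq_of_skew {M N : Mat4} (hM : Mᵀ = -M) (hN : Nᵀ = -N) (h : ∀ i j, i < j → M i j = N i j) :
    M = N := by
  have hM' (i j : Fin 4) : M j i = -M i j := congrFun (congrFun hM i) j
  have hN' (i j : Fin 4) : N j i = -N i j := congrFun (congrFun hN i) j
  ext i j
  rcases lt_trichotomy i j with hij | rfl | hij
  · exact h i j hij
  · linear_combination (1 / 2) * hM' i i - (1 / 2) * hN' i i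
  · rw [hM' j i, hN' j i, h j i hij]

/-- The skew matrix with given entries above the diagonal. -/
def skewMat (a b c d e f : ℂ) : Mat4 :=
  !![0, a, b, c; -a, 0, d, e; -b, -d, 0, f; -c, -e, -f, 0]

theorem skewMat_transpose (a b c d e f : ℂ) :
    (skewMat a b c d e f)ᵀ = -skewMat a b c d e f := by
  ext i j
  fin_cases i <;> fin_cases j <;> first | exact neg_zero.symm | exact (neg_neg _).symm | rfl

theorem det_four (k : Mat4) : k.det =
    k 0 0 * (k 1 1 * (k 2 2 * k 3 3 - k 2 3 * k 3 2) - k 1 2 * (k 2 1 * k 3 3 - k 2 3 * k 3 1)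
      + k 1 3 * (k 2 1 * k 3 2 - k 2 2 * k 3 1))
    - k 0 1 * (k 1 0 * (k 2 2 * k 3 3 - k 2 3 * k 3 2) - k 1 2 * (k 2 0 * k 3 3 - k 2 3 * k 3 0)
      + k 1 3 * (k 2 0 * k 3 2 - k 2 2 * k 3 0))
    + k 0 2 * (k 1 0 * (k 2 1 * k 3 3 - k 2 3 * k 3 1) - k 1 1 * (k 2 0 * k 3 3 - k 2 3 * k 3 0)
      + k 1 3 * (k 2 0 * k 3 1 - k 2 1 * k 3 0))
    - k 0 3 * (k 1 0 * (k 2 1 * k 3 2 - k 2 2 * k 3 1) - k 1 1 * (k 2 0 * k 3 2 - k 2 2 * k 3 0)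
      + k 1 2 * (k 2 0 * k 3 1 - k 2 1 * k 3 0)) := by
  simp [Matrix.det_succ_row_zero, Fin.sum_univ_succ, Fin.succAbove]
  ring

/-- The Hodge star is equivariant up to the determinant, for all `4 × 4` matrices: both sides are
given by the minors of size two of `k`, and the identity is Laplace expansion. -/
theorem transpose_mul_hodge_mul (k : Mat4) (a b c d e f : ℂ) :
    kᵀ * hodge (k * skewMat a b c d e f * kᵀ) * k = k.det • hodge (skewMat a b c d e f) := by
  have hS := skewMat_transpose a b c d e f
  refine eq_of_skew ?_ ?_ fun i j hij => ?_
  · rw [Matrix.transpose_mul, Matrix.transpose_mul, Matrix.transpose_transpose, ← hodge_transpose,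
      Matrix.transpose_mul, Matrix.transpose_mul, Matrix.transpose_transpose, hS]
    simp only [Matrix.mul_neg, Matrix.neg_mul, map_neg, Matrix.mul_assoc]
  · rw [Matrix.transpose_smul, ← hodge_transpose, hS, map_neg, smul_neg]
  · clear hS
    fin_cases i <;> fin_cases j <;> first | exact absurd hij (by decide) | skip
    all_goals
      simp only [hodge, skewMat, LinearMap.coe_mk, AddHom.coe_mk, Matrix.mul_apply,
        Fin.sum_univ_four, Matrix.transpose_apply, Matrix.of_apply, Matrix.cons_val, det_four,
        Matrix.smul_apply, smul_eq_mul, Fin.zero_eta, Fin.mk_one, Fin.reduceFinMk]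
      ring

/-- Special orthogonal matrices commute with the Hodge star. -/
theorem hodge_conj {k : Mat4} (hk : k * kᵀ = 1) (hd : k.det = 1) {S : Mat4} (hS : Sᵀ = -S) :
    hodge (k * S * kᵀ) = k * hodge S * kᵀ := by
  have h : S = skewMat (S 0 1) (S 0 2) (S 0 3) (S 1 2) (S 1 3) (S 2 3) :=
    eq_of_skew hS (skewMat_transpose _ _ _ _ _ _) fun i j hij => by
      fin_cases i <;> fin_cases j <;> first | exact absurd hij (by decide) | rfl
  have := transpose_mul_hodge_mul k (S 0 1) (S 0 2) (S 0 3) (S 1 2) (S 1 3) (S 2 3)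
  rw [← h, hd, one_smul] at this
  calc hodge (k * S * kᵀ) = (k * kᵀ) * hodge (k * S * kᵀ) * (k * kᵀ) := by rw [hk]; simp
    _ = k * (kᵀ * hodge (k * S * kᵀ) * k) * kᵀ := by simp only [Matrix.mul_assoc]
    _ = _ := by rw [this]

/-! ### Covariant vectors and matrices over `S(𝔤)` -/

-- Shortcuts for instance search, which is slow on the tensor product `A`.

instance algebraSgA : Algebra Sg A := Algebra.TensorProduct.leftAlgebra

instance moduleSgA : Module Sg A := Algebra.toModule

instance smulSgA : SMul Sg A := Algebra.toSMul

/-- The action on `S(𝔤)`. -/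
def actS (k : Mat4) : Sg →ₐ[ℂ] Sg :=
  SymmetricAlgebra.lift (SymmetricAlgebra.ι ℂ 𝔤 ∘ₗ AdC k)

theorem actC_tmul (k : Mat4) (r : Sg) (w : Λp) :
    actC k (r ⊗ₜ w) = actS k r ⊗ₜ ExteriorAlgebra.map (AdCp k) w := rfl

theorem actC_smul (k : Mat4) (r : Sg) (x : A) : actC k (r • x) = actS k r • actC k x := by
  have h (r : Sg) (x : A) : r • x = (r ⊗ₜ 1 : A) * x := by
    rw [Algebra.smul_def]; rfl
  rw [h, map_mul, actC_tmul, map_one, ← h]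

theorem actS_sv (k : Mat4) (u : Fin 4 → ℂ) : actS k (sv u) = sv (k *ᵥ u) := by
  simp [actS, sv, AdC_pOf]

theorem actS_sz (k M : Mat4) : actS k (sz M) = sz (k * M * kᵀ) := by
  simp [actS, sz, AdC_kOf]

/-- The generic vector in `𝔭`. -/
def vecV : Fin 4 → Sg := fun i => sv (Pi.single i 2)

/-- The generic vector in `𝔭`, as a vector of elements of degree one of `Λ(𝔭)`. -/
def vecW : Fin 4 → A := fun i => 1 ⊗ₜ sw (Pi.single i 2)

/-- The generic skew matrix, projected to the `ε`-eigenspace of the Hodge star. -/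
def matZ (ε : ℂ) : Matrix (Fin 4) (Fin 4) Sg := fun i j =>
  sz ((1 / 2 : ℂ) • ((Matrix.single i j 1 - Matrix.single j i 1) +
    ε • hodge (Matrix.single i j 1 - Matrix.single j i 1)))

/-- A complex matrix, with entries regarded in `S(𝔤)`. -/
def scal (k : Mat4) : Matrix (Fin 4) (Fin 4) Sg := k.map (algebraMap ℂ Sg)

theorem scal_mul_transpose {k : Mat4} (hk : k * kᵀ = 1) : scal k * (scal k)ᵀ = 1 := by
  rw [scal, ← Matrix.transpose_map, ← Matrix.map_mul, hk]
  simp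

theorem mulVec_single (k : Mat4) (i : Fin 4) (r : ℂ) :
    k *ᵥ Pi.single i r = ∑ l, k l i • Pi.single l r := by
  ext j
  simp [Pi.single_apply]

theorem actS_vecV (k : Mat4) (i : Fin 4) : actS k (vecV i) = (vecV ᵥ* scal k) i := by
  rw [vecV, actS_sv, mulVec_single, map_sum]
  simp only [map_smul, Matrix.vecMul, dotProduct, scal, Matrix.map_apply, vecV]
  exact Finset.sum_congr rfl fun _ _ => by rw [Algebra.smul_def, mul_comm]

theorem actC_vecW (k : Mat4) (i : Fin 4) : actC k (vecW i) = ∑ l, scal k l i • vecW l := by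
  rw [vecW, actC_sw, mulVec_single, map_sum, TensorProduct.tmul_sum]
  simp only [map_smul, scal, Matrix.map_apply, algebraMap_smul, vecW, TensorProduct.tmul_smul]

theorem conj_single (k : Mat4) (i j : Fin 4) :
    k * Matrix.single i j 1 * kᵀ = ∑ l, ∑ m, (k l i * k m j) • Matrix.single l m (1 : ℂ) := by
  ext a b
  simp [Matrix.sum_apply, Matrix.single_apply, Matrix.mul_apply, ite_and]

theorem actS_matZ {k : Mat4} (hk : k * kᵀ = 1) (hd : k.det = 1) (ε : ℂ) (i j : Fin 4) :
    actS k (matZ ε i j) = ((scal k)ᵀ * matZ ε * scal k) i j := by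
  have h1 : k * (Matrix.single i j 1 - Matrix.single j i 1) * kᵀ =
      ∑ l, ∑ m, (k l i * k m j) • (Matrix.single l m 1 - Matrix.single m l (1 : ℂ)) := by
    rw [Matrix.mul_sub, Matrix.sub_mul, conj_single, conj_single]
    simp only [smul_sub, Finset.sum_sub_distrib]
    congr 1
    rw [Finset.sum_comm]
    simp only [mul_comm]
  rw [matZ, actS_sz, Matrix.mul_smul, Matrix.smul_mul, Matrix.mul_add, Matrix.add_mul,
    Matrix.mul_smul, Matrix.smul_mul, ← hodge_conj hk hd (by simp), h1]
  simp only [map_sum, map_smul, map_add, Finset.smul_sum, smul_add, Matrix.mul_apply,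
      Finset.sum_mul,
    matZ, scal, Matrix.transpose_apply, Matrix.map_apply, ← Finset.sum_add_distrib]
  rw [Finset.sum_comm]
  refine Finset.sum_congr rfl fun l _ => Finset.sum_congr rfl fun m _ => ?_
  simp only [Algebra.smul_def, map_mul]
  ring

/-- Invariant pairing of a covector over `S(𝔤)` with the generic vector of `Λ(𝔭)`. -/
def pair (u : Fin 4 → Sg) : A := ∑ i, u i • vecW i

theorem actC_pair {k : Mat4} (hk : k * kᵀ = 1) {u : Fin 4 → Sg}
    (hu : ∀ i, actS k (u i) = (u ᵥ* scal k) i) : actC k (pair u) = pair u := by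
  have hK := scal_mul_transpose hk
  simp only [pair, map_sum, actC_smul, hu, actC_vecW, Finset.smul_sum, smul_smul]
  rw [Finset.sum_comm]
  refine Finset.sum_congr rfl fun l _ => ?_
  rw [← Finset.sum_smul]
  congr 1
  calc ∑ i, (u ᵥ* scal k) i * scal k l i = (u ᵥ* scal k ᵥ* (scal k)ᵀ) l := rfl
    _ = u l := by rw [Matrix.vecMul_vecMul, hK, Matrix.vecMul_one]

/-- The row vectors `u` with `k u = u k` are closed under multiplication by the generic skew
matrix. -/
theorem actS_vecMul {k : Mat4} (hk : k * kᵀ = 1) (hd : k.det = 1) (ε : ℂ) {u : Fin 4 → Sg}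
    (hu : ∀ i, actS k (u i) = (u ᵥ* scal k) i) (i : Fin 4) :
    actS k ((u ᵥ* matZ ε) i) = (u ᵥ* matZ ε ᵥ* scal k) i := by
  have hK := scal_mul_transpose hk
  have : actS k ((u ᵥ* matZ ε) i) = (u ᵥ* scal k ᵥ* ((scal k)ᵀ * matZ ε * scal k)) i := by
    simp only [Matrix.vecMul, dotProduct, map_sum, map_mul, actS_matZ hk hd] at hu ⊢
    simp only [hu]
  rw [this, Matrix.vecMul_vecMul, Matrix.mul_assoc, ← Matrix.mul_assoc, hK, Matrix.one_mul,
    Matrix.vecMul_vecMul]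

theorem actS_dotProduct {k : Mat4} (hk : k * kᵀ = 1) {u v : Fin 4 → Sg}
    (hu : ∀ i, actS k (u i) = (u ᵥ* scal k) i) (hv : ∀ i, actS k (v i) = (v ᵥ* scal k) i) :
    actS k (u ⬝ᵥ v) = u ⬝ᵥ v := by
  have hK := scal_mul_transpose hk
  have : actS k (u ⬝ᵥ v) = (u ᵥ* scal k) ⬝ᵥ (v ᵥ* scal k) := by
    simp only [dotProduct, map_sum, map_mul, hu, hv]
  rw [this, ← Matrix.mulVec_transpose (scal k) v, Matrix.dotProduct_mulVec, Matrix.vecMul_vecMul,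
      hK,
    Matrix.vecMul_one]

theorem actS_trace {k : Mat4} (hk : k * kᵀ = 1) (hd : k.det = 1) (ε : ℂ) :
    actS k (matZ ε * matZ ε).trace = (matZ ε * matZ ε).trace := by
  have hK := scal_mul_transpose hk
  have : actS k (matZ ε * matZ ε).trace =
      (((scal k)ᵀ * matZ ε * scal k) * ((scal k)ᵀ * matZ ε * scal k)).trace := by
    simp only [Matrix.trace, Matrix.diag, Matrix.mul_apply (M := matZ ε),
      Matrix.mul_apply (M := (scal k)ᵀ * matZ ε * scal k), map_sum, map_mul, actS_matZ hk hd]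
  rw [this, Matrix.trace_mul_comm]
  calc _ = ((scal k)ᵀ * (matZ ε * (scal k * (scal k)ᵀ) * matZ ε * scal k)).trace := by
        simp only [Matrix.mul_assoc]
    _ = _ := by
      rw [Matrix.trace_mul_comm, hK, Matrix.mul_one, Matrix.mul_assoc, hK, Matrix.mul_one]

/-- The contraction of two covariant vectors is invariant. -/
theorem actC_sum_mul {k : Mat4} (hk : k * kᵀ = 1) {x y : Fin 4 → A}
    (hx : ∀ i, actC k (x i) = ∑ l, scal k l i • x l)
    (hy : ∀ i, actC k (y i) = ∑ l, scal k l i • y l) :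
    actC k (∑ i, x i * y i) = ∑ i, x i * y i := by
  have hK (l m : Fin 4) : ∑ i, scal k l i * scal k m i = (1 : Matrix (Fin 4) (Fin 4) Sg) l m := by
    rw [← scal_mul_transpose hk]; rfl
  simp only [map_sum, map_mul, hx, hy, Finset.sum_mul_sum, smul_mul_smul_comm]
  rw [Finset.sum_comm]
  refine Finset.sum_congr rfl fun l _ => ?_
  rw [Finset.sum_comm]
  simp only [← Finset.sum_smul, hK, Matrix.one_apply, ite_smul, one_smul, zero_smul]
  simp

/-- Invariant pairing of a skew matrix over `S(𝔤)` with the generic bivector of `Λ(𝔭)`. -/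
def pair₂ (Z : Matrix (Fin 4) (Fin 4) Sg) : A := ∑ j, (∑ i, Z i j • vecW i) * vecW j

theorem actC_pair₂ {k : Mat4} (hk : k * kᵀ = 1) (hd : k.det = 1) (ε : ℂ) :
    actC k (pair₂ (matZ ε)) = pair₂ (matZ ε) := by
  refine actC_sum_mul hk (fun j => ?_) (actC_vecW k)
  have h (l : Fin 4) : ∑ i, ((scal k)ᵀ * matZ ε * scal k) i j * scal k l i =
      ∑ m, scal k m j * matZ ε l m := by
    calc _ = (scal k * ((scal k)ᵀ * matZ ε * scal k)) l j := by
          rw [Matrix.mul_apply]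
          exact Finset.sum_congr rfl fun _ _ => mul_comm _ _
      _ = (matZ ε * scal k) l j := by
          rw [Matrix.mul_assoc, ← Matrix.mul_assoc, scal_mul_transpose hk, Matrix.one_mul]
      _ = _ := by
          rw [Matrix.mul_apply]
          exact Finset.sum_congr rfl fun _ _ => mul_comm _ _
  simp only [map_sum, actC_smul, actC_vecW, actS_matZ hk hd, Finset.smul_sum, smul_smul]
  rw [Finset.sum_comm]
  nth_rw 2 [Finset.sum_comm]
  simp only [← Finset.sum_smul, h]

/-! ### The generic vectors and skew matrices in terms of the basis -/

open Complex in
/-- The imaginary unit, regarded in `S(𝔤)`. -/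
def CI : Sg := algebraMap ℂ Sg I

theorem CI_mul_CI : CI * CI = -1 := by
  rw [CI, ← map_mul, Complex.I_mul_I, map_neg, map_one]

theorem CI_sq : CI ^ 2 = -1 := by rw [sq, CI_mul_CI]

theorem CI_pow_three : CI ^ 3 = -CI := by rw [pow_succ, CI_sq]; ring

theorem CI_pow_four : CI ^ 4 = 1 := by rw [pow_succ, CI_pow_three, neg_mul, CI_mul_CI, neg_neg]

open Complex in
theorem E₃_eq_sv : E₃ = sv ![1, -I, 0, 0] := by
  rw [sv, LinearMap.comp_apply, LinearMap.comp_apply, ← pE₃_eq]; rfl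
open Complex in
theorem E₄_eq_sv : E₄ = sv ![0, 0, 1, -I] := by
  rw [sv, LinearMap.comp_apply, LinearMap.comp_apply, ← pE₄_eq]; rfl
open Complex in
theorem F₃_eq_sv : F₃ = sv ![1, I, 0, 0] := by
  rw [sv, LinearMap.comp_apply, LinearMap.comp_apply, ← pF₃_eq]; rfl
open Complex in
theorem F₄_eq_sv : F₄ = sv ![0, 0, 1, I] := by
  rw [sv, LinearMap.comp_apply, LinearMap.comp_apply, ← pF₄_eq]; rfl
open Complex in
theorem wE₃_eq_sw : wE₃ = sw ![1, -I, 0, 0] := by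
  rw [sw, LinearMap.comp_apply, ← pE₃_eq]; rfl
open Complex in
theorem wE₄_eq_sw : wE₄ = sw ![0, 0, 1, -I] := by
  rw [sw, LinearMap.comp_apply, ← pE₄_eq]; rfl
open Complex in
theorem wF₃_eq_sw : wF₃ = sw ![1, I, 0, 0] := by
  rw [sw, LinearMap.comp_apply, ← pF₃_eq]; rfl
open Complex in
theorem wF₄_eq_sw : wF₄ = sw ![0, 0, 1, I] := by
  rw [sw, LinearMap.comp_apply, ← pF₄_eq]; rfl

open Complex in
theorem H₁_eq_sz : H₁ = sz !![0, I, 0, 0; 0, 0, 0, 0; 0, 0, 0, 0; 0, 0, 0, 0] := by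
  rw [sz, LinearMap.comp_apply, ← gH₁_eq]; rfl
open Complex in
theorem H₂_eq_sz : H₂ = sz !![0, 0, 0, 0; 0, 0, 0, 0; 0, 0, 0, I; 0, 0, 0, 0] := by
  rw [sz, LinearMap.comp_apply, ← gH₂_eq]; rfl
open Complex in
theorem E₁_eq_sz : E₁ = sz ((1 / 2 : ℂ) • !![0, 0, 1, -I; 0, 0, -I, -1; 0, 0, 0, 0; 0, 0, 0,
    0]) := by
  rw [sz, LinearMap.comp_apply, ← gE₁_eq]; rfl
open Complex in
theorem E₂_eq_sz : E₂ = sz ((1 / 2 : ℂ) • !![0, 0, 1, I; 0, 0, -I, 1; 0, 0, 0, 0; 0, 0, 0, 0]) := by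
  rw [sz, LinearMap.comp_apply, ← gE₂_eq]; rfl
open Complex in
theorem F₁_eq_sz : F₁ = sz ((1 / 2 : ℂ) • !![0, 0, -1, -I; 0, 0, -I, 1; 0, 0, 0, 0; 0, 0, 0,
    0]) := by
  rw [sz, LinearMap.comp_apply, ← gF₁_eq]; rfl
open Complex in
theorem F₂_eq_sz : F₂ = sz ((1 / 2 : ℂ) • !![0, 0, -1, I; 0, 0, -I, -1; 0, 0, 0, 0; 0, 0, 0,
    0]) := by
  rw [sz, LinearMap.comp_apply, ← gF₂_eq]; rfl

theorem CI_mul (x : Sg) : CI * x = Complex.I • x := by rw [CI, Algebra.smul_def]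

theorem vecV_eq : vecV = ![E₃ + F₃, CI * (E₃ - F₃), E₄ + F₄, CI * (E₄ - F₄)] := by
  ext1 i
  fin_cases i <;>
    simp only [vecV, Fin.zero_eta, Fin.mk_one, Fin.reduceFinMk, E₃_eq_sv, E₄_eq_sv, F₃_eq_sv,
        F₄_eq_sv, CI_mul, ← map_add,
      ← map_sub, ← map_smul, Matrix.cons_val] <;>
    congr 1 <;> ext j <;> fin_cases j <;> simp [one_add_one_eq_two, ← mul_add] <;> ring_nf <;> simp

theorem vecW_eq : vecW = ![1 ⊗ₜ wE₃ + 1 ⊗ₜ wF₃, CI • (1 ⊗ₜ wE₃ - 1 ⊗ₜ wF₃),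
    1 ⊗ₜ wE₄ + 1 ⊗ₜ wF₄, CI • (1 ⊗ₜ wE₄ - 1 ⊗ₜ wF₄)] := by
  ext1 i
  fin_cases i <;>
    simp only [vecW, Fin.zero_eta, Fin.mk_one, Fin.reduceFinMk, wE₃_eq_sw, wE₄_eq_sw, wF₃_eq_sw,
        wF₄_eq_sw, CI, algebraMap_smul, ← map_add,
      ← map_sub, ← map_smul, ← TensorProduct.tmul_add, ← TensorProduct.tmul_sub,
          ← TensorProduct.tmul_smul, Matrix.cons_val] <;>
    congr 2 <;> ext j <;> fin_cases j <;> simp [one_add_one_eq_two, ← mul_add] <;> ring_nf <;> simp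

theorem sz_congr {M N : Mat4} (h01 : M 0 1 - M 1 0 = N 0 1 - N 1 0)
    (h02 : M 0 2 - M 2 0 = N 0 2 - N 2 0) (h03 : M 0 3 - M 3 0 = N 0 3 - N 3 0)
    (h12 : M 1 2 - M 2 1 = N 1 2 - N 2 1) (h13 : M 1 3 - M 3 1 = N 1 3 - N 3 1)
    (h23 : M 2 3 - M 3 2 = N 2 3 - N 3 2) : sz M = sz N := by
  rw [sz, LinearMap.comp_apply, LinearMap.comp_apply]
  congr 1
  apply Subtype.ext
  refine ext_upper (Subtype.mem _) (Subtype.mem _) h01 h02 h03 h12 h13 h23 ?_ ?_ ?_ ?_ <;> rfl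

theorem matZ_swap (ε : ℂ) (i j : Fin 4) : matZ ε j i = -matZ ε i j := by
  rw [matZ, matZ, ← map_neg, ← neg_sub (Matrix.single i j 1), map_neg]
  congr 1
  module

theorem matZ_self (ε : ℂ) (i : Fin 4) : matZ ε i i = 0 := by
  simp [matZ]

/-- A skew matrix is determined by six of its entries. -/
theorem skew_eq_of {Z : Matrix (Fin 4) (Fin 4) Sg} (h : ∀ i j, Z j i = -Z i j) (h0 : ∀ i, Z i i = 0)
    {α β γ α' β' γ' : Sg} (h1 : Z 0 1 = α) (h2 : Z 0 2 = β) (h3 : Z 0 3 = γ) (h4 : Z 2 3 = α')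
    (h5 : Z 1 3 = -β') (h6 : Z 1 2 = γ') :
    Z = !![0, α, β, γ; -α, 0, γ', -β'; -β, -γ', 0, α'; -γ, β', -α', 0] := by
  ext i j
  fin_cases i <;> fin_cases j <;> simp [h0, h1, h2, h3, h4, h5, h6, h 0 1, h 0 2, h 0 3, h 2 3,
      h 1 3, h 1 2]

set_option maxHeartbeats 1000000 in
theorem matZ_one : matZ 1 = !![0, -CI * (H₁ + H₂), E₁ - F₁, CI * (E₁ + F₁);
    -(-CI * (H₁ + H₂)), 0, CI * (E₁ + F₁), -(E₁ - F₁);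
    -(E₁ - F₁), -(CI * (E₁ + F₁)), 0, -CI * (H₁ + H₂);
    -(CI * (E₁ + F₁)), E₁ - F₁, -(-CI * (H₁ + H₂)), 0] := by
  apply skew_eq_of (matZ_swap 1) (matZ_self 1) <;>
    simp only [matZ, neg_mul, H₁_eq_sz, H₂_eq_sz, E₁_eq_sz, F₁_eq_sz, CI_mul, ← map_add, ← map_sub,
        ← map_smul, ← map_neg] <;>
    apply sz_congr <;>
    simp [hodge, Matrix.single_apply] <;> ring_nf <;> simp

set_option maxHeartbeats 1000000 in
theorem matZ_neg_one : matZ (-1) = !![0, -CI * (H₁ - H₂), E₂ - F₂, -CI * (E₂ + F₂);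
    -(-CI * (H₁ - H₂)), 0, CI * (E₂ + F₂), -(-(E₂ - F₂));
    -(E₂ - F₂), -(CI * (E₂ + F₂)), 0, CI * (H₁ - H₂);
    -(-CI * (E₂ + F₂)), -(E₂ - F₂), -(CI * (H₁ - H₂)), 0] := by
  apply skew_eq_of (matZ_swap (-1)) (matZ_self (-1)) <;>
    simp only [matZ, neg_mul, H₁_eq_sz, H₂_eq_sz, E₂_eq_sz, F₂_eq_sz, CI_mul, ← map_add, ← map_sub,
        ← map_smul, ← map_neg] <;>
    apply sz_congr <;>
    simp [hodge, Matrix.single_apply] <;> ring_nf <;> simp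

/-! ### The elements of `S` and `T` as contractions -/

theorem tmul_eq_smul (r : Sg) (w : Λp) : (r ⊗ₜ w : A) = r • (1 ⊗ₜ w : A) := by
  rw [Algebra.smul_def]
  change _ = (r ⊗ₜ 1 : A) * _
  rw [Algebra.TensorProduct.tmul_mul_tmul, one_mul, mul_one]

theorem tmul_one_mul (r : Sg) (x : A) : (r ⊗ₜ 1 : A) * x = r • x := by
  rw [Algebra.smul_def]; rfl

theorem two_mul_eq_smul (x : A) : 2 * x = (2 : Sg) • x := by rw [two_mul, two_smul]

theorem dotProduct_vecV : vecV ⬝ᵥ vecV = 4 * (E₃ * F₃ + E₄ * F₄) := by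
  simp only [vecV_eq, dotProduct, Fin.sum_univ_four, Matrix.cons_val]
  linear_combination ((E₃ - F₃) ^ 2 + (E₄ - F₄) ^ 2) * CI_sq

theorem trace_matZ_one : (matZ 1 * matZ 1).trace = 4 * ((H₁ + H₂) ^ 2 + 4 * E₁ * F₁) := by
  simp only [matZ_one, Matrix.trace, Matrix.diag, Matrix.mul_apply, Fin.sum_univ_four,
    Matrix.of_apply, Matrix.cons_val]
  linear_combination (-4 * (H₁ + H₂) ^ 2 - 4 * (E₁ + F₁) ^ 2) * CI_sq

theorem trace_matZ_neg_one : (matZ (-1) * matZ (-1)).trace = 4 * ((H₁ - H₂) ^ 2 + 4 * E₂ * F₂) := by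
  simp only [matZ_neg_one, Matrix.trace, Matrix.diag, Matrix.mul_apply, Fin.sum_univ_four,
    Matrix.of_apply, Matrix.cons_val]
  linear_combination (-4 * (H₁ - H₂) ^ 2 - 4 * (E₂ + F₂) ^ 2) * CI_sq

theorem dotProduct_matZ : (vecV ᵥ* matZ 1 ᵥ* matZ (-1)) ⬝ᵥ vecV =
    -4 * (2 * (E₁ * E₂ * F₃ ^ 2 - E₁ * F₂ * F₄ ^ 2 + F₁ * F₂ * E₃ ^ 2 - F₁ * E₂ * E₄ ^ 2)
    - 2 * (H₁ - H₂) * (E₁ * F₃ * F₄ + F₁ * E₃ * E₄)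
    - 2 * (H₁ + H₂) * (F₂ * E₃ * F₄ + E₂ * F₃ * E₄)
    - (H₁ - H₂) * (H₁ + H₂) * (E₃ * F₃ - E₄ * F₄)) := by
  simp only [vecV_eq, matZ_one, matZ_neg_one, dotProduct, Matrix.vecMul, Fin.sum_univ_four,
    Matrix.of_apply, Matrix.cons_val]
  ring_nf
  simp only [CI_sq, CI_pow_three, CI_pow_four]
  ring

theorem pair_vecV : pair vecV = (2 : Sg) • D := by
  simp only [pair, vecV_eq, vecW_eq, Fin.sum_univ_four, Matrix.cons_val, D, tmul_eq_smul E₃,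
      tmul_eq_smul E₄,
    tmul_eq_smul F₃, tmul_eq_smul F₄]
  match_scalars <;> (ring_nf; try simp only [CI_sq, CI_pow_three, CI_pow_four]; try ring1)

theorem pair_matZ_one : pair (vecV ᵥ* matZ 1) = (2 : Sg) • f := by
  simp only [pair, vecV_eq, vecW_eq, matZ_one, dotProduct, Matrix.vecMul, Fin.sum_univ_four,
      Matrix.of_apply, Matrix.cons_val, f,
    tmul_one_mul, two_mul_eq_smul, tmul_eq_smul E₃, tmul_eq_smul E₄,
    tmul_eq_smul F₃, tmul_eq_smul F₄, tmul_eq_smul (_ * _)]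
  match_scalars <;> (ring_nf; try simp only [CI_sq, CI_pow_three, CI_pow_four]; try ring1)

theorem pair_matZ_neg_one : pair (vecV ᵥ* matZ (-1)) = (-2 : Sg) • g := by
  simp only [pair, vecV_eq, vecW_eq, matZ_neg_one, dotProduct, Matrix.vecMul, Fin.sum_univ_four,
      Matrix.of_apply, Matrix.cons_val, g,
    tmul_one_mul, two_mul_eq_smul, neg_mul (2 : A), tmul_eq_smul E₃, tmul_eq_smul E₄,
    tmul_eq_smul F₃, tmul_eq_smul F₄, tmul_eq_smul (_ * _)]
  match_scalars <;> (ring_nf; try simp only [CI_sq, CI_pow_three, CI_pow_four]; try ring1)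

set_option maxHeartbeats 1000000 in
theorem pair_matZ_matZ : pair (vecV ᵥ* matZ 1 ᵥ* matZ (-1)) = (-4 : Sg) • h := by
  have h2 (x : A) : (4 : Sg) • ((1 / 2 : ℂ) • x) = (2 : Sg) • x := by
    rw [← algebraMap_smul Sg (1 / 2 : ℂ) x, smul_smul, ← map_ofNat (algebraMap ℂ Sg) 4, ← map_mul]
    norm_num
    rw [← map_ofNat (algebraMap ℂ Sg) 2, algebraMap_smul]
  simp only [pair, vecV_eq, vecW_eq, matZ_one, matZ_neg_one, dotProduct, Matrix.vecMul,
      Fin.sum_univ_four, Matrix.of_apply, Matrix.cons_val, h,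
    tmul_one_mul, two_mul_eq_smul, neg_smul, smul_sub (4 : Sg), h2]
  simp only [tmul_eq_smul E₃, tmul_eq_smul E₄, tmul_eq_smul F₃, tmul_eq_smul F₄,
      tmul_eq_smul (_ * _)]
  match_scalars <;> (ring_nf; try simp only [CI_sq, CI_pow_three, CI_pow_four]; try ring1)

theorem pair₂_matZ_one : pair₂ (matZ 1) = (4 : Sg) • d := by
  simp only [pair₂, vecW_eq, matZ_one, Fin.sum_univ_four, Matrix.of_apply, Matrix.cons_val, d,
    tmul_eq_smul (2 * _), tmul_eq_smul (_ + _), tmul_eq_smul (_ - _), smul_mul_assoc, mul_smul_comm,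
        add_mul, mul_add,
    sub_mul, mul_sub, zero_smul, add_zero, zero_add, Algebra.TensorProduct.tmul_mul_tmul, one_mul,
    mul_assoc, TensorProduct.tmul_neg, TensorProduct.tmul_add, TensorProduct.tmul_sub,
        TensorProduct.tmul_zero, neg_mul, mul_neg, neg_neg,
    neg_zero, mul_zero, smul_zero, wE₃_sq, wE₃_sq_mul, wE₄_sq, wE₄_sq_mul, wE₄_mul_wE₃,
        wE₄_mul_wE₃_mul, wF₃_sq, wF₃_sq_mul, wF₃_mul_wE₃, wF₃_mul_wE₃_mul, wF₃_mul_wE₄,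
        wF₃_mul_wE₄_mul, wF₄_sq, wF₄_sq_mul, wF₄_mul_wE₃, wF₄_mul_wE₃_mul, wF₄_mul_wE₄,
        wF₄_mul_wE₄_mul, wF₄_mul_wF₃, wF₄_mul_wF₃_mul]
  match_scalars <;> (ring_nf; try simp only [CI_sq, CI_pow_three, CI_pow_four]; try ring1)

theorem pair₂_matZ_neg_one : pair₂ (matZ (-1)) = (-4 : Sg) • e := by
  simp only [pair₂, vecW_eq, matZ_neg_one, Fin.sum_univ_four, Matrix.of_apply, Matrix.cons_val, e,
    tmul_eq_smul (2 * _), tmul_eq_smul (_ + _), tmul_eq_smul (_ - _), smul_mul_assoc, mul_smul_comm,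
        add_mul, mul_add,
    sub_mul, mul_sub, zero_smul, add_zero, zero_add, Algebra.TensorProduct.tmul_mul_tmul, one_mul,
    mul_assoc, TensorProduct.tmul_neg, TensorProduct.tmul_add, TensorProduct.tmul_sub,
        TensorProduct.tmul_zero, neg_mul, mul_neg, neg_neg,
    neg_zero, mul_zero, smul_zero, wE₃_sq, wE₃_sq_mul, wE₄_sq, wE₄_sq_mul, wE₄_mul_wE₃,
        wE₄_mul_wE₃_mul, wF₃_sq, wF₃_sq_mul, wF₃_mul_wE₃, wF₃_mul_wE₃_mul, wF₃_mul_wE₄,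
        wF₃_mul_wE₄_mul, wF₄_sq, wF₄_sq_mul, wF₄_mul_wE₃, wF₄_mul_wE₃_mul, wF₄_mul_wE₄,
        wF₄_mul_wE₄_mul, wF₄_mul_wF₃, wF₄_mul_wF₃_mul]
  match_scalars <;> (ring_nf; try simp only [CI_sq, CI_pow_three, CI_pow_four]; try ring1)

theorem d_mul_d : d * d = (-2 : Sg) • (a₁ * i) := by
  simp only [d, a₁, i, tmul_one_mul,
    tmul_eq_smul (2 * _), tmul_eq_smul (_ + _), smul_mul_assoc, mul_smul_comm, add_mul, mul_add,
    sub_mul, mul_sub, zero_smul, add_zero, zero_add, Algebra.TensorProduct.tmul_mul_tmul, one_mul,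
    mul_assoc, TensorProduct.tmul_neg, TensorProduct.tmul_add, TensorProduct.tmul_sub,
        TensorProduct.tmul_zero, neg_mul, mul_neg, neg_neg,
    neg_zero, mul_zero, smul_zero, wE₃_sq, wE₃_sq_mul, wE₄_sq, wE₄_sq_mul, wE₄_mul_wE₃,
        wE₄_mul_wE₃_mul, wF₃_sq, wF₃_sq_mul, wF₃_mul_wE₃, wF₃_mul_wE₃_mul, wF₃_mul_wE₄,
        wF₃_mul_wE₄_mul, wF₄_sq, wF₄_sq_mul, wF₄_mul_wE₃, wF₄_mul_wE₃_mul, wF₄_mul_wE₄,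
        wF₄_mul_wE₄_mul, wF₄_mul_wF₃, wF₄_mul_wF₃_mul]
  match_scalars <;> ring1

theorem d_mul_f : d * f = (-1 : Sg) • (a₁ * j) := by
  simp only [d, f, a₁, j, tmul_one_mul, two_mul_eq_smul, tmul_eq_smul E₃, tmul_eq_smul E₄,
    tmul_eq_smul F₃, tmul_eq_smul F₄, tmul_eq_smul (_ * _),
    tmul_eq_smul (2 * _), tmul_eq_smul (_ + _), smul_mul_assoc, mul_smul_comm, add_mul, mul_add,
    sub_mul, mul_sub, zero_smul, add_zero, zero_add, Algebra.TensorProduct.tmul_mul_tmul, one_mul,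
    mul_assoc, TensorProduct.tmul_neg, TensorProduct.tmul_add, TensorProduct.tmul_sub,
        TensorProduct.tmul_zero, neg_mul, mul_neg, neg_neg,
    neg_zero, mul_zero, smul_zero, wE₃_sq, wE₃_sq_mul, wE₄_sq, wE₄_sq_mul, wE₄_mul_wE₃,
        wE₄_mul_wE₃_mul, wF₃_sq, wF₃_sq_mul, wF₃_mul_wE₃, wF₃_mul_wE₃_mul, wF₃_mul_wE₄,
        wF₃_mul_wE₄_mul, wF₄_sq, wF₄_sq_mul, wF₄_mul_wE₃, wF₄_mul_wE₃_mul, wF₄_mul_wE₄,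
        wF₄_mul_wE₄_mul, wF₄_mul_wF₃, wF₄_mul_wF₃_mul]
  match_scalars <;> ring1

/-! ### Coordinates on `S(𝔤) ⊗ Λ(𝔭)` -/

/-- Polynomial functions on `ℂⁿ` with values in `Λ(𝔭)`. -/
abbrev PolyMap (n : ℕ) : Type := MvPolynomial (Fin n) ℂ ⊗[ℂ] Λp

/-- `S(𝔤)` as the polynomial ring in the ten variables given by `gvec`. -/
def polyEquiv : Sg ≃ₐ[ℂ] MvPolynomial (Fin 10) ℂ := SymmetricAlgebra.equivMvPolynomial gBasis

theorem polyEquiv_ι (i : Fin 10) :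
    polyEquiv (SymmetricAlgebra.ι ℂ 𝔤 (gvec i)) = MvPolynomial.X i := by
  rw [← gBasis_apply]
  exact SymmetricAlgebra.equivMvPolynomial_ι_apply gBasis i

theorem polyEquiv_H₁_add_H₂ : polyEquiv H₁ + polyEquiv H₂ = MvPolynomial.X 0 := by
  rw [← polyEquiv_ι, ← map_add, H₁, H₂, ← map_add]; rfl
theorem polyEquiv_E₁ : polyEquiv E₁ = MvPolynomial.X 1 := polyEquiv_ι 1
theorem polyEquiv_F₁ : polyEquiv F₁ = MvPolynomial.X 2 := polyEquiv_ι 2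
theorem polyEquiv_H₁_sub_H₂ : polyEquiv H₁ - polyEquiv H₂ = MvPolynomial.X 3 := by
  rw [← polyEquiv_ι, ← map_sub, H₁, H₂, ← map_sub]; rfl
theorem polyEquiv_E₂ : polyEquiv E₂ = MvPolynomial.X 4 := polyEquiv_ι 4
theorem polyEquiv_F₂ : polyEquiv F₂ = MvPolynomial.X 5 := polyEquiv_ι 5
theorem polyEquiv_E₃ : polyEquiv E₃ = MvPolynomial.X 6 := polyEquiv_ι 6
theorem polyEquiv_E₄ : polyEquiv E₄ = MvPolynomial.X 7 := polyEquiv_ι 7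
theorem polyEquiv_F₃ : polyEquiv F₃ = MvPolynomial.X 8 := polyEquiv_ι 8
theorem polyEquiv_F₄ : polyEquiv F₄ = MvPolynomial.X 9 := polyEquiv_ι 9

theorem polyEquiv_two : polyEquiv 2 = 2 := map_ofNat polyEquiv 2
theorem polyEquiv_four : polyEquiv 4 = 4 := map_ofNat polyEquiv 4

/-- `S(𝔤) ⊗ Λ(𝔭)` as the algebra of polynomial maps `𝔤* → Λ(𝔭)`. -/
def mapEquiv : A ≃ₐ[ℂ] PolyMap 10 :=
  Algebra.TensorProduct.congr polyEquiv AlgEquiv.refl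

theorem mapEquiv_tmul (r : Sg) (w : Λp) : mapEquiv (r ⊗ₜ w) = polyEquiv r ⊗ₜ w := rfl

/-- The quadratic form `x² + 4 e f` in the first three variables. -/
def quad (n : ℕ) : MvPolynomial (Fin (n + 3)) ℂ :=
  MvPolynomial.X 0 ^ 2 + 4 * MvPolynomial.X 1 * MvPolynomial.X 2

theorem quad_ne_zero (n : ℕ) : quad n ≠ 0 := by
  intro h0
  have := congrArg (MvPolynomial.eval fun i => if i = 0 then (1 : ℂ) else 0) h0
  simp [quad] at this

/-- The monomials `wmono` as a basis of `PolyMap n` over the polynomial ring. -/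
def mapBasis (n : ℕ) : Module.Basis (Fin 16) (MvPolynomial (Fin n) ℂ) (PolyMap n) :=
  Algebra.TensorProduct.basis _ wBasis

theorem mapBasis_repr_tmul {n : ℕ} (p : MvPolynomial (Fin n) ℂ) (w : Λp) (i : Fin 16) :
    (mapBasis n).repr (p ⊗ₜ w) i = wBasis.repr w i • p := by
  rw [mapBasis, Algebra.TensorProduct.basis_repr_tmul]
  simp [Algebra.smul_def, mul_comm]

theorem tmul_one_mul_eq_smul {n : ℕ} (p : MvPolynomial (Fin n) ℂ) (x : PolyMap n) :
    (p ⊗ₜ 1 : PolyMap n) * x = p • x := by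
  exact (Algebra.smul_def p x).symm

theorem smul_left_cancel {n : ℕ} {p : MvPolynomial (Fin n) ℂ} (hp : p ≠ 0) {x y : PolyMap n}
    (h : p • x = p • y) : x = y := by
  apply (mapBasis n).repr.injective
  ext1 i
  have := DFunLike.congr_fun (congrArg (mapBasis n).repr h) i
  simpa [hp] using this

theorem mapEquiv_a₁ : mapEquiv a₁ = quad 7 ⊗ₜ 1 := by
  rw [a₁, mapEquiv_tmul]
  simp only [map_add, map_mul, map_pow, quad, polyEquiv_four, polyEquiv_H₁_add_H₂, polyEquiv_E₁,
      polyEquiv_F₁]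

theorem a₁_mul_cancel {x y : A} (h : a₁ * x = a₁ * y) : x = y := by
  apply mapEquiv.injective
  apply smul_left_cancel (quad_ne_zero 7)
  rw [← tmul_one_mul_eq_smul, ← tmul_one_mul_eq_smul, ← mapEquiv_a₁, ← map_mul, ← map_mul, h]

/-! ### Invariance of `S` and `T` -/

/-- Elements fixed by `actC k` for all special orthogonal matrices `k`. -/
def FixedBySO (x : A) : Prop := ∀ k : Mat4, k * kᵀ = 1 → k.det = 1 → actC k x = x

theorem fixed_of_smul (n : ℤ) (hn : n ≠ 0) {x : A} (h : FixedBySO ((n : Sg) • x)) :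
    FixedBySO x := by
  intro k hk hd
  have := h k hk hd
  rw [actC_smul, map_intCast] at this
  have h2 (y : A) : (n : Sg) • y = (n : ℂ) • y := by
    rw [← algebraMap_smul Sg (n : ℂ) y, map_intCast]
  rw [h2, h2] at this
  exact smul_right_injective A (Int.cast_ne_zero.2 hn : (n : ℂ) ≠ 0) this

theorem fixed_tmul_one {r : Sg} {n : ℤ} (hn : n ≠ 0)
    (h : ∀ k : Mat4, k * kᵀ = 1 → k.det = 1 → actS k (n * r) = n * r) : FixedBySO (r ⊗ₜ 1) := by
  refine fixed_of_smul n hn fun k hk hd => ?_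
  rw [TensorProduct.smul_tmul', smul_eq_mul, actC_tmul, h k hk hd, map_one]

theorem FixedBySO.mul {x y : A} (hx : FixedBySO x) (hy : FixedBySO y) : FixedBySO (x * y) :=
  fun k hk hd => by rw [map_mul, hx k hk hd, hy k hk hd]

theorem FixedBySO.of_a₁_mul {x : A} (h1 : FixedBySO a₁) (h : FixedBySO (a₁ * x)) : FixedBySO x :=
  fun k hk hd => a₁_mul_cancel (by
    have := h k hk hd
    rwa [map_mul, h1 k hk hd] at this)

theorem fixed_a₁ : FixedBySO a₁ := fixed_tmul_one (n := 4) (by norm_num) fun k hk hd => by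
  have := actS_trace hk hd 1
  rw [trace_matZ_one] at this
  exact_mod_cast this

theorem fixed_a₂ : FixedBySO a₂ := fixed_tmul_one (n := 4) (by norm_num) fun k hk hd => by
  have := actS_trace hk hd (-1)
  rw [trace_matZ_neg_one] at this
  exact_mod_cast this

theorem fixed_b : FixedBySO b := fixed_tmul_one (n := 4) (by norm_num) fun k hk hd => by
  have := actS_dotProduct hk (actS_vecV k) (actS_vecV k)
  rw [dotProduct_vecV] at this
  exact_mod_cast this

theorem fixed_c : FixedBySO c := fixed_tmul_one (n := -4) (by norm_num) fun k hk hd => by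
  have := actS_dotProduct hk
    (actS_vecMul hk hd (-1) (actS_vecMul hk hd 1 (actS_vecV k))) (actS_vecV k)
  rw [dotProduct_matZ] at this
  exact_mod_cast this

theorem fixed_D : FixedBySO D := fixed_of_smul 2 (by norm_num) fun k hk hd => by
  have := actC_pair hk (actS_vecV k)
  rw [pair_vecV] at this
  exact_mod_cast this

theorem fixed_f : FixedBySO f := fixed_of_smul 2 (by norm_num) fun k hk hd => by
  have := actC_pair hk (actS_vecMul hk hd 1 (actS_vecV k))
  rw [pair_matZ_one] at this
  exact_mod_cast this

theorem fixed_g : FixedBySO g := fixed_of_smul (-2) (by norm_num) fun k hk hd => by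
  have := actC_pair hk (actS_vecMul hk hd (-1) (actS_vecV k))
  rw [pair_matZ_neg_one] at this
  exact_mod_cast this

theorem fixed_h : FixedBySO h := fixed_of_smul (-4) (by norm_num) fun k hk hd => by
  have := actC_pair hk (actS_vecMul hk hd (-1) (actS_vecMul hk hd 1 (actS_vecV k)))
  rw [pair_matZ_matZ] at this
  exact_mod_cast this

theorem fixed_d : FixedBySO d := fixed_of_smul 4 (by norm_num) fun k hk hd => by
  have := actC_pair₂ hk hd 1
  rw [pair₂_matZ_one] at this
  exact_mod_cast this

theorem fixed_e : FixedBySO e := fixed_of_smul (-4) (by norm_num) fun k hk hd => by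
  have := actC_pair₂ hk hd (-1)
  rw [pair₂_matZ_neg_one] at this
  exact_mod_cast this

/-- As `a₁` is not a zero divisor, `i` is invariant because `d²` is. -/
theorem fixed_i : FixedBySO i := by
  refine fixed_a₁.of_a₁_mul (fixed_of_smul (-2) (by norm_num) ?_)
  have := fixed_d.mul fixed_d
  rw [d_mul_d] at this
  exact_mod_cast this

/-- As `a₁` is not a zero divisor, `j` is invariant because `d f` is. -/
theorem fixed_j : FixedBySO j := by
  refine fixed_a₁.of_a₁_mul (fixed_of_smul (-1) (by norm_num) ?_)
  have := fixed_d.mul fixed_f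
  rw [d_mul_f] at this
  exact_mod_cast this

theorem fixed_t (l : Fin 16) : FixedBySO (t l) := by
  have h1 : FixedBySO 1 := fun k _ _ => map_one _
  fin_cases l
  exacts [h1, fixed_D, fixed_d, fixed_e, fixed_f, fixed_g, fixed_h, fixed_i, fixed_j,
    fixed_D.mul fixed_d, fixed_D.mul fixed_e, fixed_D.mul fixed_f, fixed_D.mul fixed_g,
    fixed_f.mul fixed_g, fixed_D.mul fixed_h, fixed_d.mul fixed_g]

theorem fixed_s (n₁ n₂ n₃ n₄ : ℕ) : FixedBySO (s n₁ n₂ n₃ n₄) := fun k hk hd => by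
  simp only [s, map_mul, map_pow, fixed_a₁ k hk hd, fixed_a₂ k hk hd, fixed_b k hk hd,
    fixed_c k hk hd]

theorem FixedBySO.mem_invariants {x : A} (hx : FixedBySO x) : x ∈ invariants := fun k => by
  rw [act_eq_actC]
  have hk := (Matrix.mem_orthogonalGroup_iff (Fin 4) ℝ).1
    (Matrix.mem_specialOrthogonalGroup_iff.1 k.2).1
  have hd := (Matrix.mem_specialOrthogonalGroup_iff.1 k.2).2
  refine hx _ ?_ ?_
  · have := congrArg (fun M : Matrix (Fin 4) (Fin 4) ℝ => M.map Complex.ofRealHom) hk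
    rw [Matrix.map_mul, Matrix.transpose_map, Matrix.map_one _ (map_zero _) (map_one _)] at this
    exact this
  · have := congrArg Complex.ofRealHom hd
    rwa [RingHom.map_det, map_one] at this

theorem T_eq_range : T = Set.range t := by
  simp only [T, t, Matrix.range_cons, Matrix.range_empty, Set.union_empty, Set.singleton_union]

/-! ### From `SO(4)` to complex unipotent elements -/

/-- A holomorphic function vanishing on the real unit sphere vanishes at the complex points
`(1, w, ± i w)`: circles of radius `ρ` on the sphere complexify to hyperbolas, which approach the
isotropic lines through the pole as `ρ → 0`. -/
theorem eq_zero_of_sphere {G : ℂ × ℂ × ℂ → ℂ} (hG : Differentiable ℂ G)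
    (h : ∀ z α β : ℝ, z ^ 2 + α ^ 2 + β ^ 2 = 1 → G (z, α, β) = 0)
    {ε : ℝ} (hε : ε ^ 2 = 1) (w : ℂ) : G (1, w, ε * Complex.I * w) = 0 := by
  rcases eq_or_ne w 0 with rfl | hw
  · simpa using h 1 0 0 (by norm_num)
  -- the circle of radius `ρ`: the angle may be complex, by the identity theorem
  have key (ρ : ℝ) (h0 : 0 < ρ) (h1 : ρ < 1) (θ : ℂ) :
      G (((√(1 - ρ ^ 2) : ℝ) : ℂ), ρ * Complex.cos θ, -ε * (ρ * Complex.sin θ)) = 0 := by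
    set F : ℂ → ℂ := fun θ =>
      G (((√(1 - ρ ^ 2) : ℝ) : ℂ), ρ * Complex.cos θ, -ε * (ρ * Complex.sin θ)) with hF
    have hd : Differentiable ℂ F := by
      refine hG.comp ?_
      fun_prop
    have hr (θ : ℝ) : F θ = 0 := by
      have := h (√(1 - ρ ^ 2)) (ρ * Real.cos θ) (-ε * (ρ * Real.sin θ)) (by
        rw [Real.sq_sqrt (by nlinarith)]
        linear_combination ρ ^ 2 * Real.sin_sq_add_cos_sq θ + ρ ^ 2 * (Real.sin θ) ^ 2 * hε)
      push_cast at this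
      exact this
    have ha : AnalyticOnNhd ℂ F Set.univ := fun z _ => hd.analyticAt z
    refine ha.eqOn_zero_of_preconnected_of_frequently_eq_zero isPreconnected_univ
      (Set.mem_univ 0) ?_ (Set.mem_univ θ)
    have ht : Filter.Tendsto (fun n : ℕ => ((1 / ((n : ℝ) + 1) : ℝ) : ℂ)) Filter.atTop
        (nhdsWithin 0 {0}ᶜ) := by
      refine tendsto_nhdsWithin_iff.2 ⟨?_, Filter.Eventually.of_forall fun n => ?_⟩
      · exact (Complex.continuous_ofReal.tendsto' 0 0 Complex.ofReal_zero).comp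
          tendsto_one_div_add_atTop_nhds_zero_nat
      · have : (1 / ((n : ℝ) + 1)) ≠ 0 := by positivity
        exact Complex.ofReal_ne_zero.2 this
    exact ht.frequently (Filter.Frequently.of_forall fun n => hr _)
  -- the complex angle with `ρ exp (i θ) = 2 w`
  have key2 (ρ : ℝ) (h0 : 0 < ρ) (h1 : ρ < 1) :
      G (((√(1 - ρ ^ 2) : ℝ) : ℂ), (2 * w + ρ ^ 2 / (2 * w)) / 2,
        ε * Complex.I * ((2 * w - ρ ^ 2 / (2 * w)) / 2)) = 0 := by
    have hρ : (ρ : ℂ) ≠ 0 := by exact_mod_cast h0.ne'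
    set θ : ℂ := -Complex.I * Complex.log (2 * w / ρ) with hθ
    have e1 : Complex.exp (θ * Complex.I) = 2 * w / ρ := by
      rw [hθ, show -Complex.I * Complex.log (2 * w / ρ) * Complex.I = Complex.log (2 * w / ρ) by
        linear_combination (-Complex.log (2 * w / ρ)) * Complex.I_mul_I]
      exact Complex.exp_log (by simp [hw, hρ])
    have e2 : Complex.exp (-θ * Complex.I) = ρ / (2 * w) := by
      rw [neg_mul, Complex.exp_neg, e1, inv_div]
    have := key ρ h0 h1 θ
    rw [Complex.cos, Complex.sin, e1, e2] at this
    convert this using 2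
    field_simp
    congr 1
    ring_nf
  have hc : Continuous fun ρ : ℝ => G (((√(1 - ρ ^ 2) : ℝ) : ℂ), (2 * w + ρ ^ 2 / (2 * w)) / 2,
        ε * Complex.I * ((2 * w - ρ ^ 2 / (2 * w)) / 2)) := by
    refine hG.continuous.comp ?_
    fun_prop
  have hl := hc.tendsto 0
  have h0 : Filter.Tendsto (fun ρ : ℝ => G (((√(1 - ρ ^ 2) : ℝ) : ℂ), (2 * w + ρ ^ 2 / (2 * w)) / 2,
        ε * Complex.I * ((2 * w - ρ ^ 2 / (2 * w)) / 2))) (nhdsWithin 0 (Set.Ioi 0)) (nhds 0) := by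
    refine tendsto_const_nhds.congr' ?_
    filter_upwards [Ioo_mem_nhdsGT (zero_lt_one' ℝ)] with ρ hρ
    exact (key2 ρ hρ.1 hρ.2).symm
  have := tendsto_nhds_unique (hl.mono_left nhdsWithin_le_nhds) h0
  simpa using this

/-- The functions on `P` with values in `A` that are finite sums of holomorphic functions with
constant coefficients. -/
def holo (P : Type) [NormedAddCommGroup P] [NormedSpace ℂ P] : Submodule ℂ (P → A) :=
  Submodule.span ℂ {ψ | ∃ F : P → ℂ, Differentiable ℂ F ∧ ∃ y : A, ψ = fun p => F p • y}

section
variable {P : Type} [NormedAddCommGroup P] [NormedSpace ℂ P]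

theorem smul_mem_holo {F : P → ℂ} (hF : Differentiable ℂ F) (y : A) :
    (fun p => F p • y) ∈ holo P := Submodule.subset_span ⟨F, hF, y, rfl⟩

theorem const_mem_holo (y : A) : (fun _ => y) ∈ holo P := by
  simpa using smul_mem_holo (P := P) (F := fun _ => 1) (by fun_prop) y

theorem mul_mem_holo {φ ψ : P → A} (hφ : φ ∈ holo P) (hψ : ψ ∈ holo P) : φ * ψ ∈ holo P := by
  have : holo P * holo P ≤ holo P := by
    rw [holo, Submodule.span_mul_span, Submodule.span_le]
    rintro _ ⟨_, ⟨F, hF, x, rfl⟩, _, ⟨F', hF', y, rfl⟩, rfl⟩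
    have := smul_mem_holo (hF.mul hF') (x * y)
    change (fun p => F p • x) * (fun p => F' p • y) ∈ holo P
    convert this using 1
    ext p
    simp [smul_mul_smul_comm]
  exact this (Submodule.mul_mem_mul hφ hψ)

theorem differentiable_of_mem_holo {φ : P → A} (hφ : φ ∈ holo P) (l : A →ₗ[ℂ] ℂ) :
    Differentiable ℂ fun p => l (φ p) := by
  induction hφ using Submodule.span_induction with
  | mem φ hφ =>
    obtain ⟨F, hF, y, rfl⟩ := hφ
    simpa using hF.mul_const (l y)
  | zero => simp
  | add x y _ _ hx hy =>
    simp only [Pi.add_apply, map_add]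
    exact hx.add hy
  | smul r x _ hx =>
    simp only [Pi.smul_apply, map_smul]
    exact hx.const_mul r

theorem differentiable_matCoord {M : P → Mat} (hM : ∀ a b, Differentiable ℂ fun p => M p a b)
    (l : Fin 10) : Differentiable ℂ fun p => matCoord (M p) l := by
  fin_cases l <;> simp only [matCoord, Matrix.cons_val, Fin.zero_eta, Fin.mk_one,
      Fin.reduceFinMk] <;>
    fun_prop

theorem differentiable_coord {K : P → Mat4} (hK : ∀ i j, Differentiable ℂ fun p => K p i j)
    (x : 𝔤) (l : Fin 10) : Differentiable ℂ fun p => gBasis.repr (AdC (K p) x) l := by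
  have hE (a b : Idx) : Differentiable ℂ fun p => embC (K p) a b := by
    rcases a with a | a <;> rcases b with b | b <;> simp [embC, hK]
  refine differentiable_matCoord (M := fun p => AdC (K p) x) (fun a b => ?_) l
  simp only [AdC, LinearMap.coe_mk, AddHom.coe_mk, Matrix.mul_apply, Matrix.transpose_apply]
  fun_prop

theorem sum_mem_holo {ι : Type} (S : Finset ι) {F : ι → P → A} (h : ∀ l, F l ∈ holo P) :
    (fun p => ∑ l ∈ S, F l p) ∈ holo P := by
  have := (holo P).sum_mem (t := S) (f := F) fun l _ => h l
  convert this using 1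
  ext p
  simp

theorem coe_AdCp (k : Mat4) (x : 𝔭) : (AdCp k x : 𝔤) = AdC k x := rfl

theorem actC_ι_tmul_one (k : Mat4) (x : 𝔤) : actC k (SymmetricAlgebra.ι ℂ 𝔤 x ⊗ₜ 1) =
    ∑ l, gBasis.repr (AdC k x) l • (SymmetricAlgebra.ι ℂ 𝔤 (gBasis l) ⊗ₜ 1 : A) := by
  have h1 : actC k (SymmetricAlgebra.ι ℂ 𝔤 x ⊗ₜ 1) = SymmetricAlgebra.ι ℂ 𝔤 (AdC k x) ⊗ₜ 1 := by
    simp [actC]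
  rw [h1]
  conv_lhs => rw [← gBasis.sum_repr (AdC k x)]
  rw [map_sum, TensorProduct.sum_tmul]
  simp only [map_smul, TensorProduct.smul_tmul']

theorem actC_one_tmul_ι (k : Mat4) (x : 𝔭) : actC k (1 ⊗ₜ ExteriorAlgebra.ι ℂ x) =
    ∑ l, gBasis.repr (AdC k x) (Fin.natAdd 6 l) • (1 ⊗ₜ ExteriorAlgebra.ι ℂ (pvec l) : A) := by
  have h1 : actC k (1 ⊗ₜ ExteriorAlgebra.ι ℂ x) = 1 ⊗ₜ ExteriorAlgebra.ι ℂ (AdCp k x) := by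
    rw [actC_tmul, map_one, ExteriorAlgebra.map_apply_ι]
  have h2 := congrArg (ExteriorAlgebra.ι ℂ) (eq_sum_pvec (AdCp k x))
  rw [map_sum] at h2
  simp only [map_smul, coe_AdCp] at h2
  rw [h1, h2, TensorProduct.tmul_sum]
  refine Finset.sum_congr rfl fun l _ => ?_
  rw [TensorProduct.tmul_smul]

theorem actC_mem_holo {K : P → Mat4} (hK : ∀ i j, Differentiable ℂ fun p => K p i j) (x : A) :
    (fun p => actC (K p) x) ∈ holo P := by
  have hmul {x y : A} (hx : (fun p => actC (K p) x) ∈ holo P) (hy : (fun p => actC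
      (K p) y) ∈ holo P) :
      (fun p => actC (K p) (x * y)) ∈ holo P := by
    simp only [map_mul]
    exact mul_mem_holo hx hy
  have hadd {x y : A} (hx : (fun p => actC (K p) x) ∈ holo P) (hy : (fun p => actC
      (K p) y) ∈ holo P) :
      (fun p => actC (K p) (x + y)) ∈ holo P := by
    simp only [map_add]
    exact add_mem hx hy
  induction x using TensorProduct.induction_on with
  | zero => simpa only [map_zero] using const_mem_holo 0
  | add x y hx hy => exact hadd hx hy
  | tmul r w =>
    have hr : (fun p => actC (K p) (r ⊗ₜ 1)) ∈ holo P := by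
      induction r using SymmetricAlgebra.induction with
      | algebraMap r =>
        have (p : P) : actC (K p) (algebraMap ℂ Sg r ⊗ₜ 1) = algebraMap ℂ Sg r ⊗ₜ 1 :=
          (actC (K p)).commutes r
        simp only [this]
        exact const_mem_holo _
      | ι x =>
        simp only [actC_ι_tmul_one]
        exact sum_mem_holo _ fun l => smul_mem_holo (differentiable_coord hK x l) _
      | mul x y hx hy =>
        simpa only [Algebra.TensorProduct.tmul_mul_tmul, one_mul] using hmul hx hy
      | add x y hx hy => simpa only [TensorProduct.add_tmul] using hadd hx hy
    have hw : (fun p => actC (K p) (1 ⊗ₜ w)) ∈ holo P := by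
      induction w using ExteriorAlgebra.induction with
      | algebraMap r =>
        have (p : P) : actC (K p) (1 ⊗ₜ algebraMap ℂ Λp r) = 1 ⊗ₜ algebraMap ℂ Λp r := by
          rw [actC_tmul, AlgHom.commutes, map_one]
        simp only [this]
        exact const_mem_holo _
      | ι x =>
        simp only [actC_one_tmul_ι]
        exact sum_mem_holo _ fun l => smul_mem_holo (differentiable_coord hK x (Fin.natAdd 6 l)) _
      | mul x y hx hy =>
        simpa only [Algebra.TensorProduct.tmul_mul_tmul, one_mul] using hmul hx hy
      | add x y hx hy => simpa only [TensorProduct.tmul_add] using hadd hx hy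
    have := mul_mem_holo hr hw
    convert this using 1
    ext p
    rw [Pi.mul_apply, ← map_mul, Algebra.TensorProduct.tmul_mul_tmul, one_mul, mul_one]

end

/-- The two families of matrices `z + α J + β J'`, where `J`, `J'` anticommute and are the real and
imaginary part of a nilpotent matrix in one of the two ideals of `𝔰𝔬(4)`, chosen by `η = ± 1`. -/
def kMat {R : Type*} [Ring R] (η : R) (z α β : R) : Matrix (Fin 4) (Fin 4) R :=
  !![z, 0, α, η * β; 0, z, β, -η * α; -α, -β, z, 0; -η * β, η * α, 0, z]

theorem kMat_mul_transpose {R : Type*} [CommRing R] {η z α β : R} (hη : η ^ 2 = 1)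
    (h : z ^ 2 + α ^ 2 + β ^ 2 = 1) : kMat η z α β * (kMat η z α β)ᵀ = 1 := by
  ext a b
  fin_cases a <;> fin_cases b <;> simp [kMat, Matrix.mul_apply, Fin.sum_univ_succ] <;> grind

theorem det_kMat {R : Type*} [CommRing R] {η z α β : R} (hη : η ^ 2 = 1)
    (h : z ^ 2 + α ^ 2 + β ^ 2 = 1) : (kMat η z α β).det = 1 := by
  have : (kMat η z α β).det = (z ^ 2 + α ^ 2 + β ^ 2) ^ 2 +
      (η ^ 2 - 1) * ((α ^ 2 + β ^ 2) * (z ^ 2 + α ^ 2 + β ^ 2)) := by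
    simp [kMat, Matrix.det_succ_row_zero, Fin.sum_univ_succ, Fin.succAbove]
    ring
  rw [this, h, hη]
  ring

theorem actC_of_mem_invariants {x : A} (hx : x ∈ invariants) {k : Matrix (Fin 4) (Fin 4) ℝ}
    (hk : k * kᵀ = 1) (hd : k.det = 1) : actC (k.map Complex.ofReal) x = x := by
  have := hx ⟨k, Matrix.mem_specialOrthogonalGroup_iff.2
    ⟨(Matrix.mem_orthogonalGroup_iff (Fin 4) ℝ).2 hk, hd⟩⟩
  rwa [act_eq_actC] at this

/-- Invariants are fixed by four one-parameter groups of complex unipotent matrices. The matrix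
coefficients of `kMat η z α β` on an invariant are holomorphic in `(z, α, β)` and constant on the
unit sphere, where `kMat η z α β` lies in `SO(4)`, so `eq_zero_of_sphere` applies. -/
theorem actC_kMat_of_mem_invariants {x : A} (hx : x ∈ invariants) {η ε : ℝ} (hη : η ^ 2 = 1)
    (hε : ε ^ 2 = 1) (w : ℂ) : actC (kMat (η : ℂ) 1 w (ε * Complex.I * w)) x = x := by
  rw [← sub_eq_zero, ← Module.forall_dual_apply_eq_zero_iff ℂ]
  intro l
  have hK (i j : Fin 4) : Differentiable ℂ fun p : ℂ × ℂ × ℂ => kMat (η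
      : ℂ) p.1 p.2.1 p.2.2 i j := by
    fin_cases i <;> fin_cases j <;> simp [kMat] <;> fun_prop
  have hd := (differentiable_of_mem_holo (actC_mem_holo hK x) l).sub_const (l x)
  have := eq_zero_of_sphere hd (fun z α β h => ?_) hε w
  · rw [map_sub]
    exact this
  · have h1 : kMat (η : ℂ) z α β = (kMat η z α β).map Complex.ofReal := by
      ext a b
      fin_cases a <;> fin_cases b <;> simp [kMat]
    change l (actC (kMat (η : ℂ) z α β) x) - l x = 0
    rw [h1, actC_of_mem_invariants hx (kMat_mul_transpose hη h) (det_kMat hη h), sub_self]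

theorem actC_neg_one_of_mem_invariants {x : A} (hx : x ∈ invariants) : actC (-1) x = x := by
  have h1 : (-1 : Mat4) = (-1 : Matrix (Fin 4) (Fin 4) ℝ).map Complex.ofReal := by
    ext a b
    simp [Matrix.one_apply, apply_ite]
  rw [h1]
  refine actC_of_mem_invariants hx (by simp) ?_
  rw [Matrix.det_neg, Matrix.det_one, mul_one, Fintype.card_fin]
  norm_num

/-! ### Polynomials on the nilpotent cone, and invariants of unipotent substitutions -/

section Polynomials
open MvPolynomial

/-- A polynomial vanishes if it does so at the points where another one does not vanish. -/
theorem eq_zero_of_eval_mul {n : ℕ} {p q : MvPolynomial (Fin n) ℂ} (hq : q ≠ 0)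
    (h : ∀ P : Fin n → ℂ, eval P q ≠ 0 → eval P p = 0) : p = 0 := by
  have : p * q = 0 := funext fun P => by
    rw [map_mul, map_zero]
    by_cases hP : eval P q = 0
    · rw [hP, mul_zero]
    · rw [h P hP, zero_mul]
  exact (mul_eq_zero.1 this).resolve_right hq

/-- Division by `quad n`, which is monic in the first variable. -/
theorem exists_eq_add_X_mul_add_quad_mul {n : ℕ} (p : MvPolynomial (Fin (n + 3)) ℂ) :
    ∃ (u v : MvPolynomial (Fin (n + 2)) ℂ) (q : MvPolynomial (Fin (n + 3)) ℂ),
      p = rename Fin.succ u + X 0 * rename Fin.succ v + quad n * q := by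
  induction p using MvPolynomial.induction_on with
  | C z => exact ⟨C z, 0, 0, by simp⟩
  | add p p' hp hp' =>
    obtain ⟨u, v, q, rfl⟩ := hp
    obtain ⟨u', v', q', rfl⟩ := hp'
    exact ⟨u + u', v + v', q + q', by simp only [map_add]; ring⟩
  | mul_X p k hp =>
    obtain ⟨u, v, q, rfl⟩ := hp
    refine Fin.cases ?_ (fun k => ?_) k
    · refine ⟨-4 * X 0 * X 1 * v, u, q * X 0 + rename Fin.succ v, ?_⟩
      simp only [map_mul, map_neg, map_ofNat, rename_X, quad]
      rw [show Fin.succ (0 : Fin (n + 2)) = 1 from rfl,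
          show Fin.succ (1 : Fin (n + 2)) = 2 from rfl]
      ring
    · refine ⟨u * X k, v * X k, q * X k.succ, ?_⟩
      simp only [map_mul, rename_X]
      ring

/-- A polynomial vanishing at the generic points of the nilpotent cone `x² + 4 e f = 0` is
divisible by the equation of the cone. -/
theorem quad_dvd {n : ℕ} {p : MvPolynomial (Fin (n + 3)) ℂ}
    (h : ∀ P : Fin (n + 3) → ℂ, P 0 ^ 2 + 4 * P 1 * P 2 = 0 → P 1 ≠ 0 → eval P p = 0) :
    quad n ∣ p := by
  obtain ⟨u, v, q, rfl⟩ := exists_eq_add_X_mul_add_quad_mul p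
  have key (y : Fin (n + 2) → ℂ) (hy : y 0 ≠ 0) (z : ℂ) (hz : z ^ 2 = -4 * y 0 * y 1) :
      eval y u + z * eval y v = 0 := by
    have h1 := h (Fin.cons z y) (by
      rw [Fin.cons_zero, show (1 : Fin (n + 3)) = Fin.succ 0 from rfl,
        show (2 : Fin (n + 3)) = Fin.succ 1 from rfl, Fin.cons_succ, Fin.cons_succ, hz]
      ring) hy
    have h2 : eval (Fin.cons z y : Fin (n + 3) → ℂ) (quad n) = 0 := by
      simp only [quad, map_add, map_mul, map_pow, eval_X, map_ofNat]
      rw [Fin.cons_zero, show (1 : Fin (n + 3)) = Fin.succ 0 from rfl,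
        show (2 : Fin (n + 3)) = Fin.succ 1 from rfl, Fin.cons_succ, Fin.cons_succ, hz]
      ring
    have h3 : (Fin.cons z y : Fin (n + 3) → ℂ) ∘ Fin.succ = y := by
      ext k; simp
    rw [map_add, map_add, map_mul, map_mul, h2, eval_rename, eval_rename, h3, eval_X,
      Fin.cons_zero] at h1
    linear_combination h1
  have hX (k : Fin (n + 2)) : (X k : MvPolynomial (Fin (n + 2)) ℂ) ≠ 0 := X_ne_zero k
  -- both square roots of `-4 e f` occur as values of `x`
  have key2 (y : Fin (n + 2) → ℂ) (hy : y 0 ≠ 0) :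
      ∃ z : ℂ, z ^ 2 = -4 * y 0 * y 1 ∧ eval y u = 0 ∧ z * eval y v = 0 := by
    obtain ⟨z, hz⟩ := IsAlgClosed.exists_pow_nat_eq (-4 * y 0 * y 1) (n := 2) (by norm_num)
    have h1 := key y hy z hz
    have h2 := key y hy (-z) (by rw [neg_sq, hz])
    exact ⟨z, hz, by linear_combination (h1 + h2) / 2, by linear_combination (h1 - h2) / 2⟩
  have hu : u = 0 := eq_zero_of_eval_mul (hX 0) fun y hy => by
    rw [eval_X] at hy
    obtain ⟨z, -, h1, -⟩ := key2 y hy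
    exact h1
  have hv : v = 0 := eq_zero_of_eval_mul (mul_ne_zero (hX 0) (hX 1)) fun y hy => by
    rw [map_mul, eval_X, eval_X] at hy
    obtain ⟨z, hz, -, h1⟩ := key2 y (left_ne_zero_of_mul hy)
    refine (mul_eq_zero.1 h1).resolve_left fun h0 => hy ?_
    rw [h0] at hz
    linear_combination hz / 4
  rw [hu, hv]
  simp

/-- A polynomial vanishing at the generic points of the hyperplane `X 0 = 0` is divisible by
`X 0`. -/
theorem X_dvd_of_eval {n : ℕ} {p q : MvPolynomial (Fin (n + 1)) ℂ}
    (hq : aeval (Fin.cons 0 X : Fin (n + 1) → MvPolynomial (Fin n) ℂ) q ≠ 0)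
    (h : ∀ P : Fin (n + 1) → ℂ, P 0 = 0 → eval P q ≠ 0 → eval P p = 0) : X 0 ∣ p := by
  have h0 : aeval (Fin.cons 0 X : Fin (n + 1) → MvPolynomial (Fin n) ℂ) p = 0 := by
    have he (y : Fin n → ℂ) (r : MvPolynomial (Fin (n + 1)) ℂ) :
        eval y (aeval (Fin.cons 0 X : Fin (n + 1) → MvPolynomial (Fin n) ℂ) r) =
          eval (Fin.cons 0 y) r := by
      induction r using MvPolynomial.induction_on with
      | C z => simp
      | add r r' h h' => simp only [map_add, h, h']
      | mul_X r k h =>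
        rw [map_mul, map_mul, map_mul, h, aeval_X, eval_X]
        refine congrArg _ (Fin.cases ?_ (fun k => ?_) k) <;> simp
    refine eq_zero_of_eval_mul hq fun y hy => ?_
    rw [he] at hy ⊢
    exact h _ (Fin.cons_zero _ _) hy
  have h1 : p - rename Fin.succ (aeval (Fin.cons 0 X : Fin (n + 1) → MvPolynomial (Fin n) ℂ) p) ∈
      Ideal.span {(X 0 : MvPolynomial (Fin (n + 1)) ℂ)} := by
    generalize p = r
    induction r using MvPolynomial.induction_on with
    | C z => simp
    | add r r' h h' =>
      convert add_mem h h' using 1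
      simp only [map_add]
      ring
    | mul_X r k h =>
      refine Fin.cases ?_ (fun k => ?_) k
      · simpa using Ideal.mul_mem_left _ r (Ideal.mem_span_singleton_self _)
      · convert Ideal.mul_mem_right (X k.succ) _ h using 1
        simp [sub_mul]
  rw [h0, map_zero, sub_zero] at h1
  exact Ideal.mem_span_singleton.1 h1

/-- The quadratic form `E₃ F₃ + E₄ F₄` in the variables `E₃`, `E₄`, `F₃`, `F₄`. -/
def bPoly : MvPolynomial (Fin 4) ℂ := X 0 * X 2 + X 1 * X 3

/-- The algebra generated by `E₃ F₃ + E₄ F₄` and `E₃²`. -/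
def evenInv : Subalgebra ℂ (MvPolynomial (Fin 4) ℂ) := Algebra.adjoin ℂ {bPoly, X 0 ^ 2}

theorem bPoly_mem : bPoly ∈ evenInv := Algebra.subset_adjoin (by simp)

theorem X_sq_mem : X 0 ^ 2 ∈ evenInv := Algebra.subset_adjoin (by simp)

/-- The substitutions by which the two upper unipotent subgroups act on the variables `E₃`, `E₄`,
`F₃`, `F₄`. -/
def σ₁ (u : ℂ) : Fin 4 → MvPolynomial (Fin 4) ℂ := ![X 0, X 1, X 2 - C u * X 1, X 3 + C u * X 0]

/-- See `σ₁`. -/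
def σ₂ (u : ℂ) : Fin 4 → MvPolynomial (Fin 4) ℂ := ![X 0, X 1 + C u * X 0, X 2 - C u * X 3, X 3]

/-- The antipodal substitution. -/
def σneg : Fin 4 → MvPolynomial (Fin 4) ℂ := fun k => -X k

theorem eval_aeval {m n : ℕ} (σ : Fin m → MvPolynomial (Fin n) ℂ) (P : Fin n → ℂ)
    (p : MvPolynomial (Fin m) ℂ) : eval P (aeval σ p) = eval (fun k => eval P (σ k)) p := by
  induction p using MvPolynomial.induction_on with
  | C z => simp
  | add r r' h h' => simp only [map_add, h, h']
  | mul_X r k h => rw [map_mul, map_mul, map_mul, h, aeval_X, eval_X]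

/-- Every point with `E₃ ≠ 0` is moved by the unipotent substitutions to one with `E₄` equal to the
value of `E₃ F₃ + E₄ F₄`, `F₃ = 0` and `F₄ = 1`. So an invariant polynomial is a polynomial in `E₃`
and `E₃ F₃ + E₄ F₄`. -/
theorem eq_aeval_of_invariant {p : MvPolynomial (Fin 4) ℂ} (h1 : ∀ u, aeval (σ₁ u) p = p)
    (h2 : ∀ u, aeval (σ₂ u) p = p) : p = aeval ![X 0, bPoly, 0, 1] p := by
  rw [← sub_eq_zero]
  refine eq_zero_of_eval_mul (X_ne_zero 0) fun P hP => ?_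
  rw [eval_X] at hP
  have e1 (u : ℂ) (P : Fin 4 → ℂ) : eval P p = eval ![P 0, P 1, P 2 - u * P 1,
      P 3 + u * P 0] p := by
    conv_lhs => rw [← h1 u]
    rw [eval_aeval]
    congr 2
    ext k
    fin_cases k <;> simp [σ₁]
  have e2 (u : ℂ) (P : Fin 4 → ℂ) : eval P p = eval ![P 0, P 1 + u * P 0, P 2 - u * P 3,
      P 3] p := by
    conv_lhs => rw [← h2 u]
    rw [eval_aeval]
    congr 2
    ext k
    fin_cases k <;> simp [σ₂]
  rw [map_sub, sub_eq_zero, eval_aeval, e1 ((1 - P 3) / P 0) P,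
    e2 ((P 0 * P 2 + P 1 * P 3 - P 1) / P 0)]
  congr 2
  ext k
  fin_cases k
  · simp
  · simp [bPoly]; field_simp; ring
  · simp; field_simp; ring
  · simp; field_simp; ring

theorem exists_even_add_odd (p : MvPolynomial (Fin 4) ℂ) :
    ∃ u ∈ evenInv, ∃ v ∈ evenInv, aeval ![X 0, bPoly, 0, 1] p = u + X 0 * v := by
  induction p using MvPolynomial.induction_on with
  | C z => exact ⟨C z, evenInv.algebraMap_mem z, 0, zero_mem _, by simp⟩
  | add p p' hp hp' =>
    obtain ⟨u, hu, v, hv, h⟩ := hp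
    obtain ⟨u', hu', v', hv', h'⟩ := hp'
    exact ⟨u + u', add_mem hu hu', v + v', add_mem hv hv', by rw [map_add, h, h']; ring⟩
  | mul_X p k hp =>
    obtain ⟨u, hu, v, hv, h⟩ := hp
    rw [map_mul, h, aeval_X]
    fin_cases k
    · exact ⟨X 0 ^ 2 * v, mul_mem X_sq_mem hv, u, hu, by simp; ring⟩
    · exact ⟨u * bPoly, mul_mem hu bPoly_mem, v * bPoly, mul_mem hv bPoly_mem, by simp; ring⟩
    · exact ⟨0, zero_mem _, 0, zero_mem _, by simp⟩
    · exact ⟨u, hu, v, hv, by simp⟩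

theorem aeval_σneg_of_mem {p : MvPolynomial (Fin 4) ℂ} (hp : p ∈ evenInv) : aeval σneg p = p := by
  induction hp using Algebra.adjoin_induction with
  | mem x hx =>
    rcases hx with rfl | rfl
    · simp [bPoly, σneg]
    · simp [σneg]
  | algebraMap r => simp
  | add x y _ _ hx hy => rw [map_add, hx, hy]
  | mul x y _ _ hx hy => rw [map_mul, hx, hy]

section
variable {p : MvPolynomial (Fin 4) ℂ}

theorem mem_evenInv (h1 : ∀ u, aeval (σ₁ u) p = p) (h2 : ∀ u, aeval (σ₂ u) p = p)
    (h : aeval σneg p = p) : p ∈ evenInv := by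
  obtain ⟨u, hu, v, hv, huv⟩ := exists_even_add_odd p
  rw [← eq_aeval_of_invariant h1 h2] at huv
  have h3 : aeval σneg p = u - X 0 * v := by
    rw [huv, map_add, map_mul, aeval_σneg_of_mem hu, aeval_σneg_of_mem hv, aeval_X, σneg]
    ring
  rw [h, huv] at h3
  have h4 : X 0 * v = 0 := (mul_eq_zero.1 (by linear_combination h3 : 2 *
      (X 0 * v) = 0)).resolve_left two_ne_zero
  rw [huv, h4, add_zero]
  exact hu

theorem exists_eq_X_mul (h1 : ∀ u, aeval (σ₁ u) p = p) (h2 : ∀ u, aeval (σ₂ u) p = p)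
    (h : aeval σneg p = -p) : ∃ q ∈ evenInv, p = X 0 * q := by
  obtain ⟨u, hu, v, hv, huv⟩ := exists_even_add_odd p
  rw [← eq_aeval_of_invariant h1 h2] at huv
  have h3 : aeval σneg p = u - X 0 * v := by
    rw [huv, map_add, map_mul, aeval_σneg_of_mem hu, aeval_σneg_of_mem hv, aeval_X, σneg]
    ring
  rw [h, huv] at h3
  have h4 : u = 0 := (mul_eq_zero.1 (by linear_combination -h3
      : 2 * u = 0)).resolve_left two_ne_zero
  exact ⟨v, hv, by rw [huv, h4, zero_add]⟩

theorem exists_eq_X_sq_mul (h1 : ∀ u, aeval (σ₁ u) p = p) (h2 : ∀ u, aeval (σ₂ u) p = p)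
    (h : aeval σneg p = p) (hd : X 0 ∣ p) : ∃ q ∈ evenInv, p = X 0 ^ 2 * q := by
  obtain ⟨q, rfl⟩ := hd
  have hX : (X 0 : MvPolynomial (Fin 4) ℂ) ≠ 0 := X_ne_zero 0
  obtain ⟨r, hr, rfl⟩ := exists_eq_X_mul (p := q)
    (fun u => mul_left_cancel₀ hX (by
      have := h1 u
      rwa [map_mul, aeval_X, show σ₁ u 0 = X 0 from rfl] at this))
    (fun u => mul_left_cancel₀ hX (by
      have := h2 u
      rwa [map_mul, aeval_X, show σ₂ u 0 = X 0 from rfl] at this))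
    (mul_left_cancel₀ hX (by
      rw [map_mul, aeval_X, σneg] at h
      linear_combination -h))
  exact ⟨r, hr, by ring⟩

end

end Polynomials

/-! ### Substitutions, values and degrees of polynomial maps -/

section PolyMaps
open MvPolynomial

variable {l m n : ℕ}

/-- The substitution `σ` of the variables combined with a linear map of `𝔭`. -/
def pull (σ : Fin m → MvPolynomial (Fin n) ℂ) (l : 𝔭 →ₗ[ℂ] 𝔭) : PolyMap m →ₐ[ℂ] PolyMap n :=
  Algebra.TensorProduct.map (aeval σ) (ExteriorAlgebra.map l)

theorem pull_tmul (σ : Fin m → MvPolynomial (Fin n) ℂ) (l : 𝔭 →ₗ[ℂ] 𝔭)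
    (p : MvPolynomial (Fin m) ℂ) (w : Λp) :
    pull σ l (p ⊗ₜ w) = aeval σ p ⊗ₜ ExteriorAlgebra.map l w := rfl

theorem pull_id_tmul (σ : Fin m → MvPolynomial (Fin n) ℂ) (p : MvPolynomial (Fin m) ℂ) (w : Λp) :
    pull σ LinearMap.id (p ⊗ₜ w) = aeval σ p ⊗ₜ w := by
  rw [pull_tmul, ExteriorAlgebra.map_id]
  rfl

theorem pull_smul (σ : Fin m → MvPolynomial (Fin n) ℂ) (l : 𝔭 →ₗ[ℂ] 𝔭)
    (p : MvPolynomial (Fin m) ℂ) (F : PolyMap m) :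
    pull σ l (p • F) = aeval σ p • pull σ l F := by
  rw [← tmul_one_mul_eq_smul, map_mul, pull_tmul, map_one, tmul_one_mul_eq_smul]

theorem pull_pull (σ : Fin m → MvPolynomial (Fin n) ℂ) (τ : Fin l → MvPolynomial (Fin m) ℂ)
    (k k' : 𝔭 →ₗ[ℂ] 𝔭) (F : PolyMap l) :
    pull σ k (pull τ k' F) = pull (fun i => aeval σ (τ i)) (k ∘ₗ k') F := by
  induction F using TensorProduct.induction_on with
  | zero => simp only [map_zero]
  | add x y hx hy => simp only [map_add, hx, hy]
  | tmul p w =>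
    rw [pull_tmul, pull_tmul, pull_tmul, ← ExteriorAlgebra.map_comp_map]
    congr 1
    induction p using MvPolynomial.induction_on with
    | C z => simp
    | add r r' h h' => simp only [map_add, h, h']
    | mul_X r k h => rw [map_mul, map_mul, map_mul, h, aeval_X, aeval_X]

/-- The value of a polynomial map at a point. -/
def evalMap (P : Fin n → ℂ) : PolyMap n →ₐ[ℂ] Λp :=
  (Algebra.TensorProduct.lid ℂ Λp).toAlgHom.comp
    (Algebra.TensorProduct.map (aeval P) (AlgHom.id ℂ Λp))

theorem evalMap_tmul (P : Fin n → ℂ) (p : MvPolynomial (Fin n) ℂ) (w : Λp) :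
    evalMap P (p ⊗ₜ w) = eval P p • w := by
  change (aeval P p : ℂ) • w = _
  rw [aeval_eq_eval]

theorem repr_evalMap (P : Fin n → ℂ) (F : PolyMap n) (k : Fin 16) :
    wBasis.repr (evalMap P F) k = eval P ((mapBasis n).repr F k) := by
  induction F using TensorProduct.induction_on with
  | zero => simp only [map_zero, Finsupp.coe_zero, Pi.zero_apply]
  | add x y hx hy => simp only [map_add, Finsupp.add_apply, hx, hy]
  | tmul p w =>
    rw [evalMap_tmul, mapBasis_repr_tmul, map_smul, Finsupp.smul_apply, smul_eval, smul_eq_mul,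
      mul_comm]

theorem evalMap_pull (σ : Fin m → MvPolynomial (Fin n) ℂ) (l : 𝔭 →ₗ[ℂ] 𝔭) (P : Fin n → ℂ)
    (F : PolyMap m) :
    evalMap P (pull σ l F) = ExteriorAlgebra.map l (evalMap (fun k => eval P (σ k)) F) := by
  induction F using TensorProduct.induction_on with
  | zero => simp only [map_zero]
  | add x y hx hy => simp only [map_add, hx, hy]
  | tmul p w => rw [pull_tmul, evalMap_tmul, evalMap_tmul, map_smul, eval_aeval]

theorem exists_eq_quad_smul {F : PolyMap (n + 3)}
    (h : ∀ P : Fin (n + 3) → ℂ, P 0 ^ 2 + 4 * P 1 * P 2 = 0 → P 1 ≠ 0 → evalMap P F = 0) :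
    ∃ F', F = quad n • F' := by
  have hd (k : Fin 16) : quad n ∣ (mapBasis (n + 3)).repr F k := quad_dvd fun P hP hP' => by
    rw [← repr_evalMap, h P hP hP', map_zero, Finsupp.zero_apply]
  choose q hq using hd
  refine ⟨(mapBasis (n + 3)).equivFun.symm q, (mapBasis (n + 3)).equivFun.injective ?_⟩
  ext1 k
  rw [map_smul, LinearEquiv.apply_symm_apply, Module.Basis.equivFun_apply, hq]
  rfl

/-- The substitution `σ` acts on the first three variables as the unipotent matrix with parameter
`u` in the stabilizer of the highest weight vector. -/
structure IsUpper (σ : Fin (n + 3) → MvPolynomial (Fin (n + 3)) ℂ) (u : ℂ) : Prop where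
  zero : σ 0 = X 0 - C (2 * u) * X 1
  one : σ 1 = X 1
  two : σ 2 = X 2 + C u * X 0 - C (u ^ 2) * X 1

/-- The substitution `σ` acts on the first three variables as the unipotent matrix with parameter
`u` in the stabilizer of the lowest weight vector. -/
structure IsLower (σ : Fin (n + 3) → MvPolynomial (Fin (n + 3)) ℂ) (u : ℂ) : Prop where
  zero : σ 0 = X 0 - C (2 * u) * X 2
  one : σ 1 = X 1 + C u * X 0 - C (u ^ 2) * X 2
  two : σ 2 = X 2

theorem IsUpper.aeval_quad {σ : Fin (n + 3) → MvPolynomial (Fin (n + 3)) ℂ} {u : ℂ}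
    (h : IsUpper σ u) : aeval σ (quad n) = quad n := by
  simp only [quad, map_add, map_mul, map_pow, aeval_X, map_ofNat, h.zero, h.one, h.two]
  ring

theorem IsLower.aeval_quad {σ : Fin (n + 3) → MvPolynomial (Fin (n + 3)) ℂ} {u : ℂ}
    (h : IsLower σ u) : aeval σ (quad n) = quad n := by
  simp only [quad, map_add, map_mul, map_pow, aeval_X, map_ofNat, h.zero, h.one, h.two]
  ring

/-- A polynomial map equivariant under both unipotent one-parameter groups and vanishing over the
nilpotent `(0, 0, 1)` is divisible by the equation of the nilpotent cone, since the two groups move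
`(0, 0, 1)` to a generic nilpotent. -/
theorem exists_eq_quad_smul_of_pull {F : PolyMap (n + 3)}
    {σ τ : ℂ → Fin (n + 3) → MvPolynomial (Fin (n + 3)) ℂ} {k k' : ℂ → 𝔭 →ₗ[ℂ] 𝔭}
    (hσ : ∀ u, IsUpper (σ u) u) (hτ : ∀ u, IsLower (τ u) u)
    (hF : ∀ u, pull (σ u) (k u) F = F) (hF' : ∀ u, pull (τ u) (k' u) F = F)
    (h : ∀ P : Fin (n + 3) → ℂ, P 0 = 0 → P 1 = 0 → P 2 = 1 → evalMap P F = 0) :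
    ∃ F', F = quad n • F' := by
  refine exists_eq_quad_smul fun P hP hP' => ?_
  -- the lower group moves `(0, 0, 1)` to `(2 u, -u², 1)`, then the upper one adjusts the first entry
  obtain ⟨u, hu⟩ := IsAlgClosed.exists_pow_nat_eq (-P 1) (n := 2) (by norm_num)
  have h1 : ∀ P : Fin (n + 3) → ℂ, P 0 = 2 * u → P 1 = -u ^ 2 → P 2 = 1 → evalMap P F = 0 := by
    intro P h0 h1 h2
    rw [← hF' u, evalMap_pull, h, map_zero]
    · simp [(hτ u).zero, h0, h2]
    · simp [(hτ u).one, h0, h1, h2]; ring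
    · simp [(hτ u).two, h2]
  rw [← hF ((P 0 - 2 * u) / (2 * P 1)), evalMap_pull, h1, map_zero]
  · simp [(hσ _).zero]; field_simp; ring
  · simp [(hσ _).one, hu]
  · simp [(hσ _).two]
    field_simp
    linear_combination -4 * hu + hP

/-- The homogeneous polynomial maps of degree `m`. -/
def homog (n m : ℕ) : Submodule ℂ (PolyMap n) :=
  Submodule.span ℂ {x | ∃ p : MvPolynomial (Fin n) ℂ, p.IsHomogeneous m ∧ ∃ w : Λp, x = p ⊗ₜ w}

theorem tmul_mem_homog {p : MvPolynomial (Fin n) ℂ} (hp : p.IsHomogeneous m) (w : Λp) :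
    p ⊗ₜ w ∈ homog n m := Submodule.subset_span ⟨p, hp, w, rfl⟩

theorem mul_mem_homog {x y : PolyMap n} (hx : x ∈ homog n l) (hy : y ∈ homog n m) :
    x * y ∈ homog n (l + m) := by
  have : homog n l * homog n m ≤ homog n (l + m) := by
    rw [homog, homog, Submodule.span_mul_span, Submodule.span_le]
    rintro _ ⟨_, ⟨p, hp, w, rfl⟩, _, ⟨q, hq, v, rfl⟩, rfl⟩
    change (p ⊗ₜ w : PolyMap n) * (q ⊗ₜ v) ∈ _
    rw [Algebra.TensorProduct.tmul_mul_tmul]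
    exact tmul_mem_homog (hp.mul hq) (w * v)
  exact this (Submodule.mul_mem_mul hx hy)

theorem smul_mem_homog {p : MvPolynomial (Fin n) ℂ} {y : PolyMap n} (hp : p.IsHomogeneous l)
    (hy : y ∈ homog n m) : p • y ∈ homog n (l + m) := by
  rw [← tmul_one_mul_eq_smul]
  exact mul_mem_homog (tmul_mem_homog hp 1) hy

/-- The homogeneous component of degree `d`. -/
def component (n d : ℕ) : PolyMap n →ₗ[ℂ] PolyMap n :=
  LinearMap.rTensor Λp (homogeneousComponent d)

theorem component_tmul (d : ℕ) (p : MvPolynomial (Fin n) ℂ) (w : Λp) :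
    component n d (p ⊗ₜ w) = homogeneousComponent d p ⊗ₜ w := rfl

theorem component_of_mem {x : PolyMap n} (hx : x ∈ homog n m) (d : ℕ) :
    component n d x = if d = m then x else 0 := by
  induction hx using Submodule.span_induction with
  | mem x hx =>
    obtain ⟨p, hp, w, rfl⟩ := hx
    rw [component_tmul, homogeneousComponent_of_mem hp]
    split_ifs <;> simp
  | zero => simp
  | add x y _ _ hx hy => rw [map_add, hx, hy]; split_ifs <;> simp
  | smul r x _ hx => rw [map_smul, hx]; split_ifs <;> simp

theorem exists_sum_component (x : PolyMap n) :
    ∃ N, ∀ N' ≥ N, ∑ d ∈ Finset.range N', component n d x = x := by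
  induction x using TensorProduct.induction_on with
  | zero => exact ⟨0, by simp⟩
  | add x y hx hy =>
    obtain ⟨N, hN⟩ := hx
    obtain ⟨M, hM⟩ := hy
    refine ⟨max N M, fun N' h => ?_⟩
    simp only [map_add, Finset.sum_add_distrib]
    rw [hN _ (le_trans (le_max_left _ _) h), hM _ (le_trans (le_max_right _ _) h)]
  | tmul p w =>
    refine ⟨p.totalDegree + 1, fun N' h => ?_⟩
    simp only [component_tmul]
    rw [← TensorProduct.sum_tmul]
    congr 1
    conv_rhs => rw [← sum_homogeneousComponent p]
    refine (Finset.sum_subset (Finset.range_subset_range.2 h) fun d _ hd => ?_).symm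
    exact homogeneousComponent_eq_zero _ _ (by simpa using hd)

theorem component_mem_homog (k : ℕ) (x : PolyMap n) : component n k x ∈ homog n k := by
  induction x using TensorProduct.induction_on with
  | zero => simp
  | add x y hx hy => rw [map_add]; exact add_mem hx hy
  | tmul p w => exact tmul_mem_homog (homogeneousComponent_isHomogeneous k p) w

theorem component_smul_eq_zero {p : MvPolynomial (Fin n) ℂ} (hp : p.IsHomogeneous m) {d : ℕ}
    (hd : d < m) (x : PolyMap n) : component n d (p • x) = 0 := by
  obtain ⟨N, hN⟩ := exists_sum_component x
  rw [← hN N le_rfl, Finset.smul_sum, map_sum]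
  refine Finset.sum_eq_zero fun k _ => ?_
  rw [component_of_mem (smul_mem_homog hp (component_mem_homog k x)), if_neg (by omega)]

theorem exists_eq_add_pow_smul {R V : Type*} [CommRing R] [AddCommGroup V] [Module R V]
    {Q : AddSubgroup V} {a : R} (haQ : ∀ x ∈ Q, a • x ∈ Q) {M : Set V}
    (hM : ∀ x ∈ M, ∃ q ∈ Q, ∃ y ∈ M, x = q + a • y) {x : V} (hx : x ∈ M) (k : ℕ) :
    ∃ q ∈ Q, ∃ y ∈ M, x = q + a ^ k • y := by
  induction k with
  | zero => exact ⟨0, zero_mem _, x, hx, by rw [pow_zero, one_smul, zero_add]⟩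
  | succ k ih =>
    obtain ⟨q, hq, y, hy, h⟩ := ih
    obtain ⟨q', hq', y', hy', h'⟩ := hM y hy
    have hk : a ^ k • q' ∈ Q := by
      clear h
      induction k with
      | zero => rwa [pow_zero, one_smul]
      | succ k ih => rw [pow_succ', mul_smul]; exact haQ _ ih
    refine ⟨q + a ^ k • q', add_mem hq hk, y', hy', ?_⟩
    rw [h, h', smul_add, pow_succ, mul_smul, add_assoc]

/-- A form of Nakayama's lemma for graded modules: iterating `hM` shows that `x` belongs to `Q`
modulo elements of arbitrarily high degree. -/
theorem mem_of_mem_add_smul {Q : Submodule ℂ (PolyMap n)} {a : MvPolynomial (Fin n) ℂ}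
    (hQ : ∀ d, ∀ x ∈ Q, component n d x ∈ Q) (ha : a.IsHomogeneous 2)
    (haQ : ∀ x ∈ Q, a • x ∈ Q) {M : Set (PolyMap n)}
    (hM : ∀ x ∈ M, ∃ q ∈ Q, ∃ y ∈ M, x = q + a • y) {x : PolyMap n} (hx : x ∈ M) : x ∈ Q := by
  obtain ⟨N, hN⟩ := exists_sum_component x
  rw [← hN N le_rfl]
  refine sum_mem fun d _ => ?_
  obtain ⟨q, hq, y, -, h⟩ := exists_eq_add_pow_smul (Q := Q.toAddSubgroup) haQ hM hx (d + 1)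
  rw [h, map_add, component_smul_eq_zero (ha.pow (d + 1)) (by omega), add_zero]
  exact hQ d q hq

end PolyMaps

/-! ### The sets `S` and `T` in arbitrary coordinates -/

section Generators
open MvPolynomial

variable {m n : ℕ}

/-- The polynomials `a₁`, `a₂`, `b`, `c` in arbitrary values `v` of the coordinates `gvec`. -/
def aGen (v : Fin 10 → MvPolynomial (Fin n) ℂ) : Fin 4 → MvPolynomial (Fin n) ℂ :=
  ![v 0 ^ 2 + 4 * v 1 * v 2, v 3 ^ 2 + 4 * v 4 * v 5, v 6 * v 8 + v 7 * v 9,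
    2 * (v 1 * v 4 * v 8 ^ 2 - v 1 * v 5 * v 9 ^ 2 + v 2 * v 5 * v 6 ^ 2 - v 2 * v 4 * v 7 ^ 2)
      - 2 * v 3 * (v 1 * v 8 * v 9 + v 2 * v 6 * v 7)
      - 2 * v 0 * (v 5 * v 6 * v 9 + v 4 * v 8 * v 7)
      - v 3 * v 0 * (v 6 * v 8 - v 7 * v 9)]

/-- The monomials in `a₁`, `a₂`, `b`, `c`. -/
def sGen (v : Fin 10 → MvPolynomial (Fin n) ℂ) (k : ℕ × ℕ × ℕ × ℕ) : MvPolynomial (Fin n) ℂ :=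
  aGen v 0 ^ k.1 * aGen v 1 ^ k.2.1 * aGen v 2 ^ k.2.2.1 * aGen v 3 ^ k.2.2.2

section
variable (v : Fin 10 → MvPolynomial (Fin n) ℂ)

/-- The element `D` in coordinates. -/
def DGen : PolyMap n := v 6 ⊗ₜ wF₃ + v 7 ⊗ₜ wF₄ + v 8 ⊗ₜ wE₃ + v 9 ⊗ₜ wE₄

/-- The element `d` in coordinates. -/
def dGen : PolyMap n :=
  (2 : ℂ) • v 1 ⊗ₜ (wF₃ * wF₄) - v 0 ⊗ₜ (wE₃ * wF₃ + wE₄ * wF₄) - (2 : ℂ) • v 2 ⊗ₜ (wE₃ * wE₄)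

/-- The element `e` in coordinates. -/
def eGen : PolyMap n :=
  (2 : ℂ) • v 4 ⊗ₜ (wE₄ * wF₃) + v 3 ⊗ₜ (wE₃ * wF₃ - wE₄ * wF₄) + (2 : ℂ) • v 5 ⊗ₜ (wE₃ * wF₄)

/-- The element `f` in coordinates. -/
def fGen : PolyMap n :=
  (2 : ℂ) • ((v 1 * v 8) ⊗ₜ wF₄ - (v 1 * v 9) ⊗ₜ wF₃)
    - ((v 0 * v 6) ⊗ₜ wF₃ + (v 0 * v 7) ⊗ₜ wF₄ - (v 0 * v 8) ⊗ₜ wE₃ - (v 0 * v 9) ⊗ₜ wE₄)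
    - (2 : ℂ) • ((v 2 * v 6) ⊗ₜ wE₄ - (v 2 * v 7) ⊗ₜ wE₃)

/-- The element `g` in coordinates. -/
def gGen : PolyMap n :=
  -((2 : ℂ) • ((v 4 * v 8) ⊗ₜ wE₄ - (v 4 * v 7) ⊗ₜ wF₃))
    + ((v 3 * v 6) ⊗ₜ wF₃ - (v 3 * v 7) ⊗ₜ wF₄ - (v 3 * v 8) ⊗ₜ wE₃ + (v 3 * v 9) ⊗ₜ wE₄)
    + (2 : ℂ) • ((v 5 * v 6) ⊗ₜ wF₄ - (v 5 * v 9) ⊗ₜ wE₃)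

/-- The element `h` in coordinates. -/
def hGen : PolyMap n :=
  (2 : ℂ) • ((v 1 * v 4 * v 8) ⊗ₜ wF₃ - (v 1 * v 5 * v 9) ⊗ₜ wF₄
      + (v 2 * v 5 * v 6) ⊗ₜ wE₃ - (v 2 * v 4 * v 7) ⊗ₜ wE₄)
    - ((v 3 * (v 1 * v 8)) ⊗ₜ wF₄ + (v 3 * (v 1 * v 9)) ⊗ₜ wF₃
      + (v 3 * (v 2 * v 6)) ⊗ₜ wE₄ + (v 3 * (v 2 * v 7)) ⊗ₜ wE₃)
    - ((v 0 * (v 5 * v 6)) ⊗ₜ wF₄ + (v 0 * (v 5 * v 9)) ⊗ₜ wE₃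
      + (v 0 * (v 4 * v 8)) ⊗ₜ wE₄ + (v 0 * (v 4 * v 7)) ⊗ₜ wF₃)
    - (1 / 2 : ℂ) • ((v 3 * v 0 * v 6) ⊗ₜ wF₃ + (v 3 * v 0 * v 8) ⊗ₜ wE₃
      - (v 3 * v 0 * v 7) ⊗ₜ wF₄ - (v 3 * v 0 * v 9) ⊗ₜ wE₄)

/-- The element `j` in coordinates. -/
def jGen : PolyMap n :=
  v 6 ⊗ₜ (wE₄ * wF₃ * wF₄) - v 7 ⊗ₜ (wE₃ * wF₃ * wF₄)
    + v 8 ⊗ₜ (wE₃ * wE₄ * wF₄) - v 9 ⊗ₜ (wE₃ * wE₄ * wF₃)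

/-- The sixteen elements of `T` in arbitrary values `v` of the coordinates `gvec`. -/
def tGen : Fin 16 → PolyMap n :=
  ![1, DGen v, dGen v, eGen v, fGen v, gGen v, hGen v, 1 ⊗ₜ (wE₃ * wE₄ * wF₃ * wF₄), jGen v,
    DGen v * dGen v, DGen v * eGen v, DGen v * fGen v, DGen v * gGen v, fGen v * gGen v,
    DGen v * hGen v, dGen v * gGen v]

end

section Coordinates

theorem mapEquiv_D : mapEquiv D = DGen X := by
  simp only [D, map_add, mapEquiv_tmul, polyEquiv_E₃, polyEquiv_E₄, polyEquiv_F₃, polyEquiv_F₄,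
    DGen]

theorem mapEquiv_d : mapEquiv d = dGen X := by
  simp only [d, map_add, map_sub, mapEquiv_tmul, polyEquiv_E₁, polyEquiv_F₁, two_mul,
    polyEquiv_H₁_add_H₂]
  simp only [dGen, two_smul, TensorProduct.add_tmul]

theorem mapEquiv_e : mapEquiv e = eGen X := by
  simp only [e, map_add, map_sub, mapEquiv_tmul, polyEquiv_E₂, polyEquiv_F₂, two_mul,
    polyEquiv_H₁_sub_H₂, eGen, two_smul, TensorProduct.add_tmul]

theorem mapEquiv_f : mapEquiv f = fGen X := by
  simp only [f, map_add, map_sub, map_mul, mapEquiv_tmul, two_mul, polyEquiv_H₁_add_H₂, fGen,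
    two_smul, mul_add, mul_sub, Algebra.TensorProduct.tmul_mul_tmul, one_mul, polyEquiv_E₁,
    polyEquiv_F₁, polyEquiv_E₃, polyEquiv_E₄, polyEquiv_F₃, polyEquiv_F₄]
  abel

theorem mapEquiv_g : mapEquiv g = gGen X := by
  simp only [g, neg_mul (2 : A), two_mul, map_add, map_sub, map_neg, map_mul, mapEquiv_tmul,
    polyEquiv_H₁_sub_H₂, gGen, two_smul, mul_add, mul_sub, Algebra.TensorProduct.tmul_mul_tmul,
    one_mul, polyEquiv_E₂, polyEquiv_F₂, polyEquiv_E₃, polyEquiv_E₄, polyEquiv_F₃, polyEquiv_F₄]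
  abel

theorem mapEquiv_h : mapEquiv h = hGen X := by
  simp only [h, map_add, map_sub, map_smul, map_mul, mapEquiv_tmul, two_mul,
    polyEquiv_H₁_sub_H₂, polyEquiv_H₁_add_H₂, polyEquiv_E₁, polyEquiv_F₁, polyEquiv_E₂,
    polyEquiv_F₂, polyEquiv_E₃, polyEquiv_E₄, polyEquiv_F₃, polyEquiv_F₄]
  simp only [hGen, two_smul, mul_add, mul_sub, Algebra.TensorProduct.tmul_mul_tmul, one_mul]

theorem mapEquiv_i : mapEquiv i = 1 ⊗ₜ (wE₃ * wE₄ * wF₃ * wF₄) := by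
  rw [i, mapEquiv_tmul, map_one]

theorem mapEquiv_j : mapEquiv j = jGen X := by
  simp only [j, map_add, map_sub, mapEquiv_tmul, polyEquiv_E₃, polyEquiv_E₄, polyEquiv_F₃,
    polyEquiv_F₄, jGen]

theorem mapEquiv_t (k : Fin 16) : mapEquiv (t k) = tGen X k := by
  have h1 : ∀ x y : A, mapEquiv (x * y) = mapEquiv x * mapEquiv y := map_mul mapEquiv
  fin_cases k
  exacts [map_one _, mapEquiv_D, mapEquiv_d, mapEquiv_e, mapEquiv_f, mapEquiv_g, mapEquiv_h,
    mapEquiv_i, mapEquiv_j, (h1 _ _).trans (congrArg₂ _ mapEquiv_D mapEquiv_d),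
    (h1 _ _).trans (congrArg₂ _ mapEquiv_D mapEquiv_e),
    (h1 _ _).trans (congrArg₂ _ mapEquiv_D mapEquiv_f),
    (h1 _ _).trans (congrArg₂ _ mapEquiv_D mapEquiv_g),
    (h1 _ _).trans (congrArg₂ _ mapEquiv_f mapEquiv_g),
    (h1 _ _).trans (congrArg₂ _ mapEquiv_D mapEquiv_h),
    (h1 _ _).trans (congrArg₂ _ mapEquiv_d mapEquiv_g)]

theorem mapEquiv_a₁' : mapEquiv a₁ = aGen X 0 ⊗ₜ 1 := mapEquiv_a₁

theorem mapEquiv_a₂ : mapEquiv a₂ = aGen X 1 ⊗ₜ 1 := by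
  simp [a₂, aGen, mapEquiv_tmul, polyEquiv_four, polyEquiv_H₁_sub_H₂, polyEquiv_E₂, polyEquiv_F₂]

theorem mapEquiv_b : mapEquiv b = aGen X 2 ⊗ₜ 1 := by
  simp [b, aGen, mapEquiv_tmul, polyEquiv_E₃, polyEquiv_E₄, polyEquiv_F₃, polyEquiv_F₄]

theorem mapEquiv_c : mapEquiv c = aGen X 3 ⊗ₜ 1 := by
  rw [c, mapEquiv_tmul]
  simp only [map_add, map_sub, map_mul, map_pow, polyEquiv_two, polyEquiv_H₁_sub_H₂,
    polyEquiv_H₁_add_H₂, polyEquiv_E₁, polyEquiv_F₁, polyEquiv_E₂,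
    polyEquiv_F₂, polyEquiv_E₃, polyEquiv_E₄, polyEquiv_F₃, polyEquiv_F₄]
  rfl

theorem tmul_one_pow (p : MvPolynomial (Fin n) ℂ) (k : ℕ) :
    (p ⊗ₜ 1 : PolyMap n) ^ k = (p ^ k) ⊗ₜ 1 := by
  rw [Algebra.TensorProduct.tmul_pow, one_pow]

theorem mapEquiv_pow {x : A} {p : MvPolynomial (Fin 10) ℂ} (h : mapEquiv x = p ⊗ₜ 1) (k : ℕ) :
    mapEquiv (x ^ k) = (p ^ k) ⊗ₜ 1 := by
  rw [map_pow, h, tmul_one_pow]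

theorem mapEquiv_mul {x y : A} {p q : MvPolynomial (Fin 10) ℂ} (hx : mapEquiv x = p ⊗ₜ 1)
    (hy : mapEquiv y = q ⊗ₜ 1) : mapEquiv (x * y) = (p * q) ⊗ₜ 1 := by
  rw [map_mul, hx, hy, Algebra.TensorProduct.tmul_mul_tmul, one_mul]

theorem mapEquiv_s (n₁ n₂ n₃ n₄ : ℕ) :
    mapEquiv (s n₁ n₂ n₃ n₄) = sGen X (n₁, n₂, n₃, n₄) ⊗ₜ 1 :=
  mapEquiv_mul (mapEquiv_mul (mapEquiv_mul (mapEquiv_pow mapEquiv_a₁' n₁)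
    (mapEquiv_pow mapEquiv_a₂ n₂)) (mapEquiv_pow mapEquiv_b n₃)) (mapEquiv_pow mapEquiv_c n₄)

theorem mapEquiv_s_mul_t (p : (ℕ × ℕ × ℕ × ℕ) × Fin 16) :
    mapEquiv (s p.1.1 p.1.2.1 p.1.2.2.1 p.1.2.2.2 * t p.2) = sGen X p.1 • tGen X p.2 := by
  rw [map_mul, mapEquiv_s, mapEquiv_t, tmul_one_mul_eq_smul]

end Coordinates

section Pull
variable (σ : Fin m → MvPolynomial (Fin n) ℂ) (v : Fin 10 → MvPolynomial (Fin m) ℂ)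

theorem aeval_aGen (k : Fin 4) : aeval σ (aGen v k) = aGen (fun i => aeval σ (v i)) k := by
  have h2 : aeval σ (2 : MvPolynomial (Fin m) ℂ) = 2 := map_ofNat _ 2
  have h4 : aeval σ (4 : MvPolynomial (Fin m) ℂ) = 4 := map_ofNat _ 4
  fin_cases k <;>
    simp only [aGen, Matrix.cons_val, Fin.zero_eta, Fin.mk_one, Fin.reduceFinMk, map_add, map_sub,
      map_mul, map_pow, h2, h4]

theorem aeval_sGen (k : ℕ × ℕ × ℕ × ℕ) :
    aeval σ (sGen v k) = sGen (fun i => aeval σ (v i)) k := by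
  simp only [sGen, map_mul, map_pow, aeval_aGen]

theorem pull_tGen (k : Fin 16) :
    pull σ LinearMap.id (tGen v k) = tGen (fun i => aeval σ (v i)) k := by
  have hD : pull σ LinearMap.id (DGen v) = DGen fun i => aeval σ (v i) := by
    simp only [DGen, map_add, pull_id_tmul]
  have hd : pull σ LinearMap.id (dGen v) = dGen fun i => aeval σ (v i) := by
    simp only [dGen, map_add, map_sub, map_smul, pull_id_tmul]
  have he : pull σ LinearMap.id (eGen v) = eGen fun i => aeval σ (v i) := by
    simp only [eGen, map_add, map_smul, pull_id_tmul]
  have hf : pull σ LinearMap.id (fGen v) = fGen fun i => aeval σ (v i) := by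
    simp only [fGen, map_add, map_sub, map_smul, map_mul, pull_id_tmul]
  have hg : pull σ LinearMap.id (gGen v) = gGen fun i => aeval σ (v i) := by
    simp only [gGen, map_add, map_sub, map_neg, map_smul, map_mul, pull_id_tmul]
  have hh : pull σ LinearMap.id (hGen v) = hGen fun i => aeval σ (v i) := by
    simp only [hGen, map_add, map_sub, map_smul, map_mul, pull_id_tmul]
  have hi : pull σ LinearMap.id (1 ⊗ₜ (wE₃ * wE₄ * wF₃ * wF₄)) = 1 ⊗ₜ (wE₃ * wE₄ * wF₃ * wF₄) := by
    rw [pull_id_tmul, map_one]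
  have hj : pull σ LinearMap.id (jGen v) = jGen fun i => aeval σ (v i) := by
    simp only [jGen, map_add, map_sub, pull_id_tmul]
  have h1 : ∀ x y, pull σ LinearMap.id (x * y) = pull σ LinearMap.id x * pull σ LinearMap.id y :=
    map_mul _
  fin_cases k
  exacts [map_one _, hD, hd, he, hf, hg, hh, hi, hj, (h1 _ _).trans (congrArg₂ _ hD hd),
    (h1 _ _).trans (congrArg₂ _ hD he), (h1 _ _).trans (congrArg₂ _ hD hf),
    (h1 _ _).trans (congrArg₂ _ hD hg), (h1 _ _).trans (congrArg₂ _ hf hg),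
    (h1 _ _).trans (congrArg₂ _ hD hh), (h1 _ _).trans (congrArg₂ _ hd hg)]

end Pull

section Degrees

/-- The degrees of the coordinates, when those of the first three are `α`: this is `1` on all of
`ℂ¹⁰`, and `0` on the slice where the first three coordinates are constant. -/
def degs (α : ℕ) : Fin 10 → ℕ := ![α, α, α, 1, 1, 1, 1, 1, 1, 1]

variable {v : Fin 10 → MvPolynomial (Fin n) ℂ} {α : ℕ}

theorem smul_mem_homog' {z : ℂ} {k : ℕ} {x : PolyMap n} (hx : x ∈ homog n k) :
    z • x ∈ homog n k := Submodule.smul_mem _ _ hx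

theorem exists_aGen_isHomogeneous (hv : ∀ i, (v i).IsHomogeneous (degs α i)) (k : Fin 4) :
    ∃ d, (aGen v k).IsHomogeneous d := by
  have h4 : (4 : MvPolynomial (Fin n) ℂ).IsHomogeneous 0 := isHomogeneous_C _ 4
  have h2 : (2 : MvPolynomial (Fin n) ℂ).IsHomogeneous 0 := isHomogeneous_C _ 2
  have h0 := hv 0; have h1 := hv 1; have h2' := hv 2; have h3 := hv 3; have h4' := hv 4
  have h5 := hv 5; have h6 := hv 6; have h7 := hv 7; have h8 := hv 8; have h9 := hv 9
  simp only [degs, Matrix.cons_val] at h0 h1 h2' h3 h4' h5 h6 h7 h8 h9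
  have H {p : MvPolynomial (Fin n) ℂ} {d d' : ℕ} (hp : p.IsHomogeneous d) (h : d = d') :
    p.IsHomogeneous d' := h ▸ hp
  fin_cases k
  · exact ⟨α * 2, (h0.pow 2).add (H ((h4.mul h1).mul h2') (by ring))⟩
  · exact ⟨1 * 2, (h3.pow 2).add (H ((h4.mul h4').mul h5) (by ring))⟩
  · exact ⟨1 + 1, (h6.mul h8).add (h7.mul h9)⟩
  · refine ⟨α + 3, .sub (.sub (.sub (H (h2.mul (.sub (.add (.sub (h1.mul h4' |>.mul (h8.pow 2))
      (h1.mul h5 |>.mul (h9.pow 2))) (h2'.mul h5 |>.mul (h6.pow 2)))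
      (h2'.mul h4' |>.mul (h7.pow 2)))) (by ring))
      (H (h2.mul h3 |>.mul (.add (h1.mul h8 |>.mul h9) (h2'.mul h6 |>.mul h7))) (by ring)))
      (H (h2.mul h0 |>.mul (.add (h5.mul h6 |>.mul h9) (h4'.mul h8 |>.mul h7))) (by ring)))
      (H (h3.mul h0 |>.mul (.sub (h6.mul h8) (h7.mul h9))) (by ring))⟩

theorem exists_sGen_isHomogeneous (hv : ∀ i, (v i).IsHomogeneous (degs α i))
    (k : ℕ × ℕ × ℕ × ℕ) : ∃ d, (sGen v k).IsHomogeneous d := by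
  obtain ⟨d₀, h₀⟩ := exists_aGen_isHomogeneous hv 0
  obtain ⟨d₁, h₁⟩ := exists_aGen_isHomogeneous hv 1
  obtain ⟨d₂, h₂⟩ := exists_aGen_isHomogeneous hv 2
  obtain ⟨d₃, h₃⟩ := exists_aGen_isHomogeneous hv 3
  exact ⟨_, (((h₀.pow _).mul (h₁.pow _)).mul (h₂.pow _)).mul (h₃.pow _)⟩

theorem exists_tGen_mem_homog (hv : ∀ i, (v i).IsHomogeneous (degs α i)) (k : Fin 16) :
    ∃ d, tGen v k ∈ homog n d := by
  have h0 := hv 0; have h1 := hv 1; have h2 := hv 2; have h3 := hv 3; have h4 := hv 4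
  have h5 := hv 5; have h6 := hv 6; have h7 := hv 7; have h8 := hv 8; have h9 := hv 9
  simp only [degs, Matrix.cons_val] at h0 h1 h2 h3 h4 h5 h6 h7 h8 h9
  have H {p : MvPolynomial (Fin n) ℂ} {d d' : ℕ} (hp : p.IsHomogeneous d) (h : d = d') :
    p.IsHomogeneous d' := h ▸ hp
  have hD : DGen v ∈ homog n 1 := add_mem (add_mem (add_mem (tmul_mem_homog h6 _)
    (tmul_mem_homog h7 _)) (tmul_mem_homog h8 _)) (tmul_mem_homog h9 _)
  have hd : dGen v ∈ homog n α := sub_mem (sub_mem (smul_mem_homog' (tmul_mem_homog h1 _))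
    (tmul_mem_homog h0 _)) (smul_mem_homog' (tmul_mem_homog h2 _))
  have he : eGen v ∈ homog n 1 := add_mem (add_mem (smul_mem_homog' (tmul_mem_homog h4 _))
    (tmul_mem_homog h3 _)) (smul_mem_homog' (tmul_mem_homog h5 _))
  have hf : fGen v ∈ homog n (α + 1) := sub_mem (sub_mem (smul_mem_homog' (sub_mem
    (tmul_mem_homog (h1.mul h8) _) (tmul_mem_homog (h1.mul h9) _)))
    (sub_mem (sub_mem (add_mem (tmul_mem_homog (h0.mul h6) _) (tmul_mem_homog (h0.mul h7) _))
      (tmul_mem_homog (h0.mul h8) _)) (tmul_mem_homog (h0.mul h9) _)))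
    (smul_mem_homog' (sub_mem (tmul_mem_homog (h2.mul h6) _) (tmul_mem_homog (h2.mul h7) _)))
  have hg : gGen v ∈ homog n (1 + 1) := add_mem (add_mem (neg_mem (smul_mem_homog' (sub_mem
    (tmul_mem_homog (h4.mul h8) _) (tmul_mem_homog (h4.mul h7) _))))
    (add_mem (sub_mem (sub_mem (tmul_mem_homog (h3.mul h6) _) (tmul_mem_homog (h3.mul h7) _))
      (tmul_mem_homog (h3.mul h8) _)) (tmul_mem_homog (h3.mul h9) _)))
    (smul_mem_homog' (sub_mem (tmul_mem_homog (h5.mul h6) _) (tmul_mem_homog (h5.mul h9) _)))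
  have M {p q r : MvPolynomial (Fin n) ℂ} (w : Λp) {i j k : ℕ} (hp : p.IsHomogeneous i)
      (hq : q.IsHomogeneous j) (hr : r.IsHomogeneous k) (hs : i + j + k = α + 2) :
      (p * q * r) ⊗ₜ w ∈ homog n (α + 2) := tmul_mem_homog (H ((hp.mul hq).mul hr) hs) w
  have M' {p q r : MvPolynomial (Fin n) ℂ} (w : Λp) {i j k : ℕ} (hp : p.IsHomogeneous i)
      (hq : q.IsHomogeneous j) (hr : r.IsHomogeneous k) (hs : i + (j + k) = α + 2) :
      (p * (q * r)) ⊗ₜ w ∈ homog n (α + 2) := tmul_mem_homog (H (hp.mul (hq.mul hr)) hs) w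
  have hh : hGen v ∈ homog n (α + 2) := by
    refine sub_mem (sub_mem (sub_mem (smul_mem_homog' (sub_mem (add_mem (sub_mem
      (M _ h1 h4 h8 ?_) (M _ h1 h5 h9 ?_)) (M _ h2 h5 h6 ?_)) (M _ h2 h4 h7 ?_)))
      (add_mem (add_mem (add_mem (M' _ h3 h1 h8 ?_) (M' _ h3 h1 h9 ?_)) (M' _ h3 h2 h6 ?_))
        (M' _ h3 h2 h7 ?_)))
      (add_mem (add_mem (add_mem (M' _ h0 h5 h6 ?_) (M' _ h0 h5 h9 ?_)) (M' _ h0 h4 h8 ?_))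
        (M' _ h0 h4 h7 ?_)))
      (smul_mem_homog' (sub_mem (sub_mem (add_mem (M _ h3 h0 h6 ?_) (M _ h3 h0 h8 ?_))
        (M _ h3 h0 h7 ?_)) (M _ h3 h0 h9 ?_))) <;> ring
  have hj : jGen v ∈ homog n 1 := sub_mem (add_mem (sub_mem (tmul_mem_homog h6 _)
    (tmul_mem_homog h7 _)) (tmul_mem_homog h8 _)) (tmul_mem_homog h9 _)
  fin_cases k
  exacts [⟨0, tmul_mem_homog (isHomogeneous_one _ _) 1⟩, ⟨_, hD⟩, ⟨_, hd⟩, ⟨_, he⟩, ⟨_, hf⟩, ⟨_,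
      hg⟩,
    ⟨_, hh⟩, ⟨0, tmul_mem_homog (isHomogeneous_one _ _) _⟩, ⟨_, hj⟩, ⟨_, mul_mem_homog hD hd⟩,
    ⟨_, mul_mem_homog hD he⟩, ⟨_, mul_mem_homog hD hf⟩, ⟨_, mul_mem_homog hD hg⟩,
    ⟨_, mul_mem_homog hf hg⟩, ⟨_, mul_mem_homog hD hh⟩, ⟨_, mul_mem_homog hd hg⟩]

end Degrees

/-- The span of the products of the monomials in `a₁`, `a₂`, `b`, `c` with the elements of `T`. -/
def spanST (v : Fin 10 → MvPolynomial (Fin n) ℂ) : Submodule ℂ (PolyMap n) :=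
  Submodule.span ℂ (Set.range fun p : (ℕ × ℕ × ℕ × ℕ) × Fin 16 => sGen v p.1 • tGen v p.2)

theorem map_spanST (σ : Fin m → MvPolynomial (Fin n) ℂ) (v : Fin 10 → MvPolynomial (Fin m) ℂ) :
    (spanST v).map (pull σ LinearMap.id).toLinearMap = spanST fun i => aeval σ (v i) := by
  rw [spanST, Submodule.map_span, ← Set.range_comp]
  congr 2
  ext1 p
  simp only [Function.comp_apply, AlgHom.toLinearMap_apply, pull_smul, pull_tGen, aeval_sGen]

theorem component_mem_spanST {v : Fin 10 → MvPolynomial (Fin n) ℂ} {α : ℕ}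
    (hv : ∀ i, (v i).IsHomogeneous (degs α i)) (d : ℕ) {x : PolyMap n} (hx : x ∈ spanST v) :
    component n d x ∈ spanST v := by
  induction hx using Submodule.span_induction with
  | mem x hx =>
    obtain ⟨p, rfl⟩ := hx
    obtain ⟨k, hk⟩ := exists_sGen_isHomogeneous hv p.1
    obtain ⟨k', hk'⟩ := exists_tGen_mem_homog hv p.2
    rw [component_of_mem (smul_mem_homog hk hk')]
    split_ifs
    · exact Submodule.subset_span ⟨p, rfl⟩
    · exact zero_mem _
  | zero => rw [map_zero]; exact zero_mem _
  | add x y _ _ hx hy => rw [map_add]; exact add_mem hx hy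
  | smul r x _ hx => rw [map_smul]; exact Submodule.smul_mem _ _ hx

theorem aGen_mul_sGen (v : Fin 10 → MvPolynomial (Fin n) ℂ) (i : Fin 4) (k : ℕ × ℕ × ℕ × ℕ) :
    ∃ k', aGen v i * sGen v k = sGen v k' := by
  fin_cases i
  · exact ⟨(k.1 + 1, k.2.1, k.2.2.1, k.2.2.2), by simp only [sGen, Fin.zero_eta]; ring⟩
  · exact ⟨(k.1, k.2.1 + 1, k.2.2.1, k.2.2.2), by simp only [sGen, Fin.mk_one]; ring⟩
  · exact ⟨(k.1, k.2.1, k.2.2.1 + 1, k.2.2.2), by simp only [sGen, Fin.reduceFinMk]; ring⟩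
  · exact ⟨(k.1, k.2.1, k.2.2.1, k.2.2.2 + 1), by simp only [sGen, Fin.reduceFinMk]; ring⟩

theorem aGen_smul_mem_spanST {v : Fin 10 → MvPolynomial (Fin n) ℂ} (i : Fin 4) {x : PolyMap n}
    (hx : x ∈ spanST v) : aGen v i • x ∈ spanST v := by
  induction hx using Submodule.span_induction with
  | mem x hx =>
    obtain ⟨p, rfl⟩ := hx
    obtain ⟨k, hk⟩ := aGen_mul_sGen v i p.1
    refine Submodule.subset_span ⟨(k, p.2), ?_⟩
    simp only [← hk, mul_smul]
  | zero => rw [smul_zero]; exact zero_mem _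
  | add x y _ _ hx hy => rw [smul_add]; exact add_mem hx hy
  | smul r x _ hx => rw [smul_comm]; exact Submodule.smul_mem _ _ hx

end Generators

/-! ### The action of the unipotent matrices in coordinates -/

section Unipotent
open Complex

/-- The element of `𝔰𝔬(4)` with coordinates `x, e, f, y, e', f'`. -/
def kVec (x e f y e' f' : ℂ) : 𝔤 :=
  x • gvec 0 + e • gvec 1 + f • gvec 2 + y • gvec 3 + e' • gvec 4 + f' • gvec 5

/-- The element of `𝔭` with coordinates `r, q, p, s`. -/
def pVec (r q p s : ℂ) : 𝔭 := r • pvec 0 + q • pvec 1 + p • pvec 2 + s • pvec 3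

theorem kVec_eq (x e f y e' f' : ℂ) : kVec x e f y e' f' = kOf
    !![0, I * (x + y), (e + e' - f - f') / 2, I * (-e + e' - f + f') / 2;
      0, 0, -I * (e + e' + f + f') / 2, (-e + e' + f - f') / 2;
      0, 0, 0, I * (x - y); 0, 0, 0, 0] := by
  change x • (gH₁ + gH₂) + e • gE₁ + f • gF₁ + y • (gH₁ - gH₂) + e' • gE₂ + f' • gF₂ = _
  rw [gH₁_eq, gH₂_eq, gE₁_eq, gE₂_eq, gF₁_eq, gF₂_eq]
  simp only [← map_add, ← map_sub, ← map_smul]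
  congr 1
  ext a b
  fin_cases a <;> fin_cases b <;> simp <;> ring

theorem pVec_eq (r q p s : ℂ) : pVec r q p s = pOf ![r + p, I * (p - r), q + s, I * (s - q)] := by
  change r • pE₃ + q • pE₄ + p • pF₃ + s • pF₄ = _
  rw [pE₃_eq, pE₄_eq, pF₃_eq, pF₄_eq]
  simp only [← map_add, ← map_smul]
  congr 1
  ext a
  fin_cases a <;> simp <;> ring

theorem kOf_congr {M N : Mat4} (h : ∀ a b, a < b → M a b - M b a = N a b - N b a) :
    kOf M = kOf N := by
  apply Subtype.ext
  change Matrix.fromBlocks (M - Mᵀ) 0 0 0 = Matrix.fromBlocks (N - Nᵀ) 0 0 0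
  congr 1
  ext a b
  rcases lt_trichotomy a b with hab | rfl | hab
  · exact h a b hab
  · simp
  · simpa using congrArg Neg.neg (h b a hab)

/-- The four one-parameter groups of unipotent matrices: `η` selects one of the two ideals of
`𝔰𝔬(4)`, and `ε = -1`, `ε = 1` the raising and lowering elements. -/
def kUni (η ε u : ℂ) : Mat4 := kMat η 1 (u / 2) (ε * I * (u / 2))

theorem AdC_kVec_raise₁ (u x e f y e' f' : ℂ) : AdC (kUni 1 (-1) u) (kVec x e f y e' f') =
    kVec (x + u * f) (e - 2 * u * x - u ^ 2 * f) f y e' f' := by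
  rw [kVec_eq, kVec_eq, AdC_kOf]
  refine kOf_congr fun a b hab => ?_
  have := I_mul_I
  fin_cases a <;> fin_cases b <;> first | exact absurd hab (by decide) | skip
  all_goals
    simp [kUni, kMat, Matrix.mul_apply, Fin.sum_univ_succ, Matrix.vecMul, dotProduct]
    grind

theorem AdCp_pVec_raise₁ (u r q p s : ℂ) : AdCp (kUni 1 (-1) u) (pVec r q p s) =
    pVec (r + u * s) (q - u * p) p s := by
  rw [pVec_eq, pVec_eq, AdCp_pOf]
  congr 1
  ext a
  have := I_mul_I
  fin_cases a <;> simp [kUni, kMat, Matrix.mulVec, dotProduct, Fin.sum_univ_succ] <;> grind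

theorem AdC_kVec_lower₁ (u x e f y e' f' : ℂ) : AdC (kUni 1 1 u) (kVec x e f y e' f') =
    kVec (x + u * e) e (f - 2 * u * x - u ^ 2 * e) y e' f' := by
  rw [kVec_eq, kVec_eq, AdC_kOf]
  refine kOf_congr fun a b hab => ?_
  have := I_mul_I
  fin_cases a <;> fin_cases b <;> first | exact absurd hab (by decide) | skip
  all_goals
    simp [kUni, kMat, Matrix.mul_apply, Fin.sum_univ_succ, Matrix.vecMul, dotProduct]
    grind

theorem AdCp_pVec_lower₁ (u r q p s : ℂ) : AdCp (kUni 1 1 u) (pVec r q p s) =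
    pVec r q (p + u * q) (s - u * r) := by
  rw [pVec_eq, pVec_eq, AdCp_pOf]
  congr 1
  ext a
  have := I_mul_I
  fin_cases a <;> simp [kUni, kMat, Matrix.mulVec, dotProduct, Fin.sum_univ_succ] <;> grind

theorem AdC_kVec_raise₂ (u x e f y e' f' : ℂ) : AdC (kUni (-1) (-1) u) (kVec x e f y e' f') =
    kVec x e f (y + u * f') (e' - 2 * u * y - u ^ 2 * f') f' := by
  rw [kVec_eq, kVec_eq, AdC_kOf]
  refine kOf_congr fun a b hab => ?_
  have := I_mul_I
  fin_cases a <;> fin_cases b <;> first | exact absurd hab (by decide) | skip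
  all_goals
    simp [kUni, kMat, Matrix.mul_apply, Fin.sum_univ_succ, Matrix.vecMul, dotProduct]
    grind

theorem AdCp_pVec_raise₂ (u r q p s : ℂ) : AdCp (kUni (-1) (-1) u) (pVec r q p s) =
    pVec (r + u * q) q p (s - u * p) := by
  rw [pVec_eq, pVec_eq, AdCp_pOf]
  congr 1
  ext a
  have := I_mul_I
  fin_cases a <;> simp [kUni, kMat, Matrix.mulVec, dotProduct, Fin.sum_univ_succ] <;> grind

theorem AdC_kVec_lower₂ (u x e f y e' f' : ℂ) : AdC (kUni (-1) 1 u) (kVec x e f y e' f') =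
    kVec x e f (y + u * e') e' (f' - 2 * u * y - u ^ 2 * e') := by
  rw [kVec_eq, kVec_eq, AdC_kOf]
  refine kOf_congr fun a b hab => ?_
  have := I_mul_I
  fin_cases a <;> fin_cases b <;> first | exact absurd hab (by decide) | skip
  all_goals
    simp [kUni, kMat, Matrix.mul_apply, Fin.sum_univ_succ, Matrix.vecMul, dotProduct]
    grind

theorem AdCp_pVec_lower₂ (u r q p s : ℂ) : AdCp (kUni (-1) 1 u) (pVec r q p s) =
    pVec r (q - u * r) (p + u * s) s := by
  rw [pVec_eq, pVec_eq, AdCp_pOf]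
  congr 1
  ext a
  have := I_mul_I
  fin_cases a <;> simp [kUni, kMat, Matrix.mulVec, dotProduct, Fin.sum_univ_succ] <;> grind

theorem AdC_neg_one_kVec (x e f y e' f' : ℂ) :
    AdC (-1) (kVec x e f y e' f') = kVec x e f y e' f' := by
  rw [kVec_eq, AdC_kOf]
  simp

theorem AdCp_neg_one (v : 𝔭) : AdCp (-1) v = -v := by
  have h (u : Fin 4 → ℂ) : AdCp (-1) (pOf u) = -pOf u := by
    rw [AdCp_pOf, Matrix.neg_mulVec, Matrix.one_mulVec, map_neg]
  have h' : v = pVec (pBasis.repr v 0) (pBasis.repr v 1) (pBasis.repr v 2) (pBasis.repr v 3) := by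
    conv_lhs => rw [← pBasis.sum_repr v]
    simp only [Fin.sum_univ_four, pBasis_apply]
    rfl
  rw [h', pVec_eq, h]

end Unipotent

/-! ### Restriction to slices -/

section Slices
open MvPolynomial

/-- An element of `𝔤` as a linear polynomial. -/
def linPoly : 𝔤 →ₗ[ℂ] MvPolynomial (Fin 10) ℂ :=
  polyEquiv.toLinearMap ∘ₗ SymmetricAlgebra.ι ℂ 𝔤

theorem linPoly_gvec (i : Fin 10) : linPoly (gvec i) = X i := polyEquiv_ι i

theorem mapEquiv_actC {k : Mat4} {σ : Fin 10 → MvPolynomial (Fin 10) ℂ}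
    (hσ : ∀ i, linPoly (AdC k (gvec i)) = σ i) (x : A) :
    mapEquiv (actC k x) = pull σ (AdCp k) (mapEquiv x) := by
  have h (r : Sg) : polyEquiv (actS k r) = aeval σ (polyEquiv r) := by
    have : (polyEquiv.toAlgHom.comp (actS k)) = (aeval σ).comp polyEquiv.toAlgHom := by
      apply SymmetricAlgebra.algHom_ext
      apply gBasis.ext
      intro i
      simp only [LinearMap.comp_apply, AlgHom.toLinearMap_apply, AlgHom.comp_apply, gBasis_apply]
      change polyEquiv (actS k (SymmetricAlgebra.ι ℂ 𝔤 (gvec i))) =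
        aeval σ (linPoly (gvec i))
      rw [linPoly_gvec, aeval_X, ← hσ]
      simp [actS, linPoly]
    exact DFunLike.congr_fun this r
  induction x using TensorProduct.induction_on with
  | zero => simp only [map_zero]
  | add x y hx hy => simp only [map_add, hx, hy]
  | tmul r w => rw [actC_tmul, mapEquiv_tmul, mapEquiv_tmul, pull_tmul, h]

theorem linPoly_kVec (x e f y e' f' : ℂ) : linPoly (kVec x e f y e' f') =
    C x * X 0 + C e * X 1 + C f * X 2 + C y * X 3 + C e' * X 4 + C f' * X 5 := by
  simp only [kVec, map_add, map_smul, linPoly_gvec, smul_eq_C_mul]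

theorem linPoly_pVec (r q p s : ℂ) :
    linPoly (pVec r q p s) =
    C r * X 6 + C q * X 7 + C p * X 8 + C s * X 9 := by
  simp only [pVec, Submodule.coe_add, Submodule.coe_smul, coe_pvec, map_add, map_smul, linPoly_gvec,
    smul_eq_C_mul]
  rfl

theorem gvec_eq_kVec : gvec 0 = kVec 1 0 0 0 0 0 ∧ gvec 1 = kVec 0 1 0 0 0 0 ∧
    gvec 2 = kVec 0 0 1 0 0 0 ∧ gvec 3 = kVec 0 0 0 1 0 0 ∧ gvec 4 = kVec 0 0 0 0 1 0 ∧
    gvec 5 = kVec 0 0 0 0 0 1 := by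
  simp [kVec]

theorem pvec_eq_pVec : pvec 0 = pVec 1 0 0 0 ∧ pvec 1 = pVec 0 1 0 0 ∧
    pvec 2 = pVec 0 0 1 0 ∧ pvec 3 = pVec 0 0 0 1 := by
  simp [pVec]

theorem gvec_eq_pVec : gvec 6 = pVec 1 0 0 0 ∧ gvec 7 = pVec 0 1 0 0 ∧
    gvec 8 = pVec 0 0 1 0 ∧ gvec 9 = pVec 0 0 0 1 := by
  rw [← pvec_eq_pVec.1, ← pvec_eq_pVec.2.1, ← pvec_eq_pVec.2.2.1, ← pvec_eq_pVec.2.2.2]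
  exact ⟨(coe_pvec 0).symm, (coe_pvec 1).symm, (coe_pvec 2).symm, (coe_pvec 3).symm⟩

/-- To compute the substitution induced by a matrix, it suffices to know its effect on the vectors
`kVec` and `pVec`. -/
theorem pull_mapEquiv_of_fixed {k : Mat4} {σ : Fin 10 → MvPolynomial (Fin 10) ℂ}
    (h : ![linPoly (AdC k (kVec 1 0 0 0 0 0)), linPoly (AdC k (kVec 0 1 0 0 0 0)),
        linPoly (AdC k (kVec 0 0 1 0 0 0)),
      linPoly (AdC k (kVec 0 0 0 1 0 0)), linPoly (AdC k (kVec 0 0 0 0 1 0)),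
          linPoly (AdC k (kVec 0 0 0 0 0 1)),
      linPoly (AdCp k (pVec 1 0 0 0)), linPoly (AdCp k (pVec 0 1 0 0)),
          linPoly (AdCp k (pVec 0 0 1 0)),
      linPoly (AdCp k (pVec 0 0 0 1))] = σ) {x : A} (hx : actC k x = x) :
    pull σ (AdCp k) (mapEquiv x) = mapEquiv x := by
  rw [← mapEquiv_actC, hx]
  subst h
  intro i
  obtain ⟨h0, h1, h2, h3, h4, h5⟩ := gvec_eq_kVec
  obtain ⟨h6, h7, h8, h9⟩ := gvec_eq_pVec
  fin_cases i
  · exact congrArg (fun z => linPoly (AdC k z)) h0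
  · exact congrArg (fun z => linPoly (AdC k z)) h1
  · exact congrArg (fun z => linPoly (AdC k z)) h2
  · exact congrArg (fun z => linPoly (AdC k z)) h3
  · exact congrArg (fun z => linPoly (AdC k z)) h4
  · exact congrArg (fun z => linPoly (AdC k z)) h5
  · exact congrArg (fun z => linPoly (AdC k z)) h6
  · exact congrArg (fun z => linPoly (AdC k z)) h7
  · exact congrArg (fun z => linPoly (AdC k z)) h8
  · exact congrArg (fun z => linPoly (AdC k z)) h9

/-- The substitutions by which the four unipotent one-parameter groups act on `S(𝔤)`. -/
def raise₁ (u : ℂ) : Fin 10 → MvPolynomial (Fin 10) ℂ :=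
  ![X 0 - C (2 * u) * X 1, X 1, X 2 + C u * X 0 - C (u ^ 2) * X 1, X 3, X 4, X 5,
    X 6, X 7, X 8 - C u * X 7, X 9 + C u * X 6]

/-- See `raise₁`. -/
def lower₁ (u : ℂ) : Fin 10 → MvPolynomial (Fin 10) ℂ :=
  ![X 0 - C (2 * u) * X 2, X 1 + C u * X 0 - C (u ^ 2) * X 2, X 2, X 3, X 4, X 5,
    X 6 - C u * X 9, X 7 + C u * X 8, X 8, X 9]

/-- See `raise₁`. -/
def raise₂ (u : ℂ) : Fin 10 → MvPolynomial (Fin 10) ℂ :=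
  ![X 0, X 1, X 2, X 3 - C (2 * u) * X 4, X 4, X 5 + C u * X 3 - C (u ^ 2) * X 4,
    X 6, X 7 + C u * X 6, X 8 - C u * X 9, X 9]

/-- See `raise₁`. -/
def lower₂ (u : ℂ) : Fin 10 → MvPolynomial (Fin 10) ℂ :=
  ![X 0, X 1, X 2, X 3 - C (2 * u) * X 5, X 4 + C u * X 3 - C (u ^ 2) * X 5, X 5,
    X 6 - C u * X 7, X 7, X 8, X 9 + C u * X 8]

/-- The substitution given by `-1 ∈ SO(4)`. -/
def antipode : Fin 10 → MvPolynomial (Fin 10) ℂ :=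
  ![X 0, X 1, X 2, X 3, X 4, X 5, -X 6, -X 7, -X 8, -X 9]

/-- The polynomial maps fixed by the four unipotent one-parameter groups and by `-1`. -/
structure Fixed (F : PolyMap 10) : Prop where
  raise₁ : ∀ u, pull (raise₁ u) (AdCp (kUni 1 (-1) u)) F = F
  lower₁ : ∀ u, pull (lower₁ u) (AdCp (kUni 1 1 u)) F = F
  raise₂ : ∀ u, pull (raise₂ u) (AdCp (kUni (-1) (-1) u)) F = F
  lower₂ : ∀ u, pull (lower₂ u) (AdCp (kUni (-1) 1 u)) F = F
  antipode : pull antipode (AdCp (-1)) F = F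

theorem fixed_mapEquiv {x : A} (hx : x ∈ invariants) : Fixed (mapEquiv x) where
  raise₁ u := by
    refine pull_mapEquiv_of_fixed ?_
      (by
        simpa [kUni] using
          actC_kMat_of_mem_invariants hx (η := 1) (ε := -1) (by simp) (by simp) (u / 2))
    simp only [AdC_kVec_raise₁, AdCp_pVec_raise₁, linPoly_kVec, linPoly_pVec, SO41.raise₁]
    simp [sub_eq_add_neg, add_comm, add_assoc, add_left_comm]
  lower₁ u := by
    refine pull_mapEquiv_of_fixed ?_
      (by
        simpa [kUni] using
          actC_kMat_of_mem_invariants hx (η := 1) (ε := 1) (by simp) (by simp) (u / 2))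
    simp only [AdC_kVec_lower₁, AdCp_pVec_lower₁, linPoly_kVec, linPoly_pVec, SO41.lower₁]
    simp [sub_eq_add_neg, add_comm, add_assoc, add_left_comm]
  raise₂ u := by
    refine pull_mapEquiv_of_fixed ?_
      (by
        simpa [kUni] using
          actC_kMat_of_mem_invariants hx (η := -1) (ε := -1) (by simp)
          (by simp) (u / 2))
    simp only [AdC_kVec_raise₂, AdCp_pVec_raise₂, linPoly_kVec, linPoly_pVec, SO41.raise₂]
    simp [sub_eq_add_neg, add_comm, add_assoc, add_left_comm]
  lower₂ u := by
    refine pull_mapEquiv_of_fixed ?_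
      (by
        simpa [kUni] using
          actC_kMat_of_mem_invariants hx (η := -1) (ε := 1) (by simp) (by simp) (u / 2))
    simp only [AdC_kVec_lower₂, AdCp_pVec_lower₂, linPoly_kVec, linPoly_pVec, SO41.lower₂]
    simp [sub_eq_add_neg, add_comm, add_assoc, add_left_comm]
  antipode := by
    refine pull_mapEquiv_of_fixed ?_ (actC_neg_one_of_mem_invariants hx)
    simp only [AdC_neg_one_kVec, AdCp_neg_one, linPoly_kVec, linPoly_pVec, SO41.antipode]
    simp [linPoly_pVec, sub_eq_add_neg, add_comm, add_assoc, add_left_comm]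

end Slices

section Slices
open MvPolynomial

variable {l m n : ℕ}

/-- The slice of `ℂ¹⁰` on which the first three coordinates are `0, 0, 1`. -/
def slice₁ : Fin 10 → MvPolynomial (Fin 7) ℂ := ![0, 0, 1, X 0, X 1, X 2, X 3, X 4, X 5, X 6]

/-- The slice of `ℂ⁷` on which the first three coordinates are `0, 0, 1`. -/
def slice₂ : Fin 7 → MvPolynomial (Fin 4) ℂ := ![0, 0, 1, X 0, X 1, X 2, X 3]

/-- The slice of `ℂ¹⁰` on which both nilpotents are `0, 0, 1`. -/
def slice : Fin 10 → MvPolynomial (Fin 4) ℂ := ![0, 0, 1, 0, 0, 1, X 0, X 1, X 2, X 3]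

theorem aeval_slice₂_slice₁ : (fun i => aeval slice₂ (slice₁ i)) = slice := by
  ext1 i
  fin_cases i <;> simp [slice₁, slice₂, slice]

/-- The restriction of `raise₁` to the slice `slice₁`. -/
def raise₁' (u : ℂ) : Fin 7 → MvPolynomial (Fin 7) ℂ :=
  ![X 0, X 1, X 2, X 3, X 4, X 5 - C u * X 4, X 6 + C u * X 3]

/-- The restriction of `raise₂` to the slice `slice₁`. -/
def raise₂' (u : ℂ) : Fin 7 → MvPolynomial (Fin 7) ℂ :=
  ![X 0 - C (2 * u) * X 1, X 1, X 2 + C u * X 0 - C (u ^ 2) * X 1,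
    X 3, X 4 + C u * X 3, X 5 - C u * X 6, X 6]

/-- The restriction of `lower₂` to the slice `slice₁`. -/
def lower₂' (u : ℂ) : Fin 7 → MvPolynomial (Fin 7) ℂ :=
  ![X 0 - C (2 * u) * X 2, X 1 + C u * X 0 - C (u ^ 2) * X 2, X 2,
    X 3 - C u * X 4, X 4, X 5, X 6 + C u * X 5]

/-- The restriction of `antipode` to the slice `slice₁`. -/
def antipode' : Fin 7 → MvPolynomial (Fin 7) ℂ := ![X 0, X 1, X 2, -X 3, -X 4, -X 5, -X 6]

/-- The polynomial maps on the first slice fixed by the elements which preserve the slice. -/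
structure Fixed₁ (F : PolyMap 7) : Prop where
  raise₁ : ∀ u, pull (raise₁' u) (AdCp (kUni 1 (-1) u)) F = F
  raise₂ : ∀ u, pull (raise₂' u) (AdCp (kUni (-1) (-1) u)) F = F
  lower₂ : ∀ u, pull (lower₂' u) (AdCp (kUni (-1) 1 u)) F = F
  antipode : pull antipode' (AdCp (-1)) F = F

/-- The polynomial maps on the smallest slice fixed by the elements which preserve the slice. -/
structure Fixed₂ (F : PolyMap 4) : Prop where
  raise₁ : ∀ u, pull (σ₁ u) (AdCp (kUni 1 (-1) u)) F = F
  raise₂ : ∀ u, pull (σ₂ u) (AdCp (kUni (-1) (-1) u)) F = F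
  antipode : pull σneg (AdCp (-1)) F = F

/-- Equivariant maps restrict to equivariant maps on a slice `ρ` preserved by the group. -/
theorem pull_slice {σ : Fin m → MvPolynomial (Fin m) ℂ} {τ : Fin n → MvPolynomial (Fin n) ℂ}
    {ρ : Fin m → MvPolynomial (Fin n) ℂ} (h : ∀ i, aeval τ (ρ i) = aeval ρ (σ i))
    {k : 𝔭 →ₗ[ℂ] 𝔭} {F : PolyMap m} (hF : pull σ k F = F) :
    pull τ k (pull ρ LinearMap.id F) = pull ρ LinearMap.id F := by
  conv_rhs => rw [← hF]
  rw [pull_pull, pull_pull, LinearMap.comp_id, LinearMap.id_comp]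
  simp only [h]

theorem Fixed.restrict {F : PolyMap 10} (hF : Fixed F) : Fixed₁ (pull slice₁ LinearMap.id F) where
  raise₁ u := pull_slice (fun i => by fin_cases i <;> simp [slice₁, raise₁',
      SO41.raise₁]) (hF.raise₁ u)
  raise₂ u := pull_slice (fun i => by fin_cases i <;> simp [slice₁, raise₂',
      SO41.raise₂]) (hF.raise₂ u)
  lower₂ u := pull_slice (fun i => by fin_cases i <;> simp [slice₁, lower₂',
      SO41.lower₂]) (hF.lower₂ u)
  antipode := pull_slice (fun i => by fin_cases i <;> simp [slice₁, antipode',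
      SO41.antipode]) hF.antipode

theorem Fixed₁.restrict {F : PolyMap 7} (hF : Fixed₁ F) : Fixed₂ (pull slice₂ LinearMap.id F) where
  raise₁ u := pull_slice (fun i => by fin_cases i <;> simp [slice₂, raise₁', σ₁]) (hF.raise₁ u)
  raise₂ u := pull_slice (fun i => by fin_cases i <;> simp [slice₂, raise₂', σ₂]) (hF.raise₂ u)
  antipode := pull_slice (fun i => by fin_cases i <;> simp [slice₂, antipode', σneg]) hF.antipode

theorem Fixed.sub {F G : PolyMap 10} (hF : Fixed F) (hG : Fixed G) : Fixed (F - G) where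
  raise₁ u := by rw [map_sub, hF.raise₁, hG.raise₁]
  lower₁ u := by rw [map_sub, hF.lower₁, hG.lower₁]
  raise₂ u := by rw [map_sub, hF.raise₂, hG.raise₂]
  lower₂ u := by rw [map_sub, hF.lower₂, hG.lower₂]
  antipode := by rw [map_sub, hF.antipode, hG.antipode]

theorem Fixed₁.sub {F G : PolyMap 7} (hF : Fixed₁ F) (hG : Fixed₁ G) : Fixed₁ (F - G) where
  raise₁ u := by rw [map_sub, hF.raise₁, hG.raise₁]
  raise₂ u := by rw [map_sub, hF.raise₂, hG.raise₂]
  lower₂ u := by rw [map_sub, hF.lower₂, hG.lower₂]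
  antipode := by rw [map_sub, hF.antipode, hG.antipode]

theorem Fixed₂.sub {F G : PolyMap 4} (hF : Fixed₂ F) (hG : Fixed₂ G) : Fixed₂ (F - G) where
  raise₁ u := by rw [map_sub, hF.raise₁, hG.raise₁]
  raise₂ u := by rw [map_sub, hF.raise₂, hG.raise₂]
  antipode := by rw [map_sub, hF.antipode, hG.antipode]

theorem pull_of_smul {σ : Fin n → MvPolynomial (Fin n) ℂ} {k : 𝔭 →ₗ[ℂ] 𝔭}
    {a : MvPolynomial (Fin n) ℂ} (ha : a ≠ 0) (hσ : aeval σ a = a) {F : PolyMap n}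
    (h : pull σ k (a • F) = a • F) : pull σ k F = F := by
  rw [pull_smul, hσ] at h
  exact smul_left_cancel ha h

theorem isUpper_raise₁ (u : ℂ) : IsUpper (n := 7) (raise₁ u) u := ⟨rfl, rfl, rfl⟩
theorem isLower_lower₁ (u : ℂ) : IsLower (n := 7) (lower₁ u) u := ⟨rfl, rfl, rfl⟩
theorem isUpper_raise₂' (u : ℂ) : IsUpper (n := 4) (raise₂' u) u := ⟨rfl, rfl, rfl⟩
theorem isLower_lower₂' (u : ℂ) : IsLower (n := 4) (lower₂' u) u := ⟨rfl, rfl, rfl⟩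

theorem aeval_quad_of_fixed {σ : Fin (n + 3) → MvPolynomial (Fin (n + 3)) ℂ} (h0 : σ 0 = X 0)
    (h1 : σ 1 = X 1) (h2 : σ 2 = X 2) : aeval σ (quad n) = quad n := by
  simp only [quad, map_add, map_mul, map_pow, aeval_X, map_ofNat, h0, h1, h2]

theorem aGen_X_zero_ne_zero : aGen (X : Fin 10 → MvPolynomial (Fin 10) ℂ) 0 ≠ 0 := quad_ne_zero 7
theorem aGen_slice₁_one_ne_zero : aGen slice₁ 1 ≠ 0 := quad_ne_zero 4

theorem aeval_raise₁ (u : ℂ) : aeval (raise₁ u) (aGen X 0) = aGen X 0 :=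
  (isUpper_raise₁ u).aeval_quad

theorem aeval_lower₁ (u : ℂ) : aeval (lower₁ u) (aGen X 0) = aGen X 0 :=
  (isLower_lower₁ u).aeval_quad

theorem aeval_raise₂ (u : ℂ) : aeval (raise₂ u) (aGen X 0) = aGen X 0 :=
  aeval_quad_of_fixed (n := 7) rfl rfl rfl

theorem aeval_lower₂ (u : ℂ) : aeval (lower₂ u) (aGen X 0) = aGen X 0 :=
  aeval_quad_of_fixed (n := 7) rfl rfl rfl

theorem aeval_antipode : aeval (antipode) (aGen X 0) = aGen X 0 :=
  aeval_quad_of_fixed (n := 7) rfl rfl rfl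

theorem aeval_raise₁' (u : ℂ) : aeval (raise₁' u) (aGen slice₁ 1) = aGen slice₁ 1 :=
  aeval_quad_of_fixed (n := 4) rfl rfl rfl

theorem aeval_raise₂' (u : ℂ) : aeval (raise₂' u) (aGen slice₁ 1) = aGen slice₁ 1 :=
  (isUpper_raise₂' u).aeval_quad

theorem aeval_lower₂' (u : ℂ) : aeval (lower₂' u) (aGen slice₁ 1) = aGen slice₁ 1 :=
  (isLower_lower₂' u).aeval_quad

theorem aeval_antipode' : aeval (antipode') (aGen slice₁ 1) = aGen slice₁ 1 :=
  aeval_quad_of_fixed (n := 4) rfl rfl rfl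

theorem Fixed.of_smul {F : PolyMap 10} (h : Fixed (aGen X 0 • F)) : Fixed F := by
  refine ⟨fun u => ?_, fun u => ?_, fun u => ?_, fun u => ?_, ?_⟩
  · exact pull_of_smul aGen_X_zero_ne_zero (aeval_raise₁ u) (h.raise₁ u)
  · exact pull_of_smul aGen_X_zero_ne_zero (aeval_lower₁ u) (h.lower₁ u)
  · exact pull_of_smul aGen_X_zero_ne_zero (aeval_raise₂ u) (h.raise₂ u)
  · exact pull_of_smul aGen_X_zero_ne_zero (aeval_lower₂ u) (h.lower₂ u)
  · exact pull_of_smul aGen_X_zero_ne_zero aeval_antipode h.antipode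

theorem Fixed₁.of_smul {F : PolyMap 7} (h : Fixed₁ (aGen slice₁ 1 • F)) : Fixed₁ F := by
  refine ⟨fun u => ?_, fun u => ?_, fun u => ?_, ?_⟩
  · exact pull_of_smul aGen_slice₁_one_ne_zero (aeval_raise₁' u) (h.raise₁ u)
  · exact pull_of_smul aGen_slice₁_one_ne_zero (aeval_raise₂' u) (h.raise₂ u)
  · exact pull_of_smul aGen_slice₁_one_ne_zero (aeval_lower₂' u) (h.lower₂ u)
  · exact pull_of_smul aGen_slice₁_one_ne_zero aeval_antipode' h.antipode

theorem evalMap_eq_zero_of_pull {ρ : Fin m → MvPolynomial (Fin n) ℂ} {F : PolyMap m}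
    (h : pull ρ LinearMap.id F = 0) (P : Fin n → ℂ) : evalMap (fun i => eval P (ρ i)) F = 0 := by
  have := evalMap_pull ρ LinearMap.id P F
  rw [h, map_zero, ExteriorAlgebra.map_id] at this
  exact this.symm

theorem Fixed.exists_eq_smul {F : PolyMap 10} (hF : Fixed F)
    (h : pull slice₁ LinearMap.id F = 0) : ∃ F', Fixed F' ∧ F = aGen X 0 • F' := by
  obtain ⟨F', hF'⟩ := exists_eq_quad_smul_of_pull
      (n := 7) isUpper_raise₁ isLower_lower₁ hF.raise₁ hF.lower₁
    fun P h0 h1 h2 => by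
      have hP : (fun i => eval (fun i => P (Fin.natAdd 3 i)) (slice₁ i)) = P := by
        ext1 i
        fin_cases i <;> simp [slice₁, h0, h1, h2]
      have := evalMap_eq_zero_of_pull h (fun i => P (Fin.natAdd 3 i))
      rwa [hP] at this
  have h2 : F = aGen X 0 • F' := hF'
  rw [h2] at hF
  exact ⟨F', hF.of_smul, h2⟩

theorem Fixed₁.exists_eq_smul {F : PolyMap 7} (hF : Fixed₁ F)
    (h : pull slice₂ LinearMap.id F = 0) : ∃ F', Fixed₁ F' ∧ F = aGen slice₁ 1 • F' := by
  obtain ⟨F', hF'⟩ := exists_eq_quad_smul_of_pull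
      (n := 4) isUpper_raise₂' isLower_lower₂' hF.raise₂ hF.lower₂
    fun P h0 h1 h2 => by
      have hP : (fun i => eval (fun i => P (Fin.natAdd 3 i)) (slice₂ i)) = P := by
        ext1 i
        fin_cases i <;> simp [slice₂, h0, h1, h2]
      have := evalMap_eq_zero_of_pull h (fun i => P (Fin.natAdd 3 i))
      rwa [hP] at this
  have h2 : F = aGen slice₁ 1 • F' := hF'
  rw [h2] at hF
  exact ⟨F', hF.of_smul, h2⟩

theorem exists_mapEquiv_eq {F : PolyMap 10} (hF : F ∈ spanST X) :
    ∃ x ∈ invariants, mapEquiv x = F := by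
  induction hF using Submodule.span_induction with
  | mem x hx =>
    obtain ⟨p, rfl⟩ := hx
    exact ⟨_, ((fixed_s _ _ _ _).mul (fixed_t _)).mem_invariants, mapEquiv_s_mul_t p⟩
  | zero => exact ⟨0, zero_mem _, map_zero _⟩
  | add x y _ _ hx hy =>
    obtain ⟨x, hx, rfl⟩ := hx
    obtain ⟨y, hy, rfl⟩ := hy
    exact ⟨x + y, add_mem hx hy, map_add _ _ _⟩
  | smul r x _ hx =>
    obtain ⟨x, hx, rfl⟩ := hx
    exact ⟨r • x, Subalgebra.smul_mem _ hx r, map_smul _ _ _⟩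

theorem fixed_of_mem_spanST {F : PolyMap 10} (hF : F ∈ spanST X) : Fixed F := by
  obtain ⟨x, hx, rfl⟩ := exists_mapEquiv_eq hF
  exact fixed_mapEquiv hx

theorem map_spanST_X : (spanST X).map (pull slice₁ LinearMap.id).toLinearMap = spanST slice₁ := by
  rw [map_spanST]
  simp only [aeval_X]

theorem map_spanST_slice₁ :
    (spanST slice₁).map (pull slice₂ LinearMap.id).toLinearMap = spanST slice := by
  rw [map_spanST, aeval_slice₂_slice₁]

theorem fixed₁_of_mem_spanST {F : PolyMap 7} (hF : F ∈ spanST slice₁) : Fixed₁ F := by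
  rw [← map_spanST_X] at hF
  obtain ⟨F, hF, rfl⟩ := hF
  exact (fixed_of_mem_spanST hF).restrict

theorem fixed₂_of_mem_spanST {F : PolyMap 4} (hF : F ∈ spanST slice) : Fixed₂ F := by
  rw [← map_spanST_slice₁] at hF
  obtain ⟨F, hF, rfl⟩ := hF
  exact (fixed₁_of_mem_spanST hF).restrict

theorem isHomogeneous_X (i : Fin 10) :
    (X i : MvPolynomial (Fin 10) ℂ).IsHomogeneous (degs 1 i) := by
  have h : degs 1 i = 1 := by fin_cases i <;> rfl
  rw [h]
  exact MvPolynomial.isHomogeneous_X _ _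

theorem isHomogeneous_slice₁ (i : Fin 10) : (slice₁ i).IsHomogeneous (degs 0 i) := by
  fin_cases i
  · exact isHomogeneous_zero _ _ _
  · exact isHomogeneous_zero _ _ _
  · exact isHomogeneous_one _ _
  all_goals exact MvPolynomial.isHomogeneous_X _ _

theorem isHomogeneous_quad : (quad n).IsHomogeneous 2 := by
  refine ((MvPolynomial.isHomogeneous_X _ _).pow 2).add ?_
  exact ((isHomogeneous_C _ 4).mul (MvPolynomial.isHomogeneous_X _ _)).mul
    (MvPolynomial.isHomogeneous_X _ _)

/-- Reduction modulo `a₂`: an equivariant map is determined modulo `a₂` by its restriction to the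
smallest slice. -/
theorem Fixed₁.mem_spanST (h : ∀ F, Fixed₂ F → F ∈ spanST slice) {F : PolyMap 7} (hF : Fixed₁ F) :
    F ∈ spanST slice₁ := by
  refine mem_of_mem_add_smul (M := {F | Fixed₁ F}) (a := aGen slice₁ 1)
    (fun d x hx => component_mem_spanST isHomogeneous_slice₁ d hx) (isHomogeneous_quad (n := 4))
    (fun x hx => aGen_smul_mem_spanST 1 hx) (fun x hx => ?_) hF
  have h1 := h _ (Fixed₁.restrict hx)
  rw [← map_spanST_slice₁] at h1
  obtain ⟨q, hq, hqx⟩ := h1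
  obtain ⟨y, hy, hxy⟩ := (Fixed₁.sub hx (fixed₁_of_mem_spanST hq)).exists_eq_smul (by
    rw [map_sub, ← hqx]
    exact sub_self _)
  exact ⟨q, hq, y, hy, by rw [← hxy]; abel⟩

/-- Reduction modulo `a₁`, see `Fixed₁.mem_spanST`. -/
theorem Fixed.mem_spanST (h : ∀ F, Fixed₂ F → F ∈ spanST slice) {F : PolyMap 10} (hF : Fixed F) :
    F ∈ spanST X := by
  refine mem_of_mem_add_smul (M := {F | Fixed F}) (a := aGen X 0)
    (fun d x hx => component_mem_spanST isHomogeneous_X d hx) (isHomogeneous_quad (n := 7))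
    (fun x hx => aGen_smul_mem_spanST 0 hx) (fun x hx => ?_) hF
  have h1 := Fixed₁.mem_spanST h (Fixed.restrict hx)
  rw [← map_spanST_X] at h1
  obtain ⟨q, hq, hqx⟩ := h1
  obtain ⟨y, hy, hxy⟩ := (Fixed.sub hx (fixed_of_mem_spanST hq)).exists_eq_smul (by
    rw [map_sub, ← hqx]
    exact sub_self _)
  exact ⟨q, hq, y, hy, by rw [← hxy]; abel⟩

end Slices

/-! ### Invariants on the smallest slice -/

section Base
open MvPolynomial

theorem ι_pVec (r q p s : ℂ) : ExteriorAlgebra.ι ℂ (pVec r q p s) =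
    r • wE₃ + q • wE₄ + p • wF₃ + s • wF₄ := by
  simp only [pVec, map_add, map_smul]
  rfl

theorem map_raise₁ (u : ℂ) :
    ExteriorAlgebra.map (AdCp (kUni 1 (-1) u)) wE₃ = wE₃ ∧
    ExteriorAlgebra.map (AdCp (kUni 1 (-1) u)) wE₄ = wE₄ ∧
    ExteriorAlgebra.map (AdCp (kUni 1 (-1) u)) wF₃ = wF₃ - u • wE₄ ∧
    ExteriorAlgebra.map (AdCp (kUni 1 (-1) u)) wF₄ = wF₄ + u • wE₃ := by
  have key (r q p s : ℂ) : ExteriorAlgebra.map (AdCp (kUni 1 (-1) u))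
      (r • wE₃ + q • wE₄ + p • wF₃ + s • wF₄) = (r + u * s) • wE₃ +
          (q - u * p) • wE₄ + p • wF₃ + s • wF₄ := by
    rw [← ι_pVec, ← ι_pVec, ExteriorAlgebra.map_apply_ι, AdCp_pVec_raise₁]
  refine ⟨by simpa using key 1 0 0 0, by simpa [add_comm] using key 0 1 0 0, ?_, ?_⟩
  · simpa [sub_eq_add_neg, add_comm] using key 0 0 1 0
  · simpa [add_comm] using key 0 0 0 1

theorem map_raise₂ (u : ℂ) :
    ExteriorAlgebra.map (AdCp (kUni (-1) (-1) u)) wE₃ = wE₃ ∧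
    ExteriorAlgebra.map (AdCp (kUni (-1) (-1) u)) wE₄ = wE₄ + u • wE₃ ∧
    ExteriorAlgebra.map (AdCp (kUni (-1) (-1) u)) wF₃ = wF₃ - u • wF₄ ∧
    ExteriorAlgebra.map (AdCp (kUni (-1) (-1) u)) wF₄ = wF₄ := by
  have key (r q p s : ℂ) : ExteriorAlgebra.map (AdCp (kUni (-1) (-1) u))
      (r • wE₃ + q • wE₄ + p • wF₃ + s • wF₄) = (r + u * q) • wE₃ + q • wE₄ + p • wF₃ +
          (s - u * p) • wF₄ := by
    rw [← ι_pVec, ← ι_pVec, ExteriorAlgebra.map_apply_ι, AdCp_pVec_raise₂]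
  refine ⟨by simpa using key 1 0 0 0, by simpa [add_comm] using key 0 1 0 0, ?_, ?_⟩
  · simpa [sub_eq_add_neg, add_comm] using key 0 0 1 0
  · simpa [add_comm] using key 0 0 0 1

theorem map_antipode (v : 𝔭) : ExteriorAlgebra.map (AdCp (-1)) (ExteriorAlgebra.ι ℂ v) =
    -ExteriorAlgebra.ι ℂ v := by
  rw [ExteriorAlgebra.map_apply_ι, AdCp_neg_one, map_neg]

theorem map_raise₁_wmono (u : ℂ) (k : Fin 16) :
    ExteriorAlgebra.map (AdCp (kUni 1 (-1) u)) (wmono k) =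
    (![wmono 0, wmono 1 - u • wmono 2, wmono 2, wmono 3 + u • wmono 4, wmono 4,
      wmono 5 - u • wmono 7 - u • wmono 8 + u ^ 2 • wmono 9, wmono 6, wmono 7 - u • wmono 9,
      wmono 8 - u • wmono 9, wmono 9, wmono 10, wmono 11 + u • wmono 12, wmono 12,
      wmono 13 - u • wmono 14, wmono 14, wmono 15] : Fin 16 → Λp) k := by
  obtain ⟨h0, h1, h2, h3⟩ := map_raise₁ u
  fin_cases k <;>
    simp only [wmono, Fin.zero_eta, Fin.mk_one, Fin.reduceFinMk, Matrix.cons_val, map_mul, map_one,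
      h0, h1, h2, h3, mul_add, mul_sub, add_mul, sub_mul, mul_assoc, smul_mul_assoc,
      mul_smul_comm, smul_zero, mul_zero, zero_mul, mul_neg, neg_mul, neg_neg, neg_zero, sub_zero,
          add_zero, zero_add, smul_neg, wE₃_sq, wE₃_sq_mul, wE₄_sq, wE₄_sq_mul, wE₄_mul_wE₃,
          wE₄_mul_wE₃_mul, wF₃_sq, wF₃_sq_mul, wF₃_mul_wE₃, wF₃_mul_wE₃_mul, wF₃_mul_wE₄,
          wF₃_mul_wE₄_mul, wF₄_sq, wF₄_sq_mul, wF₄_mul_wE₃, wF₄_mul_wE₃_mul, wF₄_mul_wE₄,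
          wF₄_mul_wE₄_mul, wF₄_mul_wF₃, wF₄_mul_wF₃_mul] <;>
    try module

theorem map_raise₂_wmono (u : ℂ) (k : Fin 16) :
    ExteriorAlgebra.map (AdCp (kUni (-1) (-1) u)) (wmono k) =
    (![wmono 0, wmono 1 - u • wmono 3, wmono 2 + u • wmono 4, wmono 3, wmono 4, wmono 5,
      wmono 6 - u • wmono 7 + u • wmono 8 - u ^ 2 • wmono 10, wmono 7 + u • wmono 10,
      wmono 8 - u • wmono 10, wmono 9, wmono 10, wmono 11 + u • wmono 13,
      wmono 12 - u • wmono 14, wmono 13, wmono 14, wmono 15] : Fin 16 → Λp) k := by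
  obtain ⟨h0, h1, h2, h3⟩ := map_raise₂ u
  fin_cases k <;>
    simp only [wmono, Fin.zero_eta, Fin.mk_one, Fin.reduceFinMk, Matrix.cons_val, map_mul, map_one,
      h0, h1, h2, h3, mul_add, mul_sub, add_mul, sub_mul, mul_assoc, smul_mul_assoc,
      mul_smul_comm, smul_zero, mul_zero, zero_mul, mul_neg, neg_mul, neg_neg, neg_zero, sub_zero,
          add_zero, zero_add, smul_neg, wE₃_sq, wE₃_sq_mul, wE₄_sq, wE₄_sq_mul, wE₄_mul_wE₃,
          wE₄_mul_wE₃_mul, wF₃_sq, wF₃_sq_mul, wF₃_mul_wE₃, wF₃_mul_wE₃_mul, wF₃_mul_wE₄,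
          wF₃_mul_wE₄_mul, wF₄_sq, wF₄_sq_mul, wF₄_mul_wE₃, wF₄_mul_wE₃_mul, wF₄_mul_wE₄,
          wF₄_mul_wE₄_mul, wF₄_mul_wF₃, wF₄_mul_wF₃_mul] <;>
    try module

theorem map_antipode_wmono (k : Fin 16) :
    ExteriorAlgebra.map (AdCp (-1)) (wmono k) =
    (![wmono 0, -wmono 1, -wmono 2, -wmono 3, -wmono 4, wmono 5, wmono 6, wmono 7, wmono 8, wmono 9,
      wmono 10, -wmono 11, -wmono 12, -wmono 13, -wmono 14, wmono 15] : Fin 16 → Λp) k := by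
  have h0 : ExteriorAlgebra.map (AdCp (-1)) wE₃ = -wE₃ := map_antipode _
  have h1 : ExteriorAlgebra.map (AdCp (-1)) wE₄ = -wE₄ := map_antipode _
  have h2 : ExteriorAlgebra.map (AdCp (-1)) wF₃ = -wF₃ := map_antipode _
  have h3 : ExteriorAlgebra.map (AdCp (-1)) wF₄ = -wF₄ := map_antipode _
  fin_cases k <;>
    simp only [wmono, Fin.zero_eta, Fin.mk_one, Fin.reduceFinMk, Matrix.cons_val, map_mul, map_one,
      h0, h1, h2, h3, mul_neg, neg_mul, neg_neg]


section
variable {R V W : Type*} [CommRing R] [Algebra ℂ R] [AddCommGroup V] [Module ℂ V] [AddCommGroup W]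
  [Module ℂ W] [Module R W] [IsScalarTower ℂ R W]

/-- The transpose of the matrix in `map_raise₁_wmono`, acting on coordinates. -/
theorem sum_smul_raise₁ (φ : V →ₗ[ℂ] W) (b : Fin 16 → V) (S : Fin 16 → R) (u : ℂ) :
    ∑ k, S k • φ ((![b 0, b 1 - u • b 2, b 2, b 3 + u • b 4, b 4,
      b 5 - u • b 7 - u • b 8 + u ^ 2 • b 9, b 6, b 7 - u • b 9, b 8 - u • b 9, b 9, b 10,
      b 11 + u • b 12, b 12, b 13 - u • b 14, b 14, b 15] : Fin 16 → V) k) =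
    ∑ k, (![S 0, S 1, S 2 - u • S 1, S 3, S 4 + u • S 3, S 5, S 6, S 7 - u • S 5, S 8 - u • S 5,
      S 9 + u ^ 2 • S 5 - u • S 7 - u • S 8, S 10, S 11, S 12 + u • S 11, S 13, S 14 - u • S 13,
      S 15] : Fin 16 → R) k • φ (b k) := by
  have h1 (x : W) : u • x = algebraMap ℂ R u • x := (algebraMap_smul R u x).symm
  have h2 (x : W) : u ^ 2 • x = algebraMap ℂ R u ^ 2 • x := by
    rw [← map_pow, algebraMap_smul]
  simp only [Fin.sum_univ_succ, Fin.sum_univ_zero, Matrix.cons_val_zero, Matrix.cons_val_succ]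
  simp only [Fin.succ_zero_eq_one, Fin.reduceSucc, map_add, map_sub, map_smul, Algebra.smul_def,
      map_pow, h1, h2]
  module

/-- The transpose of the matrix in `map_raise₂_wmono`, acting on coordinates. -/
theorem sum_smul_raise₂ (φ : V →ₗ[ℂ] W) (b : Fin 16 → V) (S : Fin 16 → R) (u : ℂ) :
    ∑ k, S k • φ ((![b 0, b 1 - u • b 3, b 2 + u • b 4, b 3, b 4, b 5,
      b 6 - u • b 7 + u • b 8 - u ^ 2 • b 10, b 7 + u • b 10, b 8 - u • b 10, b 9, b 10,
      b 11 + u • b 13, b 12 - u • b 14, b 13, b 14, b 15] : Fin 16 → V) k) =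
    ∑ k, (![S 0, S 1, S 2, S 3 - u • S 1, S 4 + u • S 2, S 5, S 6, S 7 - u • S 6, S 8 + u • S 6,
      S 9, S 10 - u ^ 2 • S 6 + u • S 7 - u • S 8, S 11, S 12, S 13 + u • S 11, S 14 - u • S 12,
      S 15] : Fin 16 → R) k • φ (b k) := by
  have h1 (x : W) : u • x = algebraMap ℂ R u • x := (algebraMap_smul R u x).symm
  have h2 (x : W) : u ^ 2 • x = algebraMap ℂ R u ^ 2 • x := by
    rw [← map_pow, algebraMap_smul]
  simp only [Fin.sum_univ_succ, Fin.sum_univ_zero, Matrix.cons_val_zero, Matrix.cons_val_succ]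
  simp only [Fin.succ_zero_eq_one, Fin.reduceSucc, map_add, map_sub, map_smul, Algebra.smul_def,
      map_pow, h1, h2]
  module

end

theorem sum_smul_antipode {R V W : Type*} [CommRing R] [AddCommGroup V] [Module ℂ V]
    [AddCommGroup W] [Module ℂ W] [Module R W] (φ : V →ₗ[ℂ] W) (b : Fin 16 → V) (S : Fin 16 → R) :
    ∑ k, S k • φ ((![b 0, -b 1, -b 2, -b 3, -b 4, b 5, b 6, b 7, b 8, b 9, b 10, -b 11, -b 12,
        -b 13,
      -b 14, b 15] : Fin 16 → V) k) =
    ∑ k, (![S 0, -S 1, -S 2, -S 3, -S 4, S 5, S 6, S 7, S 8, S 9, S 10, -S 11, -S 12, -S 13,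
      -S 14, S 15] : Fin 16 → R) k • φ (b k) := by
  simp only [Fin.sum_univ_succ, Fin.sum_univ_zero, Matrix.cons_val_zero, Matrix.cons_val_succ]
  simp only [Fin.succ_zero_eq_one, Fin.reduceSucc, map_add, map_sub, map_neg, map_smul]
  module

end Base

section Base
open MvPolynomial

variable {n : ℕ}

/-- The coordinates of a polynomial map in the basis `wmono`. -/
def coord (F : PolyMap n) (k : Fin 16) : MvPolynomial (Fin n) ℂ := (mapBasis n).repr F k

instance isScalarTower_polyMap : IsScalarTower ℂ (MvPolynomial (Fin n) ℂ) (PolyMap n) :=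
  TensorProduct.isScalarTower_left

/-- The constant polynomial maps. -/
def constMap (n : ℕ) : Λp →ₗ[ℂ] PolyMap n := TensorProduct.mk ℂ (MvPolynomial (Fin n) ℂ) Λp 1

theorem constMap_apply (w : Λp) : constMap n w = 1 ⊗ₜ w := rfl

theorem mapBasis_apply (k : Fin 16) : mapBasis n k = constMap n (wmono k) := by
  rw [mapBasis, Algebra.TensorProduct.basis_apply, wBasis_apply, constMap_apply]

theorem coord_sum (y : Fin 16 → MvPolynomial (Fin n) ℂ) :
    coord (∑ k, y k • constMap n (wmono k)) = y := by
  have h : ∑ k, y k • constMap n (wmono k) = ∑ k, y k • mapBasis n k :=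
    Finset.sum_congr rfl fun k _ => by rw [mapBasis_apply]
  rw [h]
  exact (mapBasis n).repr_sum_self y

theorem sum_coord (F : PolyMap n) : ∑ k, coord F k • constMap n (wmono k) = F := by
  have := (mapBasis n).sum_repr F
  simp only [mapBasis_apply] at this
  exact this

theorem coord_pull {σ : Fin n → MvPolynomial (Fin n) ℂ} {l : 𝔭 →ₗ[ℂ] 𝔭} {w : Fin 16 → Λp}
    (hw : ∀ k, ExteriorAlgebra.map l (wmono k) = w k)
    {F : PolyMap n} {y : Fin 16 → MvPolynomial (Fin n) ℂ}
    (h : ∑ k, aeval σ (coord F k) • constMap n (w k) = ∑ k, y k • constMap n (wmono k)) :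
    coord (pull σ l F) = y := by
  rw [← coord_sum y, ← h]
  congr 1
  conv_lhs => rw [← sum_coord F, map_sum]
  simp only [pull_smul, constMap_apply, pull_tmul, map_one, hw]

theorem coord_raise₁ {F : PolyMap 4} (hF : Fixed₂ F) (u : ℂ) : coord F =
    let S k := aeval (σ₁ u) (coord F k)
    ![S 0, S 1, S 2 - u • S 1, S 3, S 4 + u • S 3, S 5, S 6, S 7 - u • S 5, S 8 - u • S 5,
      S 9 + u ^ 2 • S 5 - u • S 7 - u • S 8, S 10, S 11, S 12 + u • S 11, S 13,
      S 14 - u • S 13, S 15] := by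
  conv_lhs => rw [← hF.raise₁ u]
  exact coord_pull (map_raise₁_wmono u)
    (sum_smul_raise₁ (constMap 4) wmono (fun k => aeval (σ₁ u) (coord F k)) u)

theorem coord_raise₂ {F : PolyMap 4} (hF : Fixed₂ F) (u : ℂ) : coord F =
    let S k := aeval (σ₂ u) (coord F k)
    ![S 0, S 1, S 2, S 3 - u • S 1, S 4 + u • S 2, S 5, S 6, S 7 - u • S 6, S 8 + u • S 6,
      S 9, S 10 - u ^ 2 • S 6 + u • S 7 - u • S 8, S 11, S 12, S 13 + u • S 11,
      S 14 - u • S 12, S 15] := by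
  conv_lhs => rw [← hF.raise₂ u]
  exact coord_pull (map_raise₂_wmono u)
    (sum_smul_raise₂ (constMap 4) wmono (fun k => aeval (σ₂ u) (coord F k)) u)

theorem coord_antipode {F : PolyMap 4} (hF : Fixed₂ F) : coord F =
    let S k := aeval σneg (coord F k)
    ![S 0, -S 1, -S 2, -S 3, -S 4, S 5, S 6, S 7, S 8, S 9, S 10, -S 11, -S 12, -S 13,
      -S 14, S 15] := by
  conv_lhs => rw [← hF.antipode]
  exact coord_pull (map_antipode_wmono)
    (sum_smul_antipode (constMap 4) wmono (fun k => aeval (σneg) (coord F k)))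

/-- As the group acts on coordinates by unitriangular matrices, the first nonzero coordinate of an
equivariant map is an invariant polynomial. -/
theorem aeval_σ₁_coord {F : PolyMap 4} (hF : Fixed₂ F) {k : Fin 16} (h : ∀ j < k, coord F j = 0)
    (u : ℂ) : aeval (σ₁ u) (coord F k) = coord F k := by
  conv_rhs => rw [coord_raise₁ hF u]
  have h0 : ∀ j < k, aeval (σ₁ u) (coord F j) = 0 := fun j hj => by rw [h j hj, map_zero]
  clear h
  fin_cases k <;>
    simp only [Fin.zero_eta, Fin.mk_one, Fin.reduceFinMk, Matrix.cons_val] at h0 ⊢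
  · rw [h0 1 (by decide)]; simp
  · rw [h0 3 (by decide)]; simp
  · rw [h0 5 (by decide)]; simp
  · rw [h0 5 (by decide)]; simp
  · rw [h0 5 (by decide), h0 7 (by decide), h0 8 (by decide)]; simp
  · rw [h0 11 (by decide)]; simp
  · rw [h0 13 (by decide)]; simp

/-- See `aeval_σ₁_coord`. -/
theorem aeval_σ₂_coord {F : PolyMap 4} (hF : Fixed₂ F) {k : Fin 16} (h : ∀ j < k, coord F j = 0)
    (u : ℂ) : aeval (σ₂ u) (coord F k) = coord F k := by
  conv_rhs => rw [coord_raise₂ hF u]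
  have h0 : ∀ j < k, aeval (σ₂ u) (coord F j) = 0 := fun j hj => by rw [h j hj, map_zero]
  clear h
  fin_cases k <;>
    simp only [Fin.zero_eta, Fin.mk_one, Fin.reduceFinMk, Matrix.cons_val] at h0 ⊢
  · rw [h0 1 (by decide)]; simp
  · rw [h0 2 (by decide)]; simp
  · rw [h0 6 (by decide)]; simp
  · rw [h0 6 (by decide)]; simp
  · rw [h0 6 (by decide), h0 7 (by decide), h0 8 (by decide)]; simp
  · rw [h0 11 (by decide)]; simp
  · rw [h0 12 (by decide)]; simp

/-- Over the points with `E₃ = 0`, a product of the two unipotent elements fixes the point and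
forces the vanishing of four of the coordinates of degree two. -/
theorem X_dvd_coord {F : PolyMap 4} (hF : Fixed₂ F) {k : Fin 16} (hk : 5 ≤ k) (hk' : k ≤ 8) :
    X 0 ∣ coord F k := by
  refine X_dvd_of_eval (q := X 1 * X 3) ?_ fun P h0 hP => ?_
  · rw [map_mul, aeval_X, aeval_X]
    exact mul_ne_zero (X_ne_zero 0) (X_ne_zero 2)
  rw [map_mul, eval_X, eval_X] at hP
  -- at such a point, parameters `P 3` and `-P 1` give an element fixing it
  have h1 := left_ne_zero_of_mul hP
  have h3 := right_ne_zero_of_mul hP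
  have e1 (j : Fin 16) := congrArg (eval P) (congrFun (coord_raise₁ hF (P 3)) j)
  have e2 (j : Fin 16) := congrArg (eval fun k => eval P (σ₁ (P 3) k))
    (congrFun (coord_raise₂ hF (-P 1)) j)
  have hP2 : (fun k => eval (fun k => eval P (σ₁ (P 3) k)) (σ₂ (-P 1) k)) = P := by
    ext k
    fin_cases k
    · simp [σ₁, σ₂]
    · simp [σ₁, σ₂, h0]
    · simp [σ₁, σ₂, h0]; ring
    · simp [σ₁, σ₂, h0]
  have a5 := e1 5; have a6 := e1 6; have a7 := e1 7; have a8 := e1 8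
  have a9 := e1 9; have a10 := e1 10
  have c5 := e2 5; have c6 := e2 6; have c7 := e2 7; have c8 := e2 8
  have c9 := e2 9; have c10 := e2 10
  simp only [Matrix.cons_val, map_add, map_sub, map_mul, map_pow, smul_eval, eval_aeval, hP2]
    at a5 a6 a7 a8 a9 a10 c5 c6 c7 c8 c9 c10
  have x5 : eval P (coord F 5) = 0 := by
    refine (mul_eq_zero.1 ?_).resolve_left h3
    grind
  have x6 : eval P (coord F 6) = 0 := by
    refine (mul_eq_zero.1 ?_).resolve_left h1
    grind
  have x7 : P 3 * (eval P (coord F 7) + eval P (coord F 8)) = 0 := by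
    grind
  have x8 : P 1 * (eval P (coord F 7) - eval P (coord F 8)) = 0 := by
    grind
  have x7' := (mul_eq_zero.1 x7).resolve_left h3
  have x8' := (mul_eq_zero.1 x8).resolve_left h1
  have hk : k = 5 ∨ k = 6 ∨ k = 7 ∨ k = 8 := by
    revert hk hk'; revert k; decide
  rcases hk with rfl | rfl | rfl | rfl
  · exact x5
  · exact x6
  · linear_combination (x7' + x8') / 2
  · linear_combination (x7' - x8') / 2

/-- The leading coefficients of the elements of `T` on the smallest slice, in the order of their
leading monomials. -/
def lead : Fin 16 → MvPolynomial (Fin 4) ℂ :=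
  ![1, X 0, X 0, X 0, X 0, X 0 ^ 2, X 0 ^ 2, X 0 ^ 2, X 0 ^ 2, 1, 1, X 0, X 0, X 0, X 0, 1]

/-- The possible leading terms of equivariant maps on the smallest slice. -/
theorem exists_coord_eq_lead_mul {F : PolyMap 4} (hF : Fixed₂ F) {k : Fin 16}
    (h : ∀ j < k, coord F j = 0) : ∃ q ∈ evenInv, coord F k = lead k * q := by
  have h1 := aeval_σ₁_coord hF h
  have h2 := aeval_σ₂_coord hF h
  have h3 := congrFun (coord_antipode hF) k
  have h4 : 5 ≤ k → k ≤ 8 → X 0 ∣ coord F k := X_dvd_coord hF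
  have even (h3 : coord F k = aeval σneg (coord F k)) : ∃ q ∈ evenInv, coord F k = 1 * q :=
    ⟨_, mem_evenInv h1 h2 h3.symm, (one_mul _).symm⟩
  have odd (h3 : coord F k = -aeval σneg (coord F k)) : ∃ q ∈ evenInv, coord F k = X 0 * q :=
    exists_eq_X_mul h1 h2 (neg_eq_iff_eq_neg.1 h3.symm)
  have sq (h3 : coord F k = aeval σneg (coord F k)) (h4 : X 0 ∣ coord F k) :
      ∃ q ∈ evenInv, coord F k = X 0 ^ 2 * q := exists_eq_X_sq_mul h1 h2 h3.symm h4
  clear h h1 h2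
  fin_cases k
  exacts [even h3, odd h3, odd h3, odd h3, odd h3, sq h3 (h4 (by decide) (by decide)),
    sq h3 (h4 (by decide) (by decide)), sq h3 (h4 (by decide) (by decide)),
    sq h3 (h4 (by decide) (by decide)), even h3, even h3, odd h3, odd h3, odd h3, odd h3, even h3]

end Base

section Base
open MvPolynomial

variable {n : ℕ}

theorem coord_add (F G : PolyMap n) (j : Fin 16) : coord (F + G) j = coord F j + coord G j := by
  simp only [coord, map_add, Finsupp.add_apply]

theorem coord_zero (j : Fin 16) : coord (0 : PolyMap n) j = 0 := by
  simp only [coord, map_zero, Finsupp.zero_apply]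

theorem coord_sub (F G : PolyMap n) (j : Fin 16) : coord (F - G) j = coord F j - coord G j := by
  simp only [coord, map_sub, Finsupp.sub_apply]

theorem coord_neg (F : PolyMap n) (j : Fin 16) : coord (-F) j = -coord F j := by
  simp only [coord, map_neg, Finsupp.neg_apply]

theorem coord_poly_smul (p : MvPolynomial (Fin n) ℂ) (F : PolyMap n) (j : Fin 16) :
    coord (p • F) j = p * coord F j := by
  simp only [coord, map_smul, Finsupp.smul_apply, smul_eq_mul]

theorem coord_smul (z : ℂ) (F : PolyMap n) (j : Fin 16) : coord (z • F) j = z • coord F j := by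
  rw [← algebraMap_smul (MvPolynomial (Fin n) ℂ) z F, coord_poly_smul, Algebra.smul_def]

theorem coord_tmul (p : MvPolynomial (Fin n) ℂ) (l j : Fin 16) :
    coord (p ⊗ₜ wmono l) j = if l = j then p else 0 := by
  rw [coord, mapBasis_repr_tmul, ← wBasis_apply, Module.Basis.repr_self, Finsupp.single_apply]
  split_ifs <;> simp

section
variable (p : MvPolynomial (Fin n) ℂ) (j : Fin 16)
theorem coord_one : coord (1 : PolyMap n) j = if 0 = j then 1 else 0 := coord_tmul 1 0 j
theorem coord_F₃ : coord (p ⊗ₜ wF₃) j = if 1 = j then p else 0 := coord_tmul p 1 j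
theorem coord_E₄ : coord (p ⊗ₜ wE₄) j = if 2 = j then p else 0 := coord_tmul p 2 j
theorem coord_F₄ : coord (p ⊗ₜ wF₄) j = if 3 = j then p else 0 := coord_tmul p 3 j
theorem coord_E₃ : coord (p ⊗ₜ wE₃) j = if 4 = j then p else 0 := coord_tmul p 4 j
theorem coord_F₃F₄ : coord (p ⊗ₜ (wF₃ * wF₄)) j = if 5 = j then p else 0 := coord_tmul p 5 j
theorem coord_E₄F₃ : coord (p ⊗ₜ (wE₄ * wF₃)) j = if 6 = j then p else 0 := coord_tmul p 6 j
theorem coord_E₄F₄ : coord (p ⊗ₜ (wE₄ * wF₄)) j = if 7 = j then p else 0 := coord_tmul p 7 j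
theorem coord_E₃F₃ : coord (p ⊗ₜ (wE₃ * wF₃)) j = if 8 = j then p else 0 := coord_tmul p 8 j
theorem coord_E₃E₄ : coord (p ⊗ₜ (wE₃ * wE₄)) j = if 9 = j then p else 0 := coord_tmul p 9 j
theorem coord_E₃F₄ : coord (p ⊗ₜ (wE₃ * wF₄)) j = if 10 = j then p else 0 := coord_tmul p 10 j
theorem coord_E₄F₃F₄ : coord (p ⊗ₜ (wE₄ * (wF₃ * wF₄))) j = if 11 = j then p else 0 := by
  rw [← mul_assoc]; exact coord_tmul p 11 j
theorem coord_E₃E₄F₃ : coord (p ⊗ₜ (wE₃ * (wE₄ * wF₃))) j = if 12 = j then p else 0 := by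
  rw [← mul_assoc]; exact coord_tmul p 12 j
theorem coord_E₃F₃F₄ : coord (p ⊗ₜ (wE₃ * (wF₃ * wF₄))) j = if 13 = j then p else 0 := by
  rw [← mul_assoc]; exact coord_tmul p 13 j
theorem coord_E₃E₄F₄ : coord (p ⊗ₜ (wE₃ * (wE₄ * wF₄))) j = if 14 = j then p else 0 := by
  rw [← mul_assoc]; exact coord_tmul p 14 j
theorem coord_top : coord (p ⊗ₜ (wE₃ * (wE₄ * (wF₃ * wF₄)))) j = if 15 = j then p else 0 := by
  rw [← mul_assoc, ← mul_assoc]; exact coord_tmul p 15 j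
end

theorem DGen_slice : DGen slice = X 0 ⊗ₜ wF₃ + X 1 ⊗ₜ wF₄ + X 2 ⊗ₜ wE₃ + X 3 ⊗ₜ wE₄ := rfl

theorem dGen_slice : dGen slice = (-2 : ℂ) • (1 ⊗ₜ (wE₃ * wE₄)) := by
  simp [dGen, slice]
  exact (neg_smul (2 : ℂ) (1 ⊗ₜ (wE₃ * wE₄) : PolyMap 4)).symm

theorem eGen_slice : eGen slice = (2 : ℂ) • (1 ⊗ₜ (wE₃ * wF₄)) := by
  simp [eGen, slice]

theorem fGen_slice : fGen slice = (-2 : ℂ) • (X 0 ⊗ₜ wE₄ - X 1 ⊗ₜ wE₃) := by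
  simp [fGen, slice]
  exact (neg_smul (2 : ℂ) (X 0 ⊗ₜ wE₄ - X 1 ⊗ₜ wE₃ : PolyMap 4)).symm

theorem jGen_slice : jGen slice = X 0 ⊗ₜ (wE₄ * wF₃ * wF₄) - X 1 ⊗ₜ (wE₃ * wF₃ * wF₄)
    + X 2 ⊗ₜ (wE₃ * wE₄ * wF₄) - X 3 ⊗ₜ (wE₃ * wE₄ * wF₃) := rfl

theorem gGen_slice : gGen slice = (2 : ℂ) • (X 0 ⊗ₜ wF₄ - X 3 ⊗ₜ wE₃) := by
  simp [gGen, slice]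

theorem hGen_slice : hGen slice = (2 : ℂ) • (X 0 ⊗ₜ wE₃) := by
  simp [hGen, slice]

/-! ### Leading terms and freeness -/

/-- The position in the list `T` of the element with leading monomial `wmono k` on the smallest
slice. -/
def position : Fin 16 → Fin 16 := ![0, 1, 4, 5, 6, 12, 11, 13, 14, 2, 3, 8, 9, 10, 15, 7]

/-- The constant factors of the leading terms, see `coord_tGen_slice`. -/
def leadConst : Fin 16 → ℂ := ![1, 1, -2, 2, 2, 2, 2, -4, -2, -2, 2, 1, -2, -2, -4, 1]

theorem leadConst_ne_zero (k : Fin 16) : leadConst k ≠ 0 := by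
  fin_cases k <;> simp [leadConst]

/-- On the smallest slice, the elements of `T` have distinct leading monomials. -/
theorem coord_tGen_slice (k j : Fin 16) (hj : j ≤ k) :
    coord (tGen slice (position k)) j = if k = j then leadConst k • lead k else 0 := by
  have hne (l : Fin 16) (hl : k < l) : l ≠ j := (lt_of_le_of_lt hj hl).ne'
  fin_cases k <;>
    simp only [Fin.zero_eta, Fin.mk_one, Fin.reduceFinMk] at hj hne ⊢ <;>
    simp only [tGen, position, leadConst, lead, Matrix.cons_val, DGen_slice, dGen_slice, eGen_slice,
      fGen_slice, gGen_slice, hGen_slice, jGen_slice, mul_add, mul_sub, add_mul, sub_mul, mul_neg,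
          neg_mul,
      smul_mul_assoc, mul_smul_comm, Algebra.TensorProduct.tmul_mul_tmul, one_mul, mul_one,
          mul_assoc, wE₃_sq, wE₃_sq_mul, wE₄_sq, wE₄_sq_mul, wE₄_mul_wE₃, wE₄_mul_wE₃_mul, wF₃_sq,
          wF₃_sq_mul, wF₃_mul_wE₃, wF₃_mul_wE₃_mul, wF₃_mul_wE₄, wF₃_mul_wE₄_mul, wF₄_sq,
          wF₄_sq_mul, wF₄_mul_wE₃, wF₄_mul_wE₃_mul, wF₄_mul_wE₄, wF₄_mul_wE₄_mul, wF₄_mul_wF₃,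
          wF₄_mul_wF₃_mul,
      TensorProduct.tmul_neg, TensorProduct.tmul_zero, smul_zero, mul_zero,
      coord_add, coord_sub, coord_neg, coord_zero, coord_smul, coord_one, coord_F₃, coord_E₄,
          coord_F₄,
      coord_E₃, coord_F₃F₄, coord_E₄F₃, coord_E₄F₄, coord_E₃F₃, coord_E₃E₄, coord_E₃F₄,
      coord_E₄F₃F₄, coord_E₃E₄F₃, coord_E₃F₃F₄, coord_E₃E₄F₄, coord_top]
  all_goals
    try simp only [hne, Fin.reduceLT, ite_false, neg_zero, add_zero, zero_add, sub_zero,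
      smul_zero, neg_neg]
    split_ifs
    · simp only [Algebra.smul_def, map_neg, map_ofNat, map_one]; try ring
    · simp
end Base

section Base
open MvPolynomial

variable {m n : ℕ}

theorem aGen_slice_two : aGen slice 2 = bPoly := by
  simp [aGen, slice, bPoly]

theorem aGen_slice_three : aGen slice 3 = (2 : ℂ) • X 0 ^ 2 := by
  simp [aGen, slice, Algebra.smul_def]
  exact (map_ofNat C 2).symm

theorem tGen_mem_spanST (v : Fin 10 → MvPolynomial (Fin n) ℂ) (k : Fin 16) :
    tGen v k ∈ spanST v := by
  refine Submodule.subset_span ⟨((0, 0, 0, 0), k), ?_⟩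
  simp only [sGen, pow_zero, mul_one, one_smul]

theorem evenInv_smul_mem_spanST {q : MvPolynomial (Fin 4) ℂ} (hq : q ∈ evenInv) :
    ∀ {x : PolyMap 4}, x ∈ spanST slice → q • x ∈ spanST slice := by
  induction hq using Algebra.adjoin_induction with
  | mem q hq =>
    intro x hx
    rcases hq with rfl | rfl
    · rw [← aGen_slice_two]
      exact aGen_smul_mem_spanST 2 hx
    · have h : (X 0 ^ 2 : MvPolynomial (Fin 4) ℂ) = (2⁻¹ : ℂ) • aGen slice 3 := by
        rw [aGen_slice_three, smul_smul, inv_mul_cancel₀ two_ne_zero, one_smul]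
      rw [h, smul_assoc]
      exact Submodule.smul_mem _ _ (aGen_smul_mem_spanST 3 hx)
  | algebraMap r =>
    intro x hx
    rw [algebraMap_smul]
    exact Submodule.smul_mem _ r hx
  | add p q _ _ hp hq =>
    intro x hx
    rw [add_smul]
    exact add_mem (hp hx) (hq hx)
  | mul p q _ _ hp hq =>
    intro x hx
    rw [mul_smul]
    exact hp (hq hx)

/-- Division of the leading term: the coordinates of `F` are removed one after the other. -/
theorem mem_spanST_of_coord_eq_zero (k : ℕ) : ∀ {F : PolyMap 4}, Fixed₂ F →
    (∀ j : Fin 16, j + k < 16 → coord F j = 0) → F ∈ spanST slice := by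
  induction k with
  | zero =>
    intro F _ h
    have : F = 0 := by
      rw [← sum_coord F]
      exact Finset.sum_eq_zero fun j _ => by rw [h j j.2, zero_smul]
    rw [this]
    exact zero_mem _
  | succ k ih =>
    intro F hF h
    by_cases hk : 16 ≤ k
    · exact ih hF fun j hj => absurd hj (by omega)
    let l : Fin 16 := ⟨15 - k, by omega⟩
    obtain ⟨q, hq, hFq⟩ := exists_coord_eq_lead_mul hF (k := l) fun j hj => h j (by
      rw [Fin.lt_def] at hj; change (j : ℕ) < 15 - k at hj; omega)
    have hG : ((leadConst l)⁻¹ • q) • tGen slice (position l) ∈ spanST slice :=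
      evenInv_smul_mem_spanST (evenInv.smul_mem hq _) (tGen_mem_spanST _ _)
    have hFG := ih (hF.sub (fixed₂_of_mem_spanST hG)) fun j hj => by
      have hjl : j ≤ l := by
        rw [Fin.le_def]; change (j : ℕ) ≤ 15 - k; omega
      rw [coord_sub, coord_poly_smul, coord_tGen_slice l j hjl]
      split_ifs with hlj
      · rw [← hlj, hFq, smul_mul_smul_comm, inv_mul_cancel₀ (leadConst_ne_zero l), one_smul,
          mul_comm, sub_self]
      · rw [h j (by
          have : (j : ℕ) ≠ 15 - k := fun h => hlj (Fin.ext h.symm)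
          rw [Fin.le_def] at hjl; change (j : ℕ) ≤ 15 - k at hjl; omega), mul_zero, sub_zero]
    have := add_mem hFG hG
    rwa [sub_add_cancel] at this

theorem Fixed₂.mem_spanST {F : PolyMap 4} (hF : Fixed₂ F) : F ∈ spanST slice :=
  mem_spanST_of_coord_eq_zero 16 hF fun j hj => absurd hj (by omega)

theorem coord_pull_id (σ : Fin m → MvPolynomial (Fin n) ℂ) (F : PolyMap m) (j : Fin 16) :
    coord (pull σ LinearMap.id F) j = aeval σ (coord F j) := by
  have h : pull σ LinearMap.id F = ∑ k, aeval σ (coord F k) • constMap n (wmono k) := by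
    conv_lhs => rw [← sum_coord F, map_sum]
    simp only [pull_smul, constMap_apply, pull_id_tmul, map_one]
  rw [h, coord_sum]

/-- The matrix of the sixteen elements of `T` in the basis `wmono`. -/
def coordMatrix (v : Fin 10 → MvPolynomial (Fin n) ℂ) :
    Matrix (Fin 16) (Fin 16) (MvPolynomial (Fin n) ℂ) := fun k j => coord (tGen v k) j

theorem lead_ne_zero (k : Fin 16) : lead k ≠ 0 := by
  have h0 : (X 0 : MvPolynomial (Fin 4) ℂ) ≠ 0 := X_ne_zero 0
  have h1 : (1 : MvPolynomial (Fin 4) ℂ) ≠ 0 := one_ne_zero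
  have h2 : (X 0 : MvPolynomial (Fin 4) ℂ) ^ 2 ≠ 0 := pow_ne_zero 2 h0
  fin_cases k
  exacts [h1, h0, h0, h0, h0, h2, h2, h2, h2, h1, h1, h0, h0, h0, h0, h1]

theorem det_coordMatrix_slice_ne_zero : (coordMatrix slice).det ≠ 0 := by
  intro h
  have h1 := Matrix.det_permute (Equiv.ofBijective position (by decide)) (coordMatrix slice)
  rw [h, mul_zero, Matrix.det_of_isUpperTriangular fun k j hjk => ?_] at h1
  · obtain ⟨k, -, hk⟩ := Finset.prod_eq_zero_iff.1 h1
    have h2 : coord (tGen slice (position k)) k = 0 := hk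
    rw [coord_tGen_slice k k le_rfl, if_pos rfl] at h2
    exact smul_ne_zero (leadConst_ne_zero k) (lead_ne_zero k) h2
  · have := coord_tGen_slice k j (le_of_lt hjk)
    rwa [if_neg (show k ≠ j from ne_of_gt hjk)] at this

theorem det_coordMatrix_X_ne_zero : (coordMatrix (X : Fin 10 → MvPolynomial
    (Fin 10) ℂ)).det ≠ 0 := by
  intro h
  apply det_coordMatrix_slice_ne_zero
  have h1 := congrArg (aeval slice).toRingHom h
  rw [RingHom.map_det, map_zero] at h1
  rw [← h1]
  congr 1
  refine funext fun k => funext fun j => ?_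
  have := coord_pull_id slice (tGen X k) j
  rw [pull_tGen] at this
  simp only [aeval_X] at this
  exact this

/-- The elements of `T` are linearly independent even over the polynomials. -/
theorem linearIndependent_tGen :
    LinearIndependent (MvPolynomial (Fin 10) ℂ) (tGen (n := 10) X) := by
  rw [Fintype.linearIndependent_iff]
  intro p hp
  refine congrFun (Matrix.eq_zero_of_vecMul_eq_zero det_coordMatrix_X_ne_zero ?_)
  ext1 j
  have h1 := congrArg (fun F => coord F j) hp
  have h2 : coord (∑ k, p k • tGen X k) j = ∑ k, coord (p k • tGen X k) j := by
    simp only [coord, map_sum, Finsupp.finsetSum_apply]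
  simp only [coord_poly_smul] at h2
  exact h2.symm.trans (h1.trans (coord_zero j))

/-- The map given by `a₁`, `a₂`, `b`, `c` is onto `ℂ⁴`. -/
theorem exists_eval_aGen (y : Fin 4 → ℂ) :
    ∃ P : Fin 10 → ℂ, (fun k => eval P (aGen X k)) = y := by
  obtain ⟨r, hr⟩ := IsAlgClosed.exists_pow_nat_eq (y 3 / 2 + y 0 / 4 + y 1 * y 2 ^ 2 / 4) two_pos
  refine ⟨![0, y 0 / 4, 1, 0, y 1 / 4, 1, r, y 2, 0, 1], ?_⟩
  ext1 k
  fin_cases k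
  · simp [aGen]; ring
  · simp [aGen]; ring
  · simp [aGen]
  · simp [aGen]
    rw [hr]
    ring

theorem algebraicIndependent_aGen : AlgebraicIndependent ℂ (aGen (n := 10) X) := by
  rw [algebraicIndependent_iff]
  intro p hp
  refine MvPolynomial.funext fun y => ?_
  obtain ⟨P, rfl⟩ := exists_eval_aGen y
  have := congrArg (eval P) hp
  rw [eval_aeval] at this
  rw [this, map_zero, map_zero]

theorem linearIndependent_sGen : LinearIndependent ℂ (sGen (n := 10) X) := by
  let ex (k : ℕ × ℕ × ℕ × ℕ) : Fin 4 →₀ ℕ :=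
    Finsupp.equivFunOnFinite.symm ![k.1, k.2.1, k.2.2.1, k.2.2.2]
  have hex : Function.Injective ex := fun k l h => by
    have h := congrFun (Finsupp.equivFunOnFinite.symm.injective h)
    have h0 := h 0; have h1 := h 1; have h2 := h 2; have h3 := h 3
    simp only [Matrix.cons_val] at h0 h1 h2 h3
    ext <;> assumption
  have h1 := ((basisMonomials (Fin 4) ℂ).linearIndependent.comp ex hex).map'
    (aeval (aGen (n := 10) X)).toLinearMap (LinearMap.ker_eq_bot.2 algebraicIndependent_aGen)
  have h2 : (aeval (aGen (n := 10) X)).toLinearMap ∘ basisMonomials (Fin 4) ℂ ∘ ex = sGen X := by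
    funext k
    simp only [Function.comp_apply, coe_basisMonomials, AlgHom.toLinearMap_apply, aeval_monomial,
      map_one, one_mul]
    rw [Finsupp.prod_fintype _ _ fun _ => pow_zero _]
    simp [ex, Fin.prod_univ_four, sGen]
  rw [h2] at h1
  exact h1

theorem linearIndependent_of_map {ι V W : Type*} [AddCommGroup V] [AddCommGroup W] [Module ℂ V]
    [Module ℂ W] (φ : V ≃ₗ[ℂ] W) {u : ι → V} {w : ι → W} (h : ∀ p, φ (u p) = w p)
    (hw : LinearIndependent ℂ w) : LinearIndependent ℂ u := by
  rw [← funext h] at hw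
  exact hw.of_comp φ.toLinearMap

theorem linearIndependent_s_mul_t : LinearIndependent ℂ
    fun p : (ℕ × ℕ × ℕ × ℕ) × Fin 16 => s p.1.1 p.1.2.1 p.1.2.2.1 p.1.2.2.2 * t p.2 := by
  have h := linearIndependent_smul linearIndependent_sGen linearIndependent_tGen
  exact linearIndependent_of_map mapEquiv.toLinearEquiv mapEquiv_s_mul_t h

theorem S_mul_T_eq_range : S * T = Set.range
    fun p : (ℕ × ℕ × ℕ × ℕ) × Fin 16 => s p.1.1 p.1.2.1 p.1.2.2.1 p.1.2.2.2 * t p.2 := by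
  rw [T_eq_range]
  ext x
  constructor
  · rintro ⟨_, ⟨n₁, n₂, n₃, n₄, rfl⟩, _, ⟨k, rfl⟩, rfl⟩
    exact ⟨((n₁, n₂, n₃, n₄), k), rfl⟩
  · rintro ⟨p, rfl⟩
    exact ⟨_, ⟨_, _, _, _, rfl⟩, _, ⟨p.2, rfl⟩, rfl⟩

theorem mem_span_range_of_map {ι V W : Type*} [AddCommGroup V] [AddCommGroup W] [Module ℂ V]
    [Module ℂ W] (φ : V ≃ₗ[ℂ] W) {u : ι → V} {w : ι → W} (h : ∀ p, φ (u p) = w p) {x : V}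
    (hx : φ x ∈ Submodule.span ℂ (Set.range w)) : x ∈ Submodule.span ℂ (Set.range u) := by
  rw [← funext h, Set.range_comp', ← LinearEquiv.coe_coe, ← Submodule.map_span] at hx
  obtain ⟨y, hy, hyx⟩ := hx
  rwa [← φ.injective hyx]

theorem span_S_mul_T : Submodule.span ℂ (S * T) = Subalgebra.toSubmodule invariants := by
  rw [S_mul_T_eq_range]
  apply le_antisymm
  · rw [Submodule.span_le]
    rintro _ ⟨p, rfl⟩
    exact ((fixed_s _ _ _ _).mul (fixed_t _)).mem_invariants
  · rintro x (hx : x ∈ invariants)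
    have h1 := (fixed_mapEquiv hx).mem_spanST fun F hF => hF.mem_spanST
    exact mem_span_range_of_map mapEquiv.toLinearEquiv mapEquiv_s_mul_t h1

end Base

end SO41

end

/-- `S` and `T` consist of invariants, the products of their elements (indexed by the four exponents
and the position in the list `T`, so in particular pairwise distinct) are linearly independent, and
the set `S * T` of all products is a basis of `(S(𝔤) ⊗ Λ(𝔭))^K` over `ℂ`. -/
theorem mainTheorem2 :
    SO41.S ⊆ (SO41.invariants : Set SO41.A) ∧
    SO41.T ⊆ (SO41.invariants : Set SO41.A) ∧
    LinearIndependent ℂ (fun p : (ℕ × ℕ × ℕ × ℕ) × Fin 16 =>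
      SO41.s p.1.1 p.1.2.1 p.1.2.2.1 p.1.2.2.2 * SO41.t p.2) ∧
    LinearIndepOn ℂ id (SO41.S * SO41.T) ∧
    Submodule.span ℂ (SO41.S * SO41.T) = Subalgebra.toSubmodule SO41.invariants := by
  refine ⟨?_, ?_, SO41.linearIndependent_s_mul_t, ?_, SO41.span_S_mul_T⟩
  · rintro _ ⟨n₁, n₂, n₃, n₄, rfl⟩
    exact (SO41.fixed_s n₁ n₂ n₃ n₄).mem_invariants
  · rw [SO41.T_eq_range]
    rintro _ ⟨k, rfl⟩
    exact (SO41.fixed_t k).mem_invariants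
  · rw [SO41.S_mul_T_eq_range]
    exact SO41.linearIndependent_s_mul_t.linearIndepOn_id
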